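/- Let $(\Omega,d,\mu)$ be a locally compact, non-complete metric measure space with $\mu$ a doubling Borel measure, i.e. there is $C_\mu\ge 1$ with $0<\mu(B(x,2r))\le C_\mu\,\mu(B(x,r))<\infty$ for all $x\in\Omega$, $r>0$. Let $\overline\Omega$ be the completion of $\Omega$ and $\partial\Omega=\overline\Omega\setminus\Omega$. Suppose that $\Omega$ is a uniform domain in $\overline\Omega$: there is $A\ge 1$ such that all $x,y\in\Omega$ are joined by a curve $\gamma$ in $\Omega$ with $\operatorname{diam}(\gamma)\le A\,d(x,y)$ and $\min\{\operatorname{diam}(\gamma_{x,z}),\operatorname{diam}(\gamma_{z,y})\}\le A\,d(z,\partial\Omega)$ for every point $z$ of $\gamma$, where $\gamma_{x,z}$, $\gamma_{z,y}$ are the subcurves from $x$ to $z$ and from $z$ to $y$. Let $\theta>0$ and let $\nu$ be a Borel measure on $\partial\Omega$ that is codimension $\theta$ Ahlfors regular with respect to $\mu$: there is $C_\theta\ge1$ with $$C_\theta^{-1}\,\frac{\mu(B(z,r)\cap\Omega)}{r^\theta}\le\nu(B(z,r)\cap\partial\Omega)\le C_\theta\,\frac{\mu(B(z,r)\cap\Omega)}{r^\theta}\qquad(z\in\partial\Omega,\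 0<r\le 2\operatorname{diam}(\partial\Omega)).$$ Let $1\le p<\infty$, $1\le q\le\infty$, $\alpha>0$ and $\alpha+\theta/p<1$. For a metric measure space $(Y,m)$ and $0<s<1$, $HB^s_{p,q}(Y,m)$ is the set of $u\in L^1_{\rm loc}(Y,m)$ with $$\|u\|_{HB^s_{p,q}(Y,m)}=\left(\int_0^\infty\Big(\int_Y{-\mkern-19mu\int}_{B(x,t)}|u(y)-u(x)|^p\,dm(y)\,dm(x)\Big)^{q/p}\frac{dt}{t^{sq+1}}\right)^{1/q}<\infty$$ (where ${-\mkern-19mu\int}$ denotes the mean value integral; for $q=\infty$, the supremum over $t>0$ of $t^{-s}$ times the $1/p$-th power of the inner double integral), and $B^s_{p,q}(Y,m)=HB^s_{p,q}(Y,m)\cap L^p(Y,m)$. Let $\{B_j=B(p_j,r_j)\}_j$ be a countable Whitney cover of $\Omega$: $\bigcup_jB_j=\Omega$, $r_j=\tfrac18 d(p_j,\partial\Omega)$, the balls $2B_j$ have bounded overlap, and, grouping the balls into generations by $2^{i-1}<r_j\le 2^i$, the centres of generation $i\in\mathbb Z$ are $2^i/C$-separated and for each $K\ge1$ the balls $KB_j$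 of one generation have overlap bounded independently of $i$. Let $\{\varphi_j\}_j$ be a subordinate partition of unity: $\varphi_j$ is $C/r_j$-Lipschitz, $0\le\varphi_j\le\chi_{2B_j}$, $\sum_j\varphi_j=1$ on $\Omega$. Let $q_j\in\partial\Omega$ be a point closest to $p_j$, $U_j=B(q_j,r_j)\cap\partial\Omega$, and let $\Phi:\Omega\to[0,1]$ be $1$-Lipschitz with $\Phi=1$ on $\{d(\cdot,\partial\Omega)\le1\}$ and $\Phi=0$ on $\{d(\cdot,\partial\Omega)>2\}$. Such data exist, and for $f\in HB^\alpha_{p,q}(\partial\Omega,\nu)$ one sets $$\widetilde Ef=\sum_j\Big({-\mkern-19mu\int}_{U_j}f\,d\nu\Big)\varphi_j,\qquad Ef=\Phi\,\widetilde Ef .$$ Say that $g:\partial\Omega\to\mathbb R$ is a trace of $u$ if $\lim_{r\to0^+}{-\mkern-19mu\int}_{B(z,r)\cap\Omega}|u-g(z)|^p\,d\mu=0$ for $\nu$-a.e. $z\in\partial\Omega$, and let $T$ be the trace operator $Tu(z)=\lim_{r\to0^+}{-\mkern-19mu\int}_{B(z,r)\cap\Omega}u\,d\mu$. Then, for every choice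 of the data above: 1. for every $f\in B^\alpha_{p,q}(\partial\Omega,\nu)$, one has $Ef\in B^{\alpha+\theta/p}_{p,q}(\Omega,\mu)$, the function $TEf$ is a trace of $Ef$, and $TEf(z)=f(z)$ for $\nu$-a.e. $z\in\partial\Omega$; moreover every trace of $Ef$ equals $f$ $\nu$-a.e.; 2. for every $f\in HB^\alpha_{p,q}(\partial\Omega,\nu)$ (in particular for every $f\in B^\alpha_{p,q}(\partial\Omega,\nu)$), one has $\widetilde Ef\in HB^{\alpha+\theta/p}_{p,q}(\Omega,\mu)$, the function $T\widetilde Ef$ is a trace of $\widetilde Ef$, and $T\widetilde Ef(z)=f(z)$ for $\nu$-a.e. $z\in\partial\Omega$; moreover every trace of $\widetilde Ef$ equals $f$ $\nu$-a.e. -/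

import Mathlib

open MeasureTheory Set Filter Topology UniformSpace
open scoped NNReal ENNReal

/-! ### The completion of a metric space and its boundary -/

/-- The completion of a metric space is equipped with its Borel σ-algebra. -/
instance completionMeasurableSpace (Ω : Type*) [MetricSpace Ω] :
    MeasurableSpace (Completion Ω) := borel _

instance completionBorelSpace (Ω : Type*) [MetricSpace Ω] : BorelSpace (Completion Ω) := ⟨rfl⟩

/-- The boundary `∂Ω = closure(Ω) \ Ω`, where `closure(Ω)` is the completion of `Ω`. -/
def boundarySet (Ω : Type*) [MetricSpace Ω] : Set (Completion Ω) :=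
  (Set.range ((↑) : Ω → Completion Ω))ᶜ

/-- `∂Ω` as a metric space (with its Borel σ-algebra). -/
abbrev Boundary (Ω : Type*) [MetricSpace Ω] : Type _ := ↥(boundarySet Ω)

/-- `B(z, r) ∩ Ω` for a boundary point `z`, as a subset of `Ω`. -/
def trBall {Ω : Type*} [MetricSpace Ω] (z : Boundary Ω) (r : ℝ) : Set Ω :=
  {x : Ω | dist (x : Completion Ω) (z : Completion Ω) < r}

/-- `d(x, ∂Ω)` for `x ∈ Ω`. -/
noncomputable def bdryDist {Ω : Type*} [MetricSpace Ω] (x : Ω) : ℝ :=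
  Metric.infDist (x : Completion Ω) (boundarySet Ω)

/-! ### Doubling, codimensional Ahlfors regularity, uniform domains -/

/-- `μ` is a doubling measure: `0 < μ(B(x,2r)) ≤ C μ(B(x,r)) < ∞` for all balls. -/
def IsDoubling {Y : Type*} [MetricSpace Y] [MeasurableSpace Y] (μ : Measure Y) : Prop :=
  ∃ C : ℝ≥0, 1 ≤ C ∧ ∀ (x : Y) (r : ℝ), 0 < r →
    0 < μ (Metric.ball x (2 * r)) ∧
    μ (Metric.ball x (2 * r)) ≤ C * μ (Metric.ball x r) ∧
    μ (Metric.ball x r) < ∞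

/-- `ν` (on `∂Ω`) is codimension `θ` Ahlfors regular with respect to `μ` (on `Ω`):
`ν(B(z,r) ∩ ∂Ω) ≃ μ(B(z,r) ∩ Ω) / r ^ θ` for `z ∈ ∂Ω` and `0 < r ≤ 2 diam(∂Ω)`. -/
def IsCodimRegular {Ω : Type*} [MetricSpace Ω] [MeasurableSpace Ω]
    (μ : Measure Ω) (ν : Measure (Boundary Ω)) (θ : ℝ) : Prop :=
  ∃ C : ℝ≥0, 1 ≤ C ∧ ∀ (z : Boundary Ω) (r : ℝ), 0 < r →
    ENNReal.ofReal r ≤ 2 * Metric.ediam (Set.univ : Set (Boundary Ω)) →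
    (C : ℝ≥0∞)⁻¹ * (μ (trBall z r) / ENNReal.ofReal (r ^ θ)) ≤ ν (Metric.ball z r) ∧
    ν (Metric.ball z r) ≤ C * (μ (trBall z r) / ENNReal.ofReal (r ^ θ))

/-- `Ω` is a uniform domain in its completion (diameter version, arbitrary continuous curves). -/
def IsUniformDomain (Ω : Type*) [MetricSpace Ω] : Prop :=
  ∃ A : ℝ, 1 ≤ A ∧ ∀ x y : Ω, ∃ γ : Path x y,
    Metric.diam (Set.range γ) ≤ A * dist x y ∧
    ∀ s : unitInterval,
      min (Metric.diam (γ '' Set.Iic s)) (Metric.diam (γ '' Set.Ici s)) ≤ A * bdryDist (γ s)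

/-! ### Besov spaces on a metric measure space -/

/-- `∫_Y ⨍_{B(x,t)} |u(y) - u(x)|^p dμ(y) dμ(x)`. -/
noncomputable def besovOsc {Y : Type*} [MetricSpace Y] [MeasurableSpace Y] (μ : Measure Y)
    (p : ℝ) (u : Y → ℝ) (t : ℝ) : ℝ≥0∞ :=
  ∫⁻ x, ⨍⁻ y in Metric.ball x t, ‖u y - u x‖ₑ ^ p ∂μ ∂μ

open Classical in
/-- The Besov seminorm `‖u‖_{HB^α_{p,q}(Y,μ)}`, with the supremum when `q = ∞`. -/
noncomputable def besovEnergy {Y : Type*} [MetricSpace Y] [MeasurableSpace Y] (μ : Measure Y)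
    (α p : ℝ) (q : ℝ≥0∞) (u : Y → ℝ) : ℝ≥0∞ :=
  if q = ∞ then
    ⨆ (t : ℝ) (_ : 0 < t), ENNReal.ofReal (t ^ (-α)) * besovOsc μ p u t ^ (1 / p)
  else
    (∫⁻ t in Set.Ioi (0 : ℝ), besovOsc μ p u t ^ (q.toReal / p) *
      ENNReal.ofReal (t ^ (-(α * q.toReal + 1)))) ^ (1 / q.toReal)

/-- The homogeneous Besov space: `u ∈ HB^α_{p,q}(Y,μ)`. -/
def MemHB {Y : Type*} [MetricSpace Y] [MeasurableSpace Y] (μ : Measure Y)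
    (α p : ℝ) (q : ℝ≥0∞) (u : Y → ℝ) : Prop :=
  LocallyIntegrable u μ ∧ besovEnergy μ α p q u < ∞

/-- The inhomogeneous Besov space: `u ∈ B^α_{p,q}(Y,μ) = HB^α_{p,q}(Y,μ) ∩ L^p(Y,μ)`. -/
def MemBesov {Y : Type*} [MetricSpace Y] [MeasurableSpace Y] (μ : Measure Y)
    (α p : ℝ) (q : ℝ≥0∞) (u : Y → ℝ) : Prop :=
  MemHB μ α p q u ∧ MemLp u (ENNReal.ofReal p) μ

/-! ### Traces -/

/-- `g` is a trace of `u` on `∂Ω`: for `ν`-a.e. `z ∈ ∂Ω`,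
`⨍_{B(z,r)} |u - g(z)|^p dμ → 0` as `r → 0⁺`. -/
def HasTrace {Ω : Type*} [MetricSpace Ω] [MeasurableSpace Ω] (μ : Measure Ω)
    (ν : Measure (Boundary Ω)) (p : ℝ) (u : Ω → ℝ) (g : Boundary Ω → ℝ) : Prop :=
  ∀ᵐ z ∂ν, Tendsto (fun r : ℝ => ⨍⁻ x in trBall z r, ‖u x - g z‖ₑ ^ p ∂μ) (𝓝[>] 0) (𝓝 0)

/-- The trace operator, `Tu(z) = lim_{r → 0⁺} ⨍_{B(z,r)} u dμ`. -/
noncomputable def traceOp {Ω : Type*} [MetricSpace Ω] [MeasurableSpace Ω] (μ : Measure Ω)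
    (u : Ω → ℝ) (z : Boundary Ω) : ℝ :=
  limUnder (𝓝[>] (0 : ℝ)) (fun r : ℝ => ⨍ x in trBall z r, u x ∂μ)

/-! ### Whitney extension -/

/-- A Whitney cover of `Ω` (inside its completion) by balls `B_j = B(p_j, r_j)`, together with
closest boundary points `q_j`, a subordinate Lipschitz partition of unity `φ_j`, and a Lipschitz
cutoff function `Φ`. The index set is split into the generations `level j ∈ ℤ`. -/
structure WhitneyData (Ω : Type*) [MetricSpace Ω] (ι : Type) where
  /-- the centres `p_j` -/
  center : ι → Ω
  /-- the radii `r_j` -/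
  radius : ι → ℝ
  /-- the generation of the ball `B_j` -/
  level : ι → ℤ
  cover : ∀ x : Ω, ∃ j, x ∈ Metric.ball (center j) (radius j)
  overlap : ∃ N : ℕ, ∀ x : Ω, {j | x ∈ Metric.ball (center j) (2 * radius j)}.encard ≤ N
  level_lt : ∀ j, (2 : ℝ) ^ (level j - 1) < radius j
  le_level : ∀ j, radius j ≤ (2 : ℝ) ^ level j
  radius_eq : ∀ j, radius j = bdryDist (center j) / 8
  separated : ∃ C : ℝ, 1 ≤ C ∧ ∀ j k, j ≠ k → level j = level k →
    (2 : ℝ) ^ level j / C ≤ dist (center j) (center k)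
  level_overlap : ∀ K : ℝ, 1 ≤ K → ∃ N : ℕ, ∀ (i : ℤ) (x : Ω),
    {j | level j = i ∧ x ∈ Metric.ball (center j) (K * radius j)}.encard ≤ N
  /-- the closest boundary points `q_j` -/
  closest : ι → Boundary Ω
  dist_closest : ∀ j,
    dist (center j : Completion Ω) (closest j : Completion Ω) = bdryDist (center j)
  /-- the partition of unity `φ_j` -/
  pou : ι → Ω → ℝ
  pou_nonneg : ∀ j x, 0 ≤ pou j x
  pou_le_one : ∀ j x, pou j x ≤ 1
  pou_support : ∀ j x, x ∉ Metric.ball (center j) (2 * radius j) → pou j x = 0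
  pou_sum : ∀ x, HasSum (fun j => pou j x) 1
  pou_lipschitz : ∃ C : ℝ, ∀ j x y, |pou j x - pou j y| ≤ C / radius j * dist x y
  /-- the cutoff function `Φ` -/
  cutoff : Ω → ℝ
  cutoff_nonneg : ∀ x, 0 ≤ cutoff x
  cutoff_le_one : ∀ x, cutoff x ≤ 1
  cutoff_lipschitz : LipschitzWith 1 cutoff
  cutoff_eq_one : ∀ x, bdryDist x ≤ 1 → cutoff x = 1
  cutoff_eq_zero : ∀ x, 2 < bdryDist x → cutoff x = 0

/-- The homogeneous extension `Ẽf = ∑_j (⨍_{U_j} f dν) φ_j`, with `U_j = B(q_j, r_j) ∩ ∂Ω`. -/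
noncomputable def WhitneyData.homExt {Ω : Type*} [MetricSpace Ω] {ι : Type}
    (W : WhitneyData Ω ι) (ν : Measure (Boundary Ω)) (f : Boundary Ω → ℝ) (x : Ω) : ℝ :=
  ∑' j, (⨍ z in Metric.ball (W.closest j) (W.radius j), f z ∂ν) * W.pou j x

/-- The inhomogeneous extension `Ef = Φ · Ẽf`. -/
noncomputable def WhitneyData.ext {Ω : Type*} [MetricSpace Ω] {ι : Type}
    (W : WhitneyData Ω ι) (ν : Measure (Boundary Ω)) (f : Boundary Ω → ℝ) (x : Ω) : ℝ :=
  W.cutoff x * W.homExt ν f x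

/-! Let `a j` be the mean of `f` over `U_j`. At each point the extension `Ẽf = ∑ a_j φ_j` is a
convex combination of the `a j` of the Whitney balls nearby, so its oscillation is governed by
differences `a k - a j`. Fix `t` in `[2^i, 2^(i+1))` and split `Ω` according to whether `d(x, ∂Ω) <
11 t`.

Near the boundary only pairs of balls of radius at most `3t` whose closest points are within `50t`
interact. Jensen's inequality turns `|a_k - a_j|^p` into a mean of `|f(b) - f(a)|^p` over `U_j ×
U_k`. Codimension regularity gives `μ(2B_j) ≲ r_j^θ ν(U_j)`, and a boundary point lies in boundedly
many `U_j` of each generation, so a sum over the balls of radius at most `3t` is geometric and costs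
`t^θ`. Two such sums, and one comparison of `μ(B(p_j,t))` with `t^θ ν(B(a,60t))`, leave `t^θ` times
the oscillation of `f` at scale `60t` (`exists_near_le`, `exists_pairEnergy_le`).

Away from the boundary the Lipschitz bound of the partition of unity gains a factor `t / r_j`, so
generation `i + n` contributes `2^(-np)` times the same boundary quantity at scale `2^(i+n)`
(`exists_far_le`, `exists_layerEnergy_le`). With `s = α + θ/p` one has `sp = αp + θ`, so the factor
`t^θ` is exactly the shift of smoothness. The remaining series has ratio `2^(-(p - sp))`, which is
less than one because `s < 1`, and the discrete Hardy inequality `SeqFin.hardy` finishes the energy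
estimate.

If `∂Ω` is bounded, the estimate is used for small scales only. Balls larger than the diameter all
carry the same mean `c`, `Ẽf - c` lies in `L^p`, and large scales are bounded by its norm. If `∂Ω`
is one point, `Ẽf` is constant.

For the trace, finite energy makes the dyadic oscillations of `f` summable, so almost every boundary
point is a Lebesgue point of order `p` (`ae_tsum` is replaced by
`ae_tendsto_setLAverage_of_energy`), and the mean of `|Ẽf - f(z)|^p` on `B(z,r) ∩ Ω` is controlled
by that of `|f - f(z)|^p` on a comparable boundary ball. The cutoff `Φ` equals one near `∂Ω`, hence
does not change traces, and costs one product-rule term bounded through the `L^p` norm of `Ẽf` on a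
strip. -/

/-! ### Geometry of the completion and consequences of doubling. -/

section Geometry

variable {Ω : Type*} [MetricSpace Ω]

/-- The points of `Ω` at distance less than `r` from a point `w` of the completion. -/
def tracedBall (w : Completion Ω) (r : ℝ) : Set Ω := {x : Ω | dist (x : Completion Ω) w < r}

lemma mem_tracedBall {w : Completion Ω} {r : ℝ} {x : Ω} :
    x ∈ tracedBall w r ↔ dist (x : Completion Ω) w < r := Iff.rfl

lemma tracedBall_coe (x : Ω) (r : ℝ) : tracedBall (x : Completion Ω) r = Metric.ball x r := by
  ext y; simp [tracedBall, Completion.dist_eq]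

lemma trBall_eq_tracedBall (z : Boundary Ω) (r : ℝ) :
    trBall z r = tracedBall (z : Completion Ω) r := rfl

lemma isOpen_tracedBall (w : Completion Ω) (r : ℝ) : IsOpen (tracedBall w r) :=
  isOpen_lt ((Completion.continuous_coe Ω).dist continuous_const) continuous_const

lemma tracedBall_subset {w w' : Completion Ω} {s r : ℝ} (h : s + dist w w' ≤ r) :
    tracedBall w s ⊆ tracedBall w' r := fun x hx => by
  have := dist_triangle (x : Completion Ω) w w'
  rw [mem_tracedBall] at hx ⊢
  linarith

lemma exists_dist_coe_lt (w : Completion Ω) {r : ℝ} (hr : 0 < r) :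
    ∃ x : Ω, dist (x : Completion Ω) w < r := by
  obtain ⟨x, hx⟩ := (Completion.denseRange_coe (α := Ω)).exists_dist_lt w hr
  exact ⟨x, by rwa [dist_comm]⟩

/-- Every set contains a maximal `r`-separated subset. -/
lemma exists_maximal_separated {X : Type*} [MetricSpace X] (A : Set X) {r : ℝ} (hr : 0 < r) :
    ∃ S ⊆ A, S.Pairwise (fun x y => r ≤ dist x y) ∧ ∀ x ∈ A, ∃ y ∈ S, dist x y < r := by
  obtain ⟨S, hS⟩ := zorn_subset {S : Set X | S ⊆ A ∧ S.Pairwise (fun x y => r ≤ dist x y)} (by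
    intro c hc hchain
    refine ⟨⋃₀ c, ⟨sUnion_subset fun s hs => (hc hs).1, ?_⟩, fun s hs => subset_sUnion_of_mem hs⟩
    exact (pairwise_sUnion hchain.directedOn).2 fun s hs => (hc hs).2)
  refine ⟨S, hS.prop.1, hS.prop.2, fun x hx => ?_⟩
  by_contra! hcon
  have hxS : insert x S ⊆ S := hS.le_of_ge (y := insert x S)
    ⟨insert_subset hx hS.prop.1, hS.prop.2.insert fun y hy _ =>
      ⟨hcon y hy, by rw [dist_comm]; exact hcon y hy⟩⟩ (subset_insert x S)
  have := hcon x (hxS (mem_insert x S))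
  simp at this
  linarith

/-- A compact neighbourhood `K` of `x` has compact, hence closed, image in the completion. Points of
the completion close to `x` are limits of points of `K`, so they lie in that image. -/
lemma isOpen_range_coe_completion [LocallyCompactSpace Ω] :
    IsOpen (Set.range ((↑) : Ω → Completion Ω)) := by
  rw [Metric.isOpen_iff]
  rintro _ ⟨x, rfl⟩
  obtain ⟨K, hK, hKx⟩ := exists_compact_mem_nhds x
  obtain ⟨r, hr, hrK⟩ := Metric.mem_nhds_iff.1 hKx
  refine ⟨r, hr, fun z hz => ?_⟩
  have hc : IsClosed (((↑) : Ω → Completion Ω) '' K) :=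
    (hK.image (Completion.continuous_coe Ω)).isClosed
  have hz' : z ∈ closure (((↑) : Ω → Completion Ω) '' K) := by
    rw [Metric.mem_closure_iff]
    intro ε hε
    rw [Metric.mem_ball] at hz
    obtain ⟨y, hy⟩ := exists_dist_coe_lt z (lt_min hε (sub_pos.2 hz))
    refine ⟨y, ⟨y, hrK ?_, rfl⟩, ?_⟩
    · rw [Metric.mem_ball, ← Completion.dist_eq]
      have := dist_triangle (y : Completion Ω) z x
      have := min_le_right ε (r - dist z x)
      linarith
    · rw [dist_comm]
      exact hy.trans_le (min_le_left _ _)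
  rw [hc.closure_eq] at hz'
  exact image_subset_range _ _ hz'

lemma isClosed_boundarySet [LocallyCompactSpace Ω] : IsClosed (boundarySet Ω) :=
  isOpen_range_coe_completion.isClosed_compl

lemma nonempty_boundarySet (hΩ : ¬ CompleteSpace Ω) : (boundarySet Ω).Nonempty := by
  rw [boundarySet, nonempty_compl]
  intro h
  apply hΩ
  have h2 : IsComplete (Set.range ((↑) : Ω → Completion Ω)) := by
    rw [h]; exact completeSpace_iff_isComplete_univ.1 (inferInstanceAs (CompleteSpace (Completion Ω)))
  exact (completeSpace_iff_isComplete_range (Completion.isUniformInducing_coe Ω)).2 h2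

lemma bdryDist_lipschitz (x y : Ω) : bdryDist x ≤ bdryDist y + dist x y := by
  rw [← Completion.dist_eq]
  exact Metric.infDist_le_infDist_add_dist

lemma bdryDist_le_dist (x : Ω) (z : Boundary Ω) : bdryDist x ≤ dist (x : Completion Ω) z :=
  Metric.infDist_le_dist_of_mem z.2

lemma bdryDist_pos [LocallyCompactSpace Ω] (hΩ : ¬ CompleteSpace Ω) (x : Ω) : 0 < bdryDist x :=
  (isClosed_boundarySet.notMem_iff_infDist_pos (nonempty_boundarySet hΩ)).1
    (by simp [boundarySet])

variable [MeasurableSpace Ω] {μ : Measure Ω}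

lemma IsDoubling.measure_ball_lt_top (hμ : IsDoubling μ) (x : Ω) {r : ℝ} (hr : 0 < r) :
    μ (Metric.ball x r) < ∞ := by
  obtain ⟨C, -, h⟩ := hμ
  exact (h x r hr).2.2

lemma IsDoubling.measure_ball_pos (hμ : IsDoubling μ) (x : Ω) {r : ℝ} (hr : 0 < r) :
    0 < μ (Metric.ball x r) := by
  obtain ⟨C, -, h⟩ := hμ
  simpa [mul_div_cancel₀] using (h x (r / 2) (by positivity)).1

/-- Comparison of the measures of two balls of comparable sizes, close to each other. -/
lemma IsDoubling.exists_tracedBall_le (hμ : IsDoubling μ) (L : ℝ) :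
    ∃ C : ℝ≥0∞, C ≠ ∞ ∧ ∀ (w w' : Completion Ω) (s r : ℝ), 0 < r → s + dist w w' ≤ L * r →
      μ (tracedBall w s) ≤ C * μ (tracedBall w' r) := by
  obtain ⟨C, -, h⟩ := hμ
  have hpow : ∀ (n : ℕ) (x : Ω) (r : ℝ), 0 < r →
      μ (Metric.ball x (2 ^ n * r)) ≤ (C : ℝ≥0∞) ^ n * μ (Metric.ball x r) := by
    intro n x r hr
    induction n with
    | zero => simp
    | succ n ih =>
      calc μ (Metric.ball x (2 ^ (n + 1) * r)) = μ (Metric.ball x (2 * (2 ^ n * r))) := by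
            congr 2; ring
        _ ≤ C * μ (Metric.ball x (2 ^ n * r)) := (h x _ (by positivity)).2.1
        _ ≤ C * ((C : ℝ≥0∞) ^ n * μ (Metric.ball x r)) := by gcongr
        _ = _ := by rw [pow_succ]; ring
  -- Doubling is available for centres in `Ω` only. Replacing `w'` by a point `x` of `Ω` at distance
  -- below `r/4` costs the `+ 1`; the factor `2` appears because the iteration starts from radius
  -- `r/2`, which keeps the ball around `x` inside the one around `w'`.
  obtain ⟨n, hn⟩ := pow_unbounded_of_one_lt (2 * (L + 1)) (one_lt_two (α := ℝ))
  refine ⟨(C : ℝ≥0∞) ^ n, by simp, fun w w' s r hr hs => ?_⟩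
  obtain ⟨x, hx⟩ := exists_dist_coe_lt w' (show 0 < r / 4 by positivity)
  calc μ (tracedBall w s) ≤ μ (Metric.ball x (2 ^ n * (r / 2))) := by
        rw [← tracedBall_coe]
        refine measure_mono (tracedBall_subset ?_)
        have := dist_triangle w w' x
        rw [dist_comm w' x] at this
        nlinarith
    _ ≤ (C : ℝ≥0∞) ^ n * μ (Metric.ball x (r / 2)) := hpow n x _ (by positivity)
    _ ≤ _ := by
        rw [← tracedBall_coe]
        gcongr
        exact tracedBall_subset (by linarith)

lemma IsDoubling.measure_tracedBall_lt_top (hμ : IsDoubling μ) (w : Completion Ω) (r : ℝ) :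
    μ (tracedBall w r) < ∞ := by
  obtain ⟨x, hx⟩ := exists_dist_coe_lt w one_pos
  refine lt_of_le_of_lt (measure_mono (tracedBall_subset (w' := (x : Completion Ω))
    (r := |r| + 1) ?_)) ?_
  · rw [dist_comm]; linarith [le_abs_self r]
  · rw [tracedBall_coe]
    exact hμ.measure_ball_lt_top x (by positivity)

lemma IsDoubling.measure_tracedBall_pos (hμ : IsDoubling μ) (w : Completion Ω) {r : ℝ}
    (hr : 0 < r) : 0 < μ (tracedBall w r) := by
  obtain ⟨x, hx⟩ := exists_dist_coe_lt w (show 0 < r / 2 by positivity)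
  refine lt_of_lt_of_le (hμ.measure_ball_pos x (show 0 < r / 2 by positivity)) ?_
  rw [← tracedBall_coe]
  exact measure_mono (tracedBall_subset (by linarith))

/-- Separated sets in a ball of comparable size have boundedly many elements. -/
lemma IsDoubling.exists_encard_le [BorelSpace Ω] (hμ : IsDoubling μ) (L : ℝ) :
    ∃ N : ℕ, ∀ (w : Completion Ω) (r : ℝ), 0 < r → ∀ S : Set Ω,
      (∀ x ∈ S, dist (x : Completion Ω) w < L * r) →
      S.Pairwise (fun x y => r ≤ dist x y) → S.encard ≤ N := by
  -- Volume counting: the disjoint balls of radius `r/2` around points of `S` lie in the ball of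
  -- radius `R = (|L|+1) r` around `w`, and each has measure comparable to it since `R + |L| r =
  -- (4|L|+2) · r/2`.
  obtain ⟨C, hC, h⟩ := hμ.exists_tracedBall_le (4 * |L| + 2)
  obtain ⟨N, hN⟩ := ENNReal.exists_nat_gt hC
  refine ⟨N, fun w r hr S hS hsep => ?_⟩
  by_contra! hcon
  obtain ⟨T, hTS, hT⟩ := exists_subset_encard_eq (k := ((N + 1 : ℕ) : ℕ∞))
    (by exact_mod_cast Order.add_one_le_of_lt hcon)
  have hTfin : T.Finite := finite_of_encard_eq_coe hT
  lift T to Finset Ω using hTfin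
  rw [encard_coe_eq_coe_finsetCard] at hT
  have hT : T.card = N + 1 := by exact_mod_cast hT
  set R := (|L| + 1) * r
  have hR : 0 < R := by positivity
  have hLr : L * r ≤ |L| * r := by gcongr; exact le_abs_self L
  have h1 : ∑ x ∈ T, μ (Metric.ball x (r / 2)) ≤ μ (tracedBall w R) := by
    rw [← measure_biUnion_finset _ (fun _ _ => Metric.isOpen_ball.measurableSet)]
    · refine measure_mono (iUnion₂_subset fun x hx => ?_)
      rw [← tracedBall_coe]
      refine tracedBall_subset ?_
      have := hS x (hTS hx)
      simp only [R]
      linarith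
    · intro x hx y hy hxy
      exact Metric.ball_disjoint_ball (by linarith [hsep (hTS hx) (hTS hy) hxy])
  have h2 : ∀ x ∈ T, μ (tracedBall w R) ≤ C * μ (Metric.ball x (r / 2)) := by
    intro x hx
    rw [← tracedBall_coe]
    refine h _ _ _ _ (by positivity) ?_
    have := hS x (hTS hx)
    rw [dist_comm w]
    simp only [R]
    nlinarith
  have h3 : (T.card : ℝ≥0∞) * μ (tracedBall w R) ≤ C * μ (tracedBall w R) := by
    calc (T.card : ℝ≥0∞) * μ (tracedBall w R) = ∑ x ∈ T, μ (tracedBall w R) := by simp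
      _ ≤ ∑ x ∈ T, C * μ (Metric.ball x (r / 2)) := Finset.sum_le_sum h2
      _ = C * ∑ x ∈ T, μ (Metric.ball x (r / 2)) := by rw [Finset.mul_sum]
      _ ≤ _ := by gcongr
  rw [ENNReal.mul_le_mul_iff_left (hμ.measure_tracedBall_pos w hR).ne'
    (hμ.measure_tracedBall_lt_top w R).ne] at h3
  have := h3.trans_lt hN
  rw [hT] at this
  have : N + 1 < N := by exact_mod_cast this
  omega

/-- A maximal `ε/2`-separated set of points of `Ω` in a slightly larger ball is finite by volume
counting. It is an `ε`-net, because points of the completion are approximated by points of `Ω`. -/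
lemma IsDoubling.totallyBounded_closedBall [BorelSpace Ω] (hμ : IsDoubling μ)
    (w : Completion Ω) (R : ℝ) : TotallyBounded (Metric.closedBall w R) := by
  rw [Metric.totallyBounded_iff]
  intro ε hε
  obtain ⟨S, hSA, hsep, hcov⟩ :=
    exists_maximal_separated (tracedBall w (R + ε)) (half_pos hε)
  obtain ⟨N, hN⟩ := hμ.exists_encard_le ((R + ε) / (ε / 2))
  have hS : S.Finite := finite_of_encard_le_coe (hN w (ε / 2) (half_pos hε) S (fun x hx => by
    rw [div_mul_cancel₀ _ (half_pos hε).ne']; exact hSA hx) hsep)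
  refine ⟨(↑) '' S, hS.image _, fun z hz => ?_⟩
  obtain ⟨x, hx⟩ := exists_dist_coe_lt z (half_pos hε)
  have hxA : x ∈ tracedBall w (R + ε) := by
    rw [mem_tracedBall]
    have := dist_triangle (x : Completion Ω) z w
    have := Metric.mem_closedBall.1 hz
    linarith
  obtain ⟨y, hy, hxy⟩ := hcov x hxA
  refine mem_iUnion₂.2 ⟨y, mem_image_of_mem _ hy, ?_⟩
  rw [Metric.mem_ball]
  have := dist_triangle z (x : Completion Ω) y
  rw [Completion.dist_eq x y, dist_comm z (x : Completion Ω)] at this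
  linarith

lemma IsDoubling.properSpace_completion [BorelSpace Ω] (hμ : IsDoubling μ) :
    ProperSpace (Completion Ω) :=
  ⟨fun w R => isCompact_iff_totallyBounded_isComplete.2
    ⟨hμ.totallyBounded_closedBall w R, Metric.isClosed_closedBall.isComplete⟩⟩

lemma IsDoubling.secondCountableTopology [BorelSpace Ω] (hμ : IsDoubling μ) :
    SecondCountableTopology Ω := by
  have := hμ.properSpace_completion
  exact (Completion.isUniformEmbedding_coe Ω).isEmbedding.secondCountableTopology

lemma IsDoubling.properSpace_boundary [BorelSpace Ω] [LocallyCompactSpace Ω]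
    (hμ : IsDoubling μ) : ProperSpace (Boundary Ω) := by
  have := hμ.properSpace_completion
  exact .of_isClosed isClosed_boundarySet

lemma IsDoubling.isLocallyFiniteMeasure (hμ : IsDoubling μ) : IsLocallyFiniteMeasure μ :=
  ⟨fun x => ⟨_, Metric.ball_mem_nhds x one_pos, hμ.measure_ball_lt_top x one_pos⟩⟩

end Geometry

/-! ### Existence of Whitney covers with a partition of unity. -/

section WhitneyExistence

lemma encard_biUnion_le {ι κ : Type*} (s : Finset κ) (A : κ → Set ι) (N : ℕ)
    (h : ∀ i ∈ s, (A i).encard ≤ N) : (⋃ i ∈ s, A i).encard ≤ (s.card * N : ℕ) := by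
  classical
  induction s using Finset.induction_on with
  | empty => simp
  | insert a s ha ih =>
    rw [Finset.set_biUnion_insert, Finset.card_insert_of_notMem ha, add_mul, one_mul, add_comm]
    refine (encard_union_le _ _).trans ?_
    push_cast
    exact add_le_add (h a (Finset.mem_insert_self a s))
      (by exact_mod_cast ih fun i hi => h i (Finset.mem_insert_of_mem hi))

variable {Ω : Type*} [MetricSpace Ω]

/-- Bounds for `d(x, ∂Ω)` when `x` lies in a dilated Whitney ball. -/
lemma bdryDist_bounds_of_mem_ball {c x : Ω} {r K : ℝ} (hr : r = bdryDist c / 8)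
    (hx : x ∈ Metric.ball c (K * r)) : (8 - K) * r < bdryDist x ∧ bdryDist x < (8 + K) * r := by
  have h1 := bdryDist_lipschitz x c
  have h2 := bdryDist_lipschitz c x
  rw [dist_comm c x] at h2
  rw [Metric.mem_ball] at hx
  constructor <;> linarith

lemma level_le_add_two {ι : Type*} {radius : ι → ℝ} {level : ι → ℤ}
    (level_lt : ∀ j, (2 : ℝ) ^ (level j - 1) < radius j)
    (le_level : ∀ j, radius j ≤ (2 : ℝ) ^ level j) {j k : ι}
    (h : radius k ≤ 4 * radius j) : level k ≤ level j + 2 := by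
  have h1 : (2 : ℝ) ^ (level k - 1) < 2 ^ (level j + 2) := by
    calc (2 : ℝ) ^ (level k - 1) < radius k := level_lt k
      _ ≤ 4 * radius j := h
      _ ≤ 4 * 2 ^ level j := by gcongr; exact le_level j
      _ = 2 ^ (level j + 2) := by rw [zpow_add₀ two_ne_zero]; norm_num; ring
  have := (zpow_lt_zpow_iff_right₀ one_lt_two).1 h1
  omega

/-- The tripled balls of a Whitney family have bounded overlap. -/
lemma exists_overlap_three {ι : Type*} {center : ι → Ω} {radius : ι → ℝ} {level : ι → ℤ}
    (level_lt : ∀ j, (2 : ℝ) ^ (level j - 1) < radius j)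
    (le_level : ∀ j, radius j ≤ (2 : ℝ) ^ level j)
    (radius_eq : ∀ j, radius j = bdryDist (center j) / 8)
    (level_overlap : ∀ K : ℝ, 1 ≤ K → ∃ N : ℕ, ∀ (i : ℤ) (x : Ω),
      {j | level j = i ∧ x ∈ Metric.ball (center j) (K * radius j)}.encard ≤ N) :
    ∃ N : ℕ, ∀ x : Ω, {j | x ∈ Metric.ball (center j) (3 * radius j)}.encard ≤ N := by
  obtain ⟨N, hN⟩ := level_overlap 3 (by norm_num)
  -- If `x` lies in two tripled balls, `d(x, ∂Ω)` is between `5` and `11` times each radius. The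
  -- radii then differ by a factor below `4`, so only the five generations `level j - 2, …, level j
  -- + 2` occur.
  refine ⟨5 * N, fun x => ?_⟩
  rcases eq_empty_or_nonempty {j | x ∈ Metric.ball (center j) (3 * radius j)} with h0 | ⟨j, hj⟩
  · rw [h0]; simp
  have hsub : {j | x ∈ Metric.ball (center j) (3 * radius j)} ⊆
      ⋃ i ∈ Finset.Icc (level j - 2) (level j + 2),
        {k | level k = i ∧ x ∈ Metric.ball (center k) (3 * radius k)} := by
    intro k hk
    have h1 := bdryDist_bounds_of_mem_ball (radius_eq j) hj
    have h2 := bdryDist_bounds_of_mem_ball (radius_eq k) hk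
    have pj : 0 < radius j := lt_trans (by positivity) (level_lt j)
    have pk : 0 < radius k := lt_trans (by positivity) (level_lt k)
    have h3 := level_le_add_two level_lt le_level (j := j) (k := k) (by linarith)
    have h4 := level_le_add_two level_lt le_level (j := k) (k := j) (by linarith)
    refine mem_iUnion₂.2 ⟨level k, Finset.mem_Icc.2 ⟨by omega, h3⟩, rfl, hk⟩
  refine (encard_le_encard hsub).trans ((encard_biUnion_le _ _ N fun i _ => hN i x).trans ?_)
  rw [Int.card_Icc]
  have : (level j + 2 + 1 - (level j - 2)).toNat = 5 := by omega
  rw [this]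

/-- The Whitney bump attached to a ball. -/
noncomputable def whitneyBump (c : Ω) (r : ℝ) (x : Ω) : ℝ := max 0 (min 1 (2 - dist x c / r))

lemma whitneyBump_nonneg (c : Ω) (r : ℝ) (x : Ω) : 0 ≤ whitneyBump c r x := le_max_left _ _

lemma whitneyBump_le_one (c : Ω) (r : ℝ) (x : Ω) : whitneyBump c r x ≤ 1 :=
  max_le zero_le_one (min_le_left _ _)

lemma whitneyBump_eq_zero {c : Ω} {r : ℝ} (hr : 0 < r) {x : Ω}
    (hx : x ∉ Metric.ball c (2 * r)) : whitneyBump c r x = 0 := by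
  rw [Metric.mem_ball, not_lt] at hx
  refine max_eq_left ((min_le_right _ _).trans ?_)
  rw [sub_nonpos, le_div_iff₀ hr]
  exact hx

lemma whitneyBump_eq_one {c : Ω} {r : ℝ} (hr : 0 < r) {x : Ω}
    (hx : x ∈ Metric.ball c r) : whitneyBump c r x = 1 := by
  have : dist x c / r ≤ 1 := (div_le_one hr).2 (le_of_lt hx)
  rw [whitneyBump, min_eq_left (by linarith), max_eq_right zero_le_one]

lemma whitneyBump_lipschitz {c : Ω} {r : ℝ} (hr : 0 < r) (x y : Ω) :
    |whitneyBump c r x - whitneyBump c r y| ≤ dist x y / r := by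
  have h1 : |dist y c / r - dist x c / r| ≤ dist x y / r := by
    rw [← sub_div, abs_div, abs_of_pos hr]
    gcongr
    rw [dist_comm x y]
    exact abs_dist_sub_le y x c
  unfold whitneyBump
  calc |max 0 (min 1 (2 - dist x c / r)) - max 0 (min 1 (2 - dist y c / r))|
      ≤ |min 1 (2 - dist x c / r) - min 1 (2 - dist y c / r)| := by
        simpa using abs_max_sub_max_le_max 0 (min 1 (2 - dist x c / r)) 0
          (min 1 (2 - dist y c / r))
    _ ≤ |(2 - dist x c / r) - (2 - dist y c / r)| := by
        simpa using abs_min_sub_min_le_max 1 (2 - dist x c / r) 1 (2 - dist y c / r)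
    _ ≤ _ := by
        refine le_of_eq_of_le ?_ h1
        congr 1; ring

/-- The centres of a Whitney cover, indexed by a countable type. -/
lemma exists_whitney_centers [LocallyCompactSpace Ω] [SecondCountableTopology Ω]
    (hΩ : ¬ CompleteSpace Ω) :
    ∃ (ι : Type) (_ : Countable ι) (c : ι → Ω) (level : Ω → ℤ), c.Injective ∧
      (∀ x, (2 : ℝ) ^ (level x - 1) < bdryDist x / 8 ∧ bdryDist x / 8 ≤ 2 ^ level x) ∧
      (∀ j k, j ≠ k → level (c j) = level (c k) →
        (2 : ℝ) ^ (level (c j) - 1) ≤ dist (c j) (c k)) ∧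
      ∀ x, ∃ j, dist x (c j) < 2 ^ (level (c j) - 1) := by
  have hlev : ∀ x : Ω, ∃ i : ℤ, (2 : ℝ) ^ (i - 1) < bdryDist x / 8 ∧ bdryDist x / 8 ≤ 2 ^ i := by
    intro x
    obtain ⟨n, hn⟩ := exists_mem_Ioc_zpow (show 0 < bdryDist x / 8 by
      have := bdryDist_pos hΩ x; positivity) (one_lt_two (α := ℝ))
    exact ⟨n + 1, by simpa using hn.1, hn.2⟩
  choose level hlevel using hlev
  choose S hS hsep hcov using fun i : ℤ =>
    exists_maximal_separated {x : Ω | level x = i} (show (0 : ℝ) < 2 ^ (i - 1) by positivity)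
  have hScount : ∀ i, (S i).Countable := by
    intro i
    refine PairwiseDisjoint.countable_of_isOpen
      (s := fun x : Ω => Metric.ball x ((2 : ℝ) ^ (i - 1) / 2)) ?_
      (fun _ _ => Metric.isOpen_ball)
      (fun x _ => ⟨x, Metric.mem_ball_self (by positivity)⟩)
    intro x hx y hy hxy
    exact Metric.ball_disjoint_ball (by linarith [hsep i hx hy hxy])
  have hcount : (⋃ i, S i).Countable := countable_iUnion hScount
  have : Countable ↥(⋃ i, S i) := hcount.to_subtype
  -- Reindexing by a subset of `ℕ` puts the index type into `Type`, whatever the universe of `Ω`.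
  obtain ⟨e, he⟩ := Countable.exists_injective_nat ↥(⋃ i, S i)
  let E := Equiv.ofInjective e he
  have hmem : ∀ j : Set.range e, (E.symm j : Ω) ∈ S (level (E.symm j)) := by
    intro j
    obtain ⟨i, hi⟩ := mem_iUnion.1 (E.symm j).2
    have : level (E.symm j) = i := hS i hi
    rwa [this]
  refine ⟨Set.range e, inferInstance, fun j => (E.symm j : Ω), level,
    Subtype.val_injective.comp E.symm.injective, hlevel, fun j k hjk h => ?_, fun x => ?_⟩
  · refine hsep _ (hmem j) (by rw [h]; exact hmem k) fun hne => hjk ?_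
    exact E.symm.injective (Subtype.val_injective hne)
  · obtain ⟨y, hy, hxy⟩ := hcov (level x) x rfl
    have hly : level y = level x := hS _ hy
    refine ⟨E ⟨y, mem_iUnion.2 ⟨_, hy⟩⟩, ?_⟩
    simp only [Equiv.symm_apply_apply]
    rwa [hly]

/-- Normalizing the Whitney bumps gives a Lipschitz partition of unity. -/
lemma exists_whitney_pou {ι : Type*} {center : ι → Ω} {radius : ι → ℝ}
    (hpos : ∀ j, 0 < radius j)
    (radius_eq : ∀ j, radius j = bdryDist (center j) / 8)
    (cover : ∀ x : Ω, ∃ j, x ∈ Metric.ball (center j) (radius j))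
    (overlap : ∃ N : ℕ, ∀ x : Ω, {j | x ∈ Metric.ball (center j) (2 * radius j)}.encard ≤ N) :
    ∃ pou : ι → Ω → ℝ, (∀ j x, 0 ≤ pou j x) ∧
      (∀ j x, x ∉ Metric.ball (center j) (2 * radius j) → pou j x = 0) ∧
      (∀ x, HasSum (fun j => pou j x) 1) ∧
      ∃ C : ℝ, ∀ j x y, |pou j x - pou j y| ≤ C / radius j * dist x y := by
  classical
  obtain ⟨N, hN⟩ := overlap
  let ψ : ι → Ω → ℝ := fun j => whitneyBump (center j) (radius j)
  have hfin : ∀ x : Ω, {j | x ∈ Metric.ball (center j) (2 * radius j)}.Finite := fun x =>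
    finite_of_encard_le_coe (hN x)
  let F : Ω → Finset ι := fun x => (hfin x).toFinset
  have hFmem : ∀ x j, j ∈ F x ↔ x ∈ Metric.ball (center j) (2 * radius j) := by
    intro x j; simp [F]
  have hFcard : ∀ x, (F x).card ≤ N := by
    intro x
    have := hN x
    rw [(hfin x).encard_eq_coe_toFinset_card] at this
    exact_mod_cast this
  have hψ0 : ∀ x j, j ∉ F x → ψ j x = 0 := fun x j hj =>
    whitneyBump_eq_zero (hpos j) (by rwa [← hFmem])
  let ψsum : Ω → ℝ := fun x => ∑ j ∈ F x, ψ j x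
  have hsum : ∀ x, HasSum (fun j => ψ j x) (ψsum x) := fun x =>
    hasSum_sum_of_ne_finset_zero (hψ0 x)
  have hs1 : ∀ x, 1 ≤ ψsum x := by
    intro x
    obtain ⟨j, hj⟩ := cover x
    rw [← whitneyBump_eq_one (hpos j) hj]
    refine Finset.single_le_sum (f := fun j => ψ j x) (fun k _ => whitneyBump_nonneg _ _ _) ?_
    rw [hFmem]
    exact Metric.ball_subset_ball (by linarith [hpos j]) hj
  have hspos : ∀ x, 0 < ψsum x := fun x => one_pos.trans_le (hs1 x)
  have hle : ∀ j x, ψ j x / ψsum x ≤ 1 := fun j x =>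
    (div_le_one (hspos x)).2 ((whitneyBump_le_one _ _ _).trans (hs1 x))
  have hnn : ∀ j x, 0 ≤ ψ j x / ψsum x := fun j x =>
    div_nonneg (whitneyBump_nonneg _ _ _) (hspos x).le
  -- In `1 + 4 * N`, the `1` comes from the bump itself; the `4 * N` from the denominator: at most
  -- `2N` bumps vary between `x` and `y`, each with Lipschitz constant at most `2 / radius j`.
  refine ⟨fun j x => ψ j x / ψsum x, hnn, fun j x hx => ?_, fun x => ?_, 1 + 4 * N,
    fun j x y => ?_⟩
  · show ψ j x / ψsum x = 0
    rw [hψ0 x j (by rwa [hFmem]), zero_div]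
  · have := (hsum x).div_const (ψsum x)
    rwa [div_self (hspos x).ne'] at this
  · have hrj := hpos j
    have hN0 : (0 : ℝ) ≤ N := Nat.cast_nonneg N
    rcases le_or_gt (radius j) (dist x y) with hd | hd
    · calc |ψ j x / ψsum x - ψ j y / ψsum y| ≤ 1 := by
            rw [abs_le]; constructor <;> linarith [hle j x, hle j y, hnn j x, hnn j y]
        _ ≤ dist x y / radius j := (one_le_div hrj).2 hd
        _ = 1 / radius j * dist x y := by ring
        _ ≤ _ := by gcongr; linarith
    by_cases hxy : j ∈ F x ∨ j ∈ F y
    swap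
    · push Not at hxy
      simp only [hψ0 x j hxy.1, hψ0 y j hxy.2, zero_div, sub_zero, abs_zero]
      positivity
    have hx3 : x ∈ Metric.ball (center j) (3 * radius j) := by
      rcases hxy with h | h <;> rw [hFmem, Metric.mem_ball] at h <;> rw [Metric.mem_ball]
      · linarith
      · linarith [dist_triangle x y (center j)]
    have hy3 : y ∈ Metric.ball (center j) (3 * radius j) := by
      rcases hxy with h | h <;> rw [hFmem, Metric.mem_ball] at h <;> rw [Metric.mem_ball]
      · rw [dist_comm] at hd; linarith [dist_triangle y x (center j)]
      · linarith
    have hbx := (bdryDist_bounds_of_mem_ball (radius_eq j) hx3).1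
    have hby := (bdryDist_bounds_of_mem_ball (radius_eq j) hy3).1
    -- Here `d(x, ∂Ω)` and `d(y, ∂Ω)` exceed `5` times `radius j`, whereas a ball active at `x` or
    -- `y` forces them below `10` times `radius k`; hence `radius k` is at least half of `radius j`.
    have hk : ∀ k ∈ F x ∪ F y, |ψ k x - ψ k y| ≤ 2 * (dist x y / radius j) := by
      intro k hk
      have hrk : radius j / 2 ≤ radius k := by
        rcases Finset.mem_union.1 hk with h | h <;> rw [hFmem] at h <;>
          have := (bdryDist_bounds_of_mem_ball (radius_eq k) h).2 <;> linarith
      calc |ψ k x - ψ k y| ≤ dist x y / radius k := whitneyBump_lipschitz (hpos k) x y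
        _ ≤ dist x y / (radius j / 2) := by gcongr
        _ = _ := by field_simp
    have hs2 : |ψsum x - ψsum y| ≤ 4 * N * (dist x y / radius j) := by
      have ex : ψsum x = ∑ k ∈ F x ∪ F y, ψ k x :=
        Finset.sum_subset Finset.subset_union_left fun k _ hk => hψ0 x k hk
      have ey : ψsum y = ∑ k ∈ F x ∪ F y, ψ k y :=
        Finset.sum_subset Finset.subset_union_right fun k _ hk => hψ0 y k hk
      rw [ex, ey, ← Finset.sum_sub_distrib]
      refine (Finset.abs_sum_le_sum_abs _ _).trans ((Finset.sum_le_card_nsmul _ _ _ hk).trans ?_)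
      rw [nsmul_eq_mul]
      have : ((F x ∪ F y).card : ℝ) ≤ 2 * N := by
        have h1 := (Finset.card_union_le (F x) (F y)).trans (add_le_add (hFcard x) (hFcard y))
        rw [two_mul]; exact_mod_cast h1
      calc _ ≤ 2 * (N : ℝ) * (2 * (dist x y / radius j)) := by gcongr
        _ = _ := by ring
    -- Quotient rule, arranged so that only the lower bound `1 ≤ ψsum x` and the bound `ψ j y / ψsum
    -- y ≤ 1` are needed.
    have hid : ψ j x / ψsum x - ψ j y / ψsum y =
        (ψ j x - ψ j y) / ψsum x - ψ j y / ψsum y * ((ψsum x - ψsum y) / ψsum x) := by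
      have := (hspos x).ne'
      have := (hspos y).ne'
      field_simp
      ring
    have h1 : |(ψ j x - ψ j y) / ψsum x| ≤ dist x y / radius j := by
      rw [abs_div, abs_of_pos (hspos x)]
      exact (div_le_self (abs_nonneg _) (hs1 x)).trans (whitneyBump_lipschitz hrj x y)
    have h2 : |ψ j y / ψsum y * ((ψsum x - ψsum y) / ψsum x)| ≤ 4 * N * (dist x y / radius j) := by
      rw [abs_mul, abs_of_nonneg (hnn j y), abs_div, abs_of_pos (hspos x)]
      calc _ ≤ 1 * |ψsum x - ψsum y| := by
            gcongr
            · exact div_nonneg (abs_nonneg _) (hspos x).le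
            · exact hle j y
            · exact div_le_self (abs_nonneg _) (hs1 x)
        _ ≤ _ := by rw [one_mul]; exact hs2
    show |ψ j x / ψsum x - ψ j y / ψsum y| ≤ _
    rw [hid]
    calc _ ≤ dist x y / radius j + 4 * N * (dist x y / radius j) :=
          (abs_sub _ _).trans (add_le_add h1 h2)
      _ = _ := by ring

lemma bdryDist_abs_sub_le (x y : Ω) : |bdryDist x - bdryDist y| ≤ dist x y := by
  have h1 := bdryDist_lipschitz x y
  have h2 := bdryDist_lipschitz y x
  rw [dist_comm y x] at h2
  rw [abs_le]; constructor <;> linarith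

/-- Maximal separated sets, one per generation, supply the centres. Doubling bounds the overlap
inside a generation, and comparability of radii extends this to all doubled balls. Closest points
exist because the completion is proper and `∂Ω` is closed. -/
theorem exists_whitneyData [LocallyCompactSpace Ω] [MeasurableSpace Ω] [BorelSpace Ω]
    (hΩ : ¬ CompleteSpace Ω) {μ : Measure Ω} (hμ : IsDoubling μ) :
    ∃ (ι : Type) (_ : Countable ι), Nonempty (WhitneyData Ω ι) := by
  have := hμ.secondCountableTopology
  have := hμ.properSpace_completion
  obtain ⟨ι, hι, c, level, hc, hlev, hsep, hcov⟩ := exists_whitney_centers hΩ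
  have hpos : ∀ j, 0 < bdryDist (c j) / 8 := fun j => by
    have := bdryDist_pos hΩ (c j); positivity
  have level_overlap : ∀ K : ℝ, 1 ≤ K → ∃ N : ℕ, ∀ (i : ℤ) (x : Ω),
      {j | level (c j) = i ∧ x ∈ Metric.ball (c j) (K * (bdryDist (c j) / 8))}.encard ≤ N := by
    intro K hK
    -- The centres are separated by `2^(i-1)`, while the radius is at most `2^i`; this accounts for
    -- the factor `2`.
    obtain ⟨N, hN⟩ := hμ.exists_encard_le (2 * K)
    refine ⟨N, fun i x => ?_⟩
    rw [← hc.encard_image]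
    refine hN (x : Completion Ω) (2 ^ (i - 1)) (by positivity) _ ?_ ?_
    · rintro _ ⟨j, ⟨rfl, hj⟩, rfl⟩
      rw [Completion.dist_eq, dist_comm]
      rw [Metric.mem_ball] at hj
      calc dist x (c j) < K * (bdryDist (c j) / 8) := hj
        _ ≤ K * 2 ^ level (c j) := by gcongr; exact (hlev _).2
        _ = _ := by rw [zpow_sub_one₀ two_ne_zero]; ring
    · rintro _ ⟨j, ⟨rfl, hj⟩, rfl⟩ _ ⟨k, ⟨hjk, hk⟩, rfl⟩ hne
      exact hsep j k (fun h => hne (by rw [h])) hjk.symm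
  have overlap : ∃ N : ℕ, ∀ x : Ω,
      {j | x ∈ Metric.ball (c j) (2 * (bdryDist (c j) / 8))}.encard ≤ N := by
    obtain ⟨N, hN⟩ := exists_overlap_three (center := c) (level := fun j => level (c j))
      (radius := fun j => bdryDist (c j) / 8)
      (fun j => (hlev _).1) (fun j => (hlev _).2) (fun _ => rfl) level_overlap
    refine ⟨N, fun x => (encard_le_encard fun j hj => ?_).trans (hN x)⟩
    exact Metric.ball_subset_ball (by linarith [hpos j]) hj
  have cover : ∀ x : Ω, ∃ j, x ∈ Metric.ball (c j) (bdryDist (c j) / 8) := fun x => by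
    obtain ⟨j, hj⟩ := hcov x
    exact ⟨j, hj.trans (hlev _).1⟩
  obtain ⟨pou, hp0, hp1, hp2, hp3⟩ := exists_whitney_pou hpos (fun _ => rfl) cover overlap
  have hclosest : ∀ j, ∃ z : Boundary Ω,
      dist (c j : Completion Ω) (z : Completion Ω) = bdryDist (c j) := by
    intro j
    obtain ⟨z, hz, h⟩ := isClosed_boundarySet.exists_infDist_eq_dist (nonempty_boundarySet hΩ)
      (c j : Completion Ω)
    exact ⟨⟨z, hz⟩, h.symm⟩
  choose closest hclosest using hclosest
  refine ⟨ι, hι, ⟨{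
    center := c
    radius := fun j => bdryDist (c j) / 8
    level := fun j => level (c j)
    cover := cover
    overlap := overlap
    level_lt := fun j => (hlev _).1
    le_level := fun j => (hlev _).2
    radius_eq := fun _ => rfl
    separated := ⟨2, one_le_two, fun j k hjk h => ?_⟩
    level_overlap := level_overlap
    closest := closest
    dist_closest := hclosest
    pou := pou
    pou_nonneg := hp0
    pou_le_one := fun j x => le_hasSum (hp2 x) j fun k _ => hp0 k x
    pou_support := hp1
    pou_sum := hp2
    pou_lipschitz := hp3
    cutoff := fun x => max 0 (min 1 (2 - bdryDist x))
    cutoff_nonneg := fun x => le_max_left _ _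
    cutoff_le_one := fun x => max_le zero_le_one (min_le_left _ _)
    cutoff_lipschitz := ?_
    cutoff_eq_one := fun x hx => ?_
    cutoff_eq_zero := fun x hx => ?_ }⟩⟩
  · rw [div_eq_mul_inv, ← zpow_sub_one₀ two_ne_zero]
    exact hsep j k hjk h
  · refine LipschitzWith.of_dist_le_mul fun x y => ?_
    rw [NNReal.coe_one, one_mul, Real.dist_eq]
    calc |max 0 (min 1 (2 - bdryDist x)) - max 0 (min 1 (2 - bdryDist y))|
        ≤ |min 1 (2 - bdryDist x) - min 1 (2 - bdryDist y)| := by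
          simpa using abs_max_sub_max_le_max 0 (min 1 (2 - bdryDist x)) 0
            (min 1 (2 - bdryDist y))
      _ ≤ |(2 - bdryDist x) - (2 - bdryDist y)| := by
          simpa using abs_min_sub_min_le_max 1 (2 - bdryDist x) 1 (2 - bdryDist y)
      _ = |bdryDist y - bdryDist x| := by congr 1; ring
      _ ≤ dist x y := by rw [dist_comm]; exact bdryDist_abs_sub_le y x
  · rw [min_eq_left (by linarith), max_eq_right zero_le_one]
  · exact max_eq_left ((min_le_right _ _).trans (by linarith))

end WhitneyExistence

/-! ### Besov energies and their dyadic discretisation. -/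

section Energy

open Classical in
/-- The Besov energy as a functional of the oscillation function `t ↦ besovOsc μ p u t`. -/
noncomputable def energyOf (s p : ℝ) (q : ℝ≥0∞) (O : ℝ → ℝ≥0∞) : ℝ≥0∞ :=
  if q = ∞ then
    ⨆ (t : ℝ) (_ : 0 < t), ENNReal.ofReal (t ^ (-s)) * O t ^ (1 / p)
  else
    (∫⁻ t in Set.Ioi (0 : ℝ), O t ^ (q.toReal / p) *
      ENNReal.ofReal (t ^ (-(s * q.toReal + 1)))) ^ (1 / q.toReal)

lemma besovEnergy_eq_energyOf {Y : Type*} [MetricSpace Y] [MeasurableSpace Y] (μ : Measure Y)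
    (s p : ℝ) (q : ℝ≥0∞) (u : Y → ℝ) :
    besovEnergy μ s p q u = energyOf s p q (besovOsc μ p u) := rfl

lemma toReal_pos_of_one_le {q : ℝ≥0∞} (hq : 1 ≤ q) (hq' : q ≠ ∞) : 0 < q.toReal :=
  ENNReal.toReal_pos (one_pos.trans_le hq).ne' hq'

lemma energyOf_top (s p : ℝ) (O : ℝ → ℝ≥0∞) : energyOf s p ∞ O =
    ⨆ (t : ℝ) (_ : 0 < t), ENNReal.ofReal (t ^ (-s)) * O t ^ (1 / p) := if_pos rfl

lemma energyOf_lt_top_iff {s p : ℝ} {q : ℝ≥0∞} (hq : 1 ≤ q) (hq' : q ≠ ∞) {O : ℝ → ℝ≥0∞} :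
    energyOf s p q O < ∞ ↔ ∫⁻ t in Set.Ioi (0 : ℝ), O t ^ (q.toReal / p) *
      ENNReal.ofReal (t ^ (-(s * q.toReal + 1))) < ∞ := by
  rw [energyOf, if_neg hq']
  exact ENNReal.rpow_lt_top_iff_of_pos (one_div_pos.2 (toReal_pos_of_one_le hq hq'))

lemma ENNReal.add_rpow_le_two_rpow {r : ℝ} (hr : 0 ≤ r) (a b : ℝ≥0∞) :
    (a + b) ^ r ≤ 2 ^ r * (a ^ r + b ^ r) := by
  wlog h : b ≤ a generalizing a b
  · rw [add_comm a, add_comm (a ^ r)]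
    exact this b a (le_of_not_ge h)
  calc (a + b) ^ r ≤ (2 * a) ^ r := by
        gcongr; rw [two_mul]; gcongr
    _ = 2 ^ r * a ^ r := ENNReal.mul_rpow_of_nonneg _ _ hr
    _ ≤ _ := by gcongr; exact le_self_add

/-- The energy is a quasi-norm, so a constant depending on `p` and `q` suffices. Splitting the
integral of a sum requires measurability of one summand only, so nothing has to be known about `O₁`,
which will be an oscillation function. -/
lemma energyOf_lt_top_of_le_add {s p : ℝ} {q : ℝ≥0∞} (hp : 1 ≤ p) (hq : 1 ≤ q)
    {O O₁ O₂ : ℝ → ℝ≥0∞} {C : ℝ≥0∞} (hC : C ≠ ∞)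
    (h : ∀ t, 0 < t → O t ≤ C * (O₁ t + O₂ t)) (hO₂ : Measurable O₂)
    (h₁ : energyOf s p q O₁ < ∞) (h₂ : energyOf s p q O₂ < ∞) : energyOf s p q O < ∞ := by
  rcases eq_or_ne q ∞ with rfl | hq'
  · have hp' : 0 ≤ 1 / p := by positivity
    have hCp : (C : ℝ≥0∞) ^ (1 / p) * 2 ^ (1 / p) ≠ ∞ :=
      ENNReal.mul_ne_top (ENNReal.rpow_ne_top_of_nonneg hp' hC)
        (ENNReal.rpow_ne_top_of_nonneg hp' ENNReal.ofNat_ne_top)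
    refine lt_of_le_of_lt ?_ (ENNReal.mul_lt_top hCp.lt_top (ENNReal.add_lt_top.2 ⟨h₁, h₂⟩))
    rw [energyOf_top]
    refine iSup₂_le fun t ht => ?_
    have e₁ : ENNReal.ofReal (t ^ (-s)) * O₁ t ^ (1 / p) ≤ energyOf s p ∞ O₁ := by
      rw [energyOf_top]
      exact le_iSup₂ (f := fun t (_ : 0 < t) => ENNReal.ofReal (t ^ (-s)) * O₁ t ^ (1 / p)) t ht
    have e₂ : ENNReal.ofReal (t ^ (-s)) * O₂ t ^ (1 / p) ≤ energyOf s p ∞ O₂ := by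
      rw [energyOf_top]
      exact le_iSup₂ (f := fun t (_ : 0 < t) => ENNReal.ofReal (t ^ (-s)) * O₂ t ^ (1 / p)) t ht
    calc ENNReal.ofReal (t ^ (-s)) * O t ^ (1 / p)
        ≤ ENNReal.ofReal (t ^ (-s)) * (C * (O₁ t + O₂ t)) ^ (1 / p) := by gcongr; exact h t ht
      _ ≤ ENNReal.ofReal (t ^ (-s)) *
          (C ^ (1 / p) * (2 ^ (1 / p) * (O₁ t ^ (1 / p) + O₂ t ^ (1 / p)))) := by
          rw [ENNReal.mul_rpow_of_nonneg _ _ hp']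
          gcongr
          exact ENNReal.add_rpow_le_two_rpow hp' _ _
      _ = C ^ (1 / p) * 2 ^ (1 / p) * (ENNReal.ofReal (t ^ (-s)) * O₁ t ^ (1 / p) +
          ENNReal.ofReal (t ^ (-s)) * O₂ t ^ (1 / p)) := by ring
      _ ≤ _ := by gcongr
  · have hQ := toReal_pos_of_one_le hq hq'
    have hρ : 0 ≤ q.toReal / p := by positivity
    rw [energyOf_lt_top_iff hq hq'] at h₁ h₂ ⊢
    have hCp : (C : ℝ≥0∞) ^ (q.toReal / p) * 2 ^ (q.toReal / p) ≠ ∞ :=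
      ENNReal.mul_ne_top (ENNReal.rpow_ne_top_of_nonneg hρ hC)
        (ENNReal.rpow_ne_top_of_nonneg hρ ENNReal.ofNat_ne_top)
    refine lt_of_le_of_lt ?_ (ENNReal.mul_lt_top hCp.lt_top (ENNReal.add_lt_top.2 ⟨h₁, h₂⟩))
    rw [← lintegral_add_right, ← lintegral_const_mul' _ _ hCp]
    · refine setLIntegral_mono' measurableSet_Ioi fun t ht => ?_
      calc O t ^ (q.toReal / p) * ENNReal.ofReal (t ^ (-(s * q.toReal + 1)))
          ≤ (C * (O₁ t + O₂ t)) ^ (q.toReal / p) *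
            ENNReal.ofReal (t ^ (-(s * q.toReal + 1))) := by gcongr; exact h t ht
        _ ≤ (C ^ (q.toReal / p) * (2 ^ (q.toReal / p) * (O₁ t ^ (q.toReal / p) +
            O₂ t ^ (q.toReal / p)))) * ENNReal.ofReal (t ^ (-(s * q.toReal + 1))) := by
            rw [ENNReal.mul_rpow_of_nonneg _ _ hρ]
            gcongr
            exact ENNReal.add_rpow_le_two_rpow hρ _ _
        _ = _ := by ring
    · fun_prop

/-- Membership of `b ^ (1 / p)` in `ℓ^q(ℤ)`. -/
def SeqFin (p : ℝ) (q : ℝ≥0∞) (b : ℤ → ℝ≥0∞) : Prop :=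
  (q = ∞ → ⨆ k, b k < ∞) ∧ (q ≠ ∞ → ∑' k, b k ^ (q.toReal / p) < ∞)

variable {p : ℝ} {q : ℝ≥0∞}

lemma SeqFin.of_le_mul (hp : 1 ≤ p) {b b' : ℤ → ℝ≥0∞} (hb : SeqFin p q b) {C : ℝ≥0∞}
    (hC : C ≠ ∞) (h : ∀ k, b' k ≤ C * b k) : SeqFin p q b' := by
  refine ⟨fun hq => ?_, fun hq => ?_⟩
  · refine lt_of_le_of_lt (iSup_le fun k => (h k).trans ?_)
      (ENNReal.mul_lt_top hC.lt_top (hb.1 hq))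
    gcongr
    exact le_iSup b k
  · have hρ : 0 ≤ q.toReal / p := by positivity
    refine lt_of_le_of_lt (ENNReal.tsum_le_tsum
      (g := fun k => C ^ (q.toReal / p) * b k ^ (q.toReal / p)) fun k => ?_) ?_
    · rw [← ENNReal.mul_rpow_of_nonneg _ _ hρ]
      gcongr
      exact h k
    · rw [ENNReal.tsum_mul_left]
      exact ENNReal.mul_lt_top (ENNReal.rpow_lt_top_of_nonneg hρ hC) (hb.2 hq)

lemma SeqFin.add (hp : 1 ≤ p) {b b' : ℤ → ℝ≥0∞} (hb : SeqFin p q b) (hb' : SeqFin p q b') :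
    SeqFin p q (fun k => b k + b' k) := by
  refine ⟨fun hq => ?_, fun hq => ?_⟩
  · refine lt_of_le_of_lt (iSup_le fun k => ?_) (ENNReal.add_lt_top.2 ⟨hb.1 hq, hb'.1 hq⟩)
    exact add_le_add (le_iSup b k) (le_iSup b' k)
  · have hρ : 0 ≤ q.toReal / p := by positivity
    refine lt_of_le_of_lt (ENNReal.tsum_le_tsum fun k =>
      ENNReal.add_rpow_le_two_rpow hρ (b k) (b' k)) ?_
    rw [ENNReal.tsum_mul_left, ENNReal.tsum_add]
    exact ENNReal.mul_lt_top (ENNReal.rpow_lt_top_of_nonneg hρ ENNReal.ofNat_ne_top)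
      (ENNReal.add_lt_top.2 ⟨hb.2 hq, hb'.2 hq⟩)

/-- A discrete Hardy inequality. -/
lemma SeqFin.hardy (hp : 1 ≤ p) (hq : 1 ≤ q) {a : ℤ → ℝ≥0∞} (ha : SeqFin p q a) {κ : ℝ≥0∞}
    (hκ : κ < 1) : SeqFin p q (fun k => ∑' n : ℕ, κ ^ n * a (k + n)) := by
  refine ⟨fun hq' => ?_, fun hq' => ?_⟩
  · refine lt_of_le_of_lt (iSup_le fun k => ?_)
      (ENNReal.mul_lt_top (tsum_geometric_lt_top.2 hκ) (ha.1 hq'))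
    rw [← ENNReal.tsum_mul_right]
    refine ENNReal.tsum_le_tsum fun n => ?_
    gcongr
    exact le_iSup a _
  · set ρ := q.toReal / p
    have hρ : 0 < ρ := div_pos (toReal_pos_of_one_le hq hq') (by positivity)
    -- Splitting `κ = κ₁ * κ₁` spends one factor on summing the series against a supremum and keeps
    -- the other to sum the `ρ`-th powers. This treats every `ρ > 0` at once, without separating `ρ
    -- < 1` from `ρ ≥ 1`.
    set κ₁ := κ ^ (1 / 2 : ℝ) with hκ₁
    have hκ₁1 : κ₁ < 1 := ENNReal.rpow_lt_one hκ (by norm_num)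
    have hκκ : κ = κ₁ * κ₁ := by
      rw [hκ₁, ← ENNReal.rpow_add_of_nonneg _ _ (by norm_num) (by norm_num)]; norm_num
    set G := ∑' n : ℕ, κ₁ ^ n
    have hG : G < ∞ := tsum_geometric_lt_top.2 hκ₁1
    have hb : ∀ k, (∑' n : ℕ, κ ^ n * a (k + n)) ^ ρ ≤
        G ^ ρ * ∑' n : ℕ, (κ₁ ^ ρ) ^ n * a (k + n) ^ ρ := by
      intro k
      set M := (∑' n : ℕ, (κ₁ ^ ρ) ^ n * a (k + n) ^ ρ) ^ (1 / ρ) with hM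
      have h1 : ∀ n : ℕ, κ₁ ^ n * a (k + n) ≤ M := by
        intro n
        rw [hM, one_div, ENNReal.le_rpow_inv_iff hρ, ENNReal.mul_rpow_of_nonneg _ _ hρ.le,
          ← ENNReal.rpow_natCast, ← ENNReal.rpow_mul, mul_comm (n : ℝ), ENNReal.rpow_mul,
          ENNReal.rpow_natCast]
        exact ENNReal.le_tsum n
      have h2 : ∑' n : ℕ, κ ^ n * a (k + n) ≤ G * M := by
        rw [← ENNReal.tsum_mul_right]
        refine ENNReal.tsum_le_tsum fun n => ?_
        rw [hκκ, mul_pow, mul_assoc]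
        gcongr
        exact h1 n
      calc _ ≤ (G * M) ^ ρ := by gcongr
        _ = G ^ ρ * M ^ ρ := ENNReal.mul_rpow_of_nonneg _ _ hρ.le
        _ = _ := by
          rw [hM, ← ENNReal.rpow_mul, one_div, inv_mul_cancel₀ hρ.ne', ENNReal.rpow_one]
    refine lt_of_le_of_lt (ENNReal.tsum_le_tsum hb) ?_
    rw [ENNReal.tsum_mul_left, ENNReal.tsum_comm]
    have h3 : ∀ n : ℕ, ∑' k : ℤ, (κ₁ ^ ρ) ^ n * a (k + n) ^ ρ =
        (κ₁ ^ ρ) ^ n * ∑' k, a k ^ ρ := by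
      intro n
      rw [ENNReal.tsum_mul_left]
      congr 1
      exact (Equiv.addRight (n : ℤ)).tsum_eq (fun k => a k ^ ρ)
    simp_rw [h3]
    rw [ENNReal.tsum_mul_right]
    refine ENNReal.mul_lt_top (ENNReal.rpow_lt_top_of_nonneg hρ.le hG.ne)
      (ENNReal.mul_lt_top (tsum_geometric_lt_top.2 (ENNReal.rpow_lt_one hκ₁1 hρ)) (ha.2 hq'))

/-- A sum over `ℤ` of a function of `|k|` is at most two geometric series over `ℕ`. It serves for
one-sided estimates, after discarding the half line where they are not needed. -/
lemma SeqFin.geometric (hp : 1 ≤ p) (hq : 1 ≤ q) {κ : ℝ≥0∞} (hκ : κ < 1) :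
    SeqFin p q (fun k => κ ^ k.natAbs) := by
  refine ⟨fun hq' => lt_of_le_of_lt (iSup_le fun k => pow_le_one' hκ.le _) ENNReal.one_lt_top,
    fun hq' => ?_⟩
  set ρ := q.toReal / p
  have hρ : 0 < ρ := div_pos (toReal_pos_of_one_le hq hq') (by positivity)
  have hinj : Function.Injective fun k : ℤ => (k.natAbs, decide (0 ≤ k)) := by
    intro k l h
    simp only [Prod.mk.injEq, decide_eq_decide] at h
    omega
  refine lt_of_le_of_lt (ENNReal.tsum_comp_le_tsum_of_injective hinj
    (fun x : ℕ × Bool => (κ ^ x.1) ^ ρ)) ?_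
  rw [ENNReal.tsum_prod (f := fun (n : ℕ) (_ : Bool) => (κ ^ n) ^ ρ)]
  simp only [tsum_fintype, Fintype.sum_bool, ← two_mul]
  rw [ENNReal.tsum_mul_left]
  refine ENNReal.mul_lt_top ENNReal.ofNat_lt_top ?_
  have : ∀ n : ℕ, (κ ^ n) ^ ρ = (κ ^ ρ) ^ n := fun n => by
    rw [← ENNReal.rpow_natCast, ← ENNReal.rpow_mul, mul_comm (n : ℝ), ENNReal.rpow_mul,
      ENNReal.rpow_natCast]
  simp_rw [this]
  exact tsum_geometric_lt_top.2 (ENNReal.rpow_lt_one hκ hρ)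

lemma SeqFin.exists_le (hp : 1 ≤ p) (hq : 1 ≤ q) {a : ℤ → ℝ≥0∞} (ha : SeqFin p q a) :
    ∃ B : ℝ≥0∞, B ≠ ∞ ∧ ∀ k, a k ≤ B := by
  rcases eq_or_ne q ∞ with hq' | hq'
  · exact ⟨_, (ha.1 hq').ne, le_iSup a⟩
  · have hρ : 0 < q.toReal / p := div_pos (toReal_pos_of_one_le hq hq') (by positivity)
    refine ⟨(∑' k, a k ^ (q.toReal / p)) ^ (q.toReal / p)⁻¹,
      ENNReal.rpow_ne_top_of_nonneg (by positivity) (ha.2 hq').ne, fun k => ?_⟩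
    rw [ENNReal.le_rpow_inv_iff hρ]
    exact ENNReal.le_tsum k

lemma disjoint_Ico_zpow {c : ℝ} (hc : 0 < c) :
    Pairwise (Function.onFun Disjoint fun i : ℤ => Set.Ico (c * 2 ^ i) (c * 2 ^ (i + 1))) := by
  have key : ∀ i j : ℤ, i < j →
      Disjoint (Set.Ico (c * 2 ^ i) (c * 2 ^ (i + 1))) (Set.Ico (c * 2 ^ j) (c * 2 ^ (j + 1))) := by
    intro i j hij
    refine disjoint_left.2 fun t ht ht' => ?_
    have : (2 : ℝ) ^ (i + 1) ≤ 2 ^ j := zpow_le_zpow_right₀ one_le_two (by omega)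
    have h2 : c * 2 ^ (i + 1) ≤ c * 2 ^ j := by gcongr
    linarith [ht.2, ht'.1]
  intro i j hij
  rcases lt_or_gt_of_ne hij with h | h
  · exact key i j h
  · exact (key j i h).symm

/-- Finite energy controls a sequence dominated by the oscillation on dyadic intervals. -/
lemma seqFin_of_energyOf_lt_top {s : ℝ} (hs : 0 < s) (hp : 1 ≤ p) (hq : 1 ≤ q)
    {O : ℝ → ℝ≥0∞} (hO : energyOf s p q O < ∞) {a : ℤ → ℝ≥0∞} {c : ℝ} (hc : 0 < c)
    {C : ℝ≥0∞} (hC : C ≠ ∞)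
    (h : ∀ i : ℤ, ∀ t ∈ Set.Ico (c * 2 ^ i) (c * 2 ^ (i + 1)),
      a i ≤ C * O t * ENNReal.ofReal (((2 : ℝ) ^ i) ^ (-(s * p)))) : SeqFin p q a := by
  have hp0 : 0 < p := one_pos.trans_le hp
  refine ⟨fun hq' => ?_, fun hq' => ?_⟩
  · subst hq'
    rw [energyOf_top] at hO
    set B := ⨆ (t : ℝ) (_ : 0 < t), ENNReal.ofReal (t ^ (-s)) * O t ^ (1 / p)
    have hB : C * (ENNReal.ofReal (c ^ (s * p)) * B ^ p) < ∞ :=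
      ENNReal.mul_lt_top hC.lt_top (ENNReal.mul_lt_top ENNReal.ofReal_lt_top
        (ENNReal.rpow_lt_top_of_nonneg hp0.le hO.ne))
    refine lt_of_le_of_lt (iSup_le fun i => ?_) hB
    have h2i : (0 : ℝ) < 2 ^ i := by positivity
    have hci : 0 < c * 2 ^ i := by positivity
    have h1 : ENNReal.ofReal ((c * 2 ^ i) ^ (-s)) * O (c * 2 ^ i) ^ (1 / p) ≤ B :=
      le_iSup₂ (f := fun t (_ : 0 < t) => ENNReal.ofReal (t ^ (-s)) * O t ^ (1 / p)) _ hci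
    have h2 : ENNReal.ofReal ((c * 2 ^ i) ^ (-(s * p))) * O (c * 2 ^ i) ≤ B ^ p := by
      calc _ = (ENNReal.ofReal ((c * 2 ^ i) ^ (-s)) * O (c * 2 ^ i) ^ (1 / p)) ^ p := by
            rw [ENNReal.mul_rpow_of_nonneg _ _ hp0.le, ← ENNReal.rpow_mul,
              one_div_mul_cancel hp0.ne', ENNReal.rpow_one,
              ENNReal.ofReal_rpow_of_pos (by positivity), ← Real.rpow_mul hci.le, neg_mul]
        _ ≤ _ := by gcongr
    have h3 : ENNReal.ofReal (((2 : ℝ) ^ i) ^ (-(s * p))) =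
        ENNReal.ofReal (c ^ (s * p)) * ENNReal.ofReal ((c * 2 ^ i) ^ (-(s * p))) := by
      rw [← ENNReal.ofReal_mul (by positivity), Real.mul_rpow hc.le h2i.le, ← mul_assoc,
        ← Real.rpow_add hc, add_neg_cancel, Real.rpow_zero, one_mul]
    calc a i ≤ C * O (c * 2 ^ i) * ENNReal.ofReal (((2 : ℝ) ^ i) ^ (-(s * p))) :=
          h i _ ⟨le_rfl, by rw [zpow_add_one₀ two_ne_zero]; nlinarith⟩
      _ = C * (ENNReal.ofReal (c ^ (s * p)) *
          (ENNReal.ofReal ((c * 2 ^ i) ^ (-(s * p))) * O (c * 2 ^ i))) := by rw [h3]; ring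
      _ ≤ _ := by gcongr
  · rw [energyOf_lt_top_iff hq hq'] at hO
    set Q := q.toReal with hQdef
    have hQ : 0 < Q := toReal_pos_of_one_le hq hq'
    set ρ := Q / p with hρdef
    have hρ : 0 < ρ := div_pos hQ hp0
    set g : ℝ → ℝ≥0∞ := fun t => O t ^ ρ * ENNReal.ofReal (t ^ (-(s * Q + 1)))
    set D : ℝ := (2 * c) ^ (s * Q + 1)
    set I : ℤ → Set ℝ := fun i => Set.Ico (c * 2 ^ i) (c * 2 ^ (i + 1))
    have hK : C ^ ρ * ENNReal.ofReal (D / c) ≠ ∞ :=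
      ENNReal.mul_ne_top (ENNReal.rpow_ne_top_of_nonneg hρ.le hC) ENNReal.ofReal_ne_top
    have hi : ∀ i, a i ^ ρ ≤ C ^ ρ * ENNReal.ofReal (D / c) * ∫⁻ t in I i, g t := by
      intro i
      have h2i : (0 : ℝ) < 2 ^ i := by positivity
      have hvol : volume (I i) = ENNReal.ofReal (c * 2 ^ i) := by
        simp only [I, Real.volume_Ico]
        congr 1
        rw [zpow_add_one₀ two_ne_zero]; ring
      have hK' : C ^ ρ * ENNReal.ofReal (D * 2 ^ i) ≠ ∞ :=
        ENNReal.mul_ne_top (ENNReal.rpow_ne_top_of_nonneg hρ.le hC) ENNReal.ofReal_ne_top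
      -- The constant `a i ^ ρ` is integrated over the dyadic interval, whose length is `c * 2 ^ i`;
      -- there `t` is comparable to `2 ^ i`, so the weight of the energy is, up to the constant `D`,
      -- the inverse length times `(2 ^ i) ^ (-(s * Q))`.
      have h1 : a i ^ ρ * ENNReal.ofReal (c * 2 ^ i) ≤
          C ^ ρ * ENNReal.ofReal (D * 2 ^ i) * ∫⁻ t in I i, g t := by
        rw [← hvol, ← setLIntegral_const, ← lintegral_const_mul' _ _ hK']
        refine setLIntegral_mono' measurableSet_Ico fun t ht => ?_
        have ht0 : 0 < t := lt_of_lt_of_le (by positivity) ht.1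
        have ht2 : t ≤ 2 * c * 2 ^ i := by
          have := ht.2.le
          rw [zpow_add_one₀ two_ne_zero] at this
          linarith
        have h4 : ((2 : ℝ) ^ i) ^ (-(s * Q)) ≤ D * 2 ^ i * t ^ (-(s * Q + 1)) := by
          have h5 : (2 * c * 2 ^ i) ^ (-(s * Q + 1)) ≤ t ^ (-(s * Q + 1)) :=
            Real.rpow_le_rpow_of_nonpos ht0 ht2 (by nlinarith [mul_pos hs hQ])
          calc ((2 : ℝ) ^ i) ^ (-(s * Q)) = D * 2 ^ i * (2 * c * 2 ^ i) ^ (-(s * Q + 1)) := by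
                rw [Real.mul_rpow (by positivity) h2i.le, Real.rpow_neg (x := 2 * c) (by positivity),
                  neg_add, Real.rpow_add h2i, Real.rpow_neg_one]
                have : (2 * c) ^ (s * Q + 1) ≠ 0 := by positivity
                simp only [D]
                field_simp
            _ ≤ _ := by gcongr
        calc a i ^ ρ ≤ (C * O t * ENNReal.ofReal (((2 : ℝ) ^ i) ^ (-(s * p)))) ^ ρ := by
              gcongr; exact h i t ht
          _ = C ^ ρ * O t ^ ρ * ENNReal.ofReal (((2 : ℝ) ^ i) ^ (-(s * Q))) := by
              rw [ENNReal.mul_rpow_of_nonneg _ _ hρ.le, ENNReal.mul_rpow_of_nonneg _ _ hρ.le,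
                ENNReal.ofReal_rpow_of_pos (by positivity), ← Real.rpow_mul h2i.le]
              congr 4
              rw [hρdef]; field_simp
          _ ≤ C ^ ρ * O t ^ ρ * ENNReal.ofReal (D * 2 ^ i * t ^ (-(s * Q + 1))) := by gcongr
          _ = _ := by
              rw [ENNReal.ofReal_mul (by positivity)]
              simp only [g]; ring
      have h2 : ENNReal.ofReal (D * 2 ^ i) = ENNReal.ofReal (D / c) * ENNReal.ofReal (c * 2 ^ i) := by
        rw [← ENNReal.ofReal_mul (by positivity)]
        congr 1; field_simp
      rw [h2] at h1
      have h3 : ENNReal.ofReal (c * 2 ^ i) ≠ 0 := by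
        rw [Ne, ENNReal.ofReal_eq_zero, not_le]; positivity
      refine (ENNReal.mul_le_mul_iff_left h3 ENNReal.ofReal_ne_top).1 (h1.trans_eq ?_)
      ring
    refine lt_of_le_of_lt (ENNReal.tsum_le_tsum hi) ?_
    rw [ENNReal.tsum_mul_left, ← lintegral_iUnion (fun _ => measurableSet_Ico) (disjoint_Ico_zpow hc)]
    refine ENNReal.mul_lt_top hK.lt_top (lt_of_le_of_lt (lintegral_mono_set ?_) hO)
    refine iUnion_subset fun i t ht => lt_of_lt_of_le ?_ ht.1
    positivity

/-- A dyadic bound of the oscillation by a summable sequence gives finite energy. -/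
lemma energyOf_lt_top_of_seqFin {s : ℝ} (hp : 1 ≤ p) (hq : 1 ≤ q) (hs : 0 < s)
    {O : ℝ → ℝ≥0∞} {b : ℤ → ℝ≥0∞} (hb : SeqFin p q b)
    (h : ∀ k : ℤ, ∀ t ∈ Set.Ico ((2 : ℝ) ^ k) (2 ^ (k + 1)),
      O t ≤ ENNReal.ofReal (((2 : ℝ) ^ k) ^ (s * p)) * b k) : energyOf s p q O < ∞ := by
  have hp0 : 0 < p := one_pos.trans_le hp
  rcases eq_or_ne q ∞ with rfl | hq'
  · rw [energyOf_top]
    refine lt_of_le_of_lt (iSup₂_le fun t ht => ?_)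
      (ENNReal.rpow_lt_top_of_nonneg (y := 1 / p) (by positivity) (hb.1 rfl).ne)
    obtain ⟨k, hk⟩ := exists_mem_Ico_zpow ht (one_lt_two (α := ℝ))
    have h2k : (0 : ℝ) < 2 ^ k := by positivity
    calc ENNReal.ofReal (t ^ (-s)) * O t ^ (1 / p)
        ≤ ENNReal.ofReal (((2 : ℝ) ^ k) ^ (-s)) *
          (ENNReal.ofReal (((2 : ℝ) ^ k) ^ (s * p)) * b k) ^ (1 / p) := by
          gcongr ENNReal.ofReal ?_ * ?_ ^ _
          · exact Real.rpow_le_rpow_of_nonpos h2k hk.1 (by linarith)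
          · exact h k t hk
      _ = b k ^ (1 / p) := by
          rw [ENNReal.mul_rpow_of_nonneg _ _ (by positivity), ← mul_assoc,
            ENNReal.ofReal_rpow_of_pos (by positivity), ← Real.rpow_mul h2k.le,
            ← ENNReal.ofReal_mul (by positivity), ← Real.rpow_add h2k]
          have : -s + s * p * (1 / p) = 0 := by field_simp; ring
          rw [this]; simp
      _ ≤ _ := by gcongr; exact le_iSup b k
  · rw [energyOf_lt_top_iff hq hq']
    set Q := q.toReal with hQdef
    have hQ : 0 < Q := toReal_pos_of_one_le hq hq'
    set ρ := Q / p with hρdef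
    have hρ : 0 < ρ := div_pos hQ hp0
    have hcover : Set.Ioi (0 : ℝ) ⊆ ⋃ k : ℤ, Set.Ico ((2 : ℝ) ^ k) (2 ^ (k + 1)) := fun t ht =>
      mem_iUnion.2 (exists_mem_Ico_zpow ht (one_lt_two (α := ℝ)))
    refine lt_of_le_of_lt ((lintegral_mono_set hcover).trans (lintegral_iUnion_le _ _)) ?_
    refine lt_of_le_of_lt (ENNReal.tsum_le_tsum fun k => ?_) (hb.2 hq')
    have h2k : (0 : ℝ) < 2 ^ k := by positivity
    calc ∫⁻ t in Set.Ico ((2 : ℝ) ^ k) (2 ^ (k + 1)),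
          O t ^ ρ * ENNReal.ofReal (t ^ (-(s * Q + 1)))
        ≤ ∫⁻ _ in Set.Ico ((2 : ℝ) ^ k) (2 ^ (k + 1)),
          (ENNReal.ofReal (((2 : ℝ) ^ k) ^ (s * p)) * b k) ^ ρ *
            ENNReal.ofReal (((2 : ℝ) ^ k) ^ (-(s * Q + 1))) := by
          refine setLIntegral_mono' measurableSet_Ico fun t ht => ?_
          gcongr ?_ ^ _ * ENNReal.ofReal ?_
          · exact h k t ht
          · exact Real.rpow_le_rpow_of_nonpos h2k ht.1 (by nlinarith [mul_pos hs hQ])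
      _ = b k ^ ρ := by
          rw [setLIntegral_const, Real.volume_Ico, ENNReal.mul_rpow_of_nonneg _ _ hρ.le,
            ENNReal.ofReal_rpow_of_pos (by positivity), ← Real.rpow_mul h2k.le]
          have e1 : (2 : ℝ) ^ (k + 1) - 2 ^ k = 2 ^ k := by rw [zpow_add_one₀ two_ne_zero]; ring
          have e2 : s * p * ρ = s * Q := by rw [hρdef]; field_simp
          -- The length `2 ^ k` of the interval cancels the extra `1` in the exponent of the weight,
          -- so the constant is exactly one.
          have e3 : ((2 : ℝ) ^ k) ^ (s * Q) * ((2 : ℝ) ^ k) ^ (-(s * Q + 1)) * 2 ^ k = 1 := by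
            rw [← Real.rpow_add h2k, show s * Q + -(s * Q + 1) = -1 by ring, Real.rpow_neg_one,
              inv_mul_cancel₀ h2k.ne']
          rw [e1, e2]
          calc _ = b k ^ ρ * (ENNReal.ofReal (((2 : ℝ) ^ k) ^ (s * Q)) *
                ENNReal.ofReal (((2 : ℝ) ^ k) ^ (-(s * Q + 1))) * ENNReal.ofReal (2 ^ k)) := by ring
            _ = _ := by
              rw [← ENNReal.ofReal_mul (by positivity), ← ENNReal.ofReal_mul (by positivity), e3]
              simp

end Energy

/-! ### Codimension regularity up to a prescribed radius. -/

section Regularity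

variable {Ω : Type*} [MetricSpace Ω] [MeasurableSpace Ω] {μ : Measure Ω}
  {ν : Measure (Boundary Ω)} {θ : ℝ} {R₀ : ℝ≥0∞}

/-- Codimension `θ` Ahlfors regularity for the radii up to `R₀`. -/
def RegularUpTo (μ : Measure Ω) (ν : Measure (Boundary Ω)) (θ : ℝ) (R₀ : ℝ≥0∞) : Prop :=
  ∃ C : ℝ≥0∞, C ≠ ∞ ∧ ∀ (z : Boundary Ω) (r : ℝ), 0 < r → ENNReal.ofReal r ≤ R₀ →
    μ (tracedBall (z : Completion Ω) r) ≤ C * ENNReal.ofReal (r ^ θ) * ν (Metric.ball z r) ∧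
    ν (Metric.ball z r) ≤ C * ENNReal.ofReal (r ^ (-θ)) * μ (tracedBall (z : Completion Ω) r)

lemma RegularUpTo.mono {R₁ : ℝ≥0∞} (h : RegularUpTo μ ν θ R₀) (hR : R₁ ≤ R₀) :
    RegularUpTo μ ν θ R₁ := by
  obtain ⟨C, hC, h⟩ := h
  exact ⟨C, hC, fun z r hr hr' => h z r hr (hr'.trans hR)⟩

lemma IsCodimRegular.regularUpTo_two_mul_ediam (hν : IsCodimRegular μ ν θ) :
    RegularUpTo μ ν θ (2 * Metric.ediam (Set.univ : Set (Boundary Ω))) := by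
  obtain ⟨C, hC, h⟩ := hν
  refine ⟨C, ENNReal.coe_ne_top, fun z r hr hr' => ?_⟩
  obtain ⟨h1, h2⟩ := h z r hr hr'
  have hrθ : 0 < r ^ θ := by positivity
  have h0 : ENNReal.ofReal (r ^ θ) ≠ 0 := by
    rw [Ne, ENNReal.ofReal_eq_zero, not_le]; exact hrθ
  have hC0 : (C : ℝ≥0∞) ≠ 0 := by
    simp only [ne_eq, ENNReal.coe_eq_zero]
    exact (one_pos.trans_le hC).ne'
  rw [trBall_eq_tracedBall] at h1 h2
  constructor
  · rw [ENNReal.inv_mul_le_iff hC0 ENNReal.coe_ne_top,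
      ENNReal.div_le_iff h0 ENNReal.ofReal_ne_top] at h1
    exact h1.trans_eq (by ring)
  · refine h2.trans_eq ?_
    rw [ENNReal.div_eq_inv_mul, ← mul_assoc, Real.rpow_neg hr.le, ENNReal.ofReal_inv_of_pos hrθ]

/-- Regularity extends beyond the diameter of the boundary. -/
lemma IsCodimRegular.regularUpTo (hν : IsCodimRegular μ ν θ) (hμ : IsDoubling μ) (hθ : 0 < θ)
    (h0 : Metric.ediam (Set.univ : Set (Boundary Ω)) ≠ 0)
    (hR : R₀ ≠ ∞ ∨ Metric.ediam (Set.univ : Set (Boundary Ω)) = ∞) : RegularUpTo μ ν θ R₀ := by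
  by_cases htop : Metric.ediam (Set.univ : Set (Boundary Ω)) = ∞
  · refine hν.regularUpTo_two_mul_ediam.mono ?_
    rw [htop, ENNReal.mul_top two_ne_zero]
    exact le_top
  have hR : R₀ ≠ ∞ := hR.resolve_right htop
  obtain ⟨C, hC, h⟩ := hν.regularUpTo_two_mul_ediam
  have hd2 : 2 * Metric.ediam (Set.univ : Set (Boundary Ω)) ≠ ∞ :=
    ENNReal.mul_ne_top ENNReal.ofNat_ne_top htop
  set d := (2 * Metric.ediam (Set.univ : Set (Boundary Ω))).toReal with hd
  have hdpos : 0 < d := ENNReal.toReal_pos (mul_ne_zero two_ne_zero h0) hd2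
  have hofd : ENNReal.ofReal d = 2 * Metric.ediam (Set.univ : Set (Boundary Ω)) :=
    ENNReal.ofReal_toReal hd2
  have hball : ∀ (z : Boundary Ω) (r : ℝ), d ≤ r → Metric.ball z r = Set.univ := by
    intro z r hr
    refine eq_univ_of_forall fun w => ?_
    have h1 : edist w z ≤ Metric.ediam (Set.univ : Set (Boundary Ω)) :=
      Metric.edist_le_ediam_of_mem (mem_univ _) (mem_univ _)
    rw [Metric.mem_ball]
    have h2 : dist w z ≤ (Metric.ediam (Set.univ : Set (Boundary Ω))).toReal := by
      rw [dist_edist]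
      exact ENNReal.toReal_mono htop h1
    have h3 : d = 2 * (Metric.ediam (Set.univ : Set (Boundary Ω))).toReal := by
      rw [hd, ENNReal.toReal_mul]; rfl
    linarith
  -- Beyond `d`, twice the diameter, the boundary balls are all of `∂Ω`. A radius in `(d, R₀]` is at
  -- most `L * d`, so doubling of `μ` and the values at `d` give both inequalities, with constants
  -- depending on `L`.
  set L := R₀.toReal / d
  obtain ⟨C₁, hC₁, h₁⟩ := hμ.exists_tracedBall_le L
  refine ⟨C + C * C₁ + C * ENNReal.ofReal (L ^ θ), by finiteness, fun z r hr hr' => ?_⟩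
  rcases le_or_gt r d with hrd | hrd
  · obtain ⟨h2, h3⟩ := h z r hr (by rw [← hofd]; exact ENNReal.ofReal_le_ofReal hrd)
    constructor
    · refine h2.trans ?_
      gcongr
      rw [add_assoc]; exact le_self_add
    · refine h3.trans ?_
      gcongr
      rw [add_assoc]; exact le_self_add
  · obtain ⟨h2, h3⟩ := h z d hdpos hofd.le
    have hrL : r ≤ L * d := by
      simp only [L]
      rw [div_mul_cancel₀ _ hdpos.ne']
      exact (ENNReal.ofReal_le_iff_le_toReal hR).1 hr'
    rw [hball z d le_rfl] at h2 h3
    rw [hball z r hrd.le]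
    constructor
    · calc μ (tracedBall (z : Completion Ω) r) ≤ C₁ * μ (tracedBall (z : Completion Ω) d) :=
            h₁ _ _ _ _ hdpos (by simpa using hrL)
        _ ≤ C₁ * (C * ENNReal.ofReal (r ^ θ) * ν Set.univ) := by
            gcongr
            refine h2.trans ?_
            gcongr
        _ = C * C₁ * ENNReal.ofReal (r ^ θ) * ν Set.univ := by ring
        _ ≤ _ := by
            gcongr
            rw [add_right_comm]; exact le_add_self
    · have hLpos : 0 < L := by
        by_contra hL
        push Not at hL
        nlinarith
      calc ν Set.univ ≤ C * ENNReal.ofReal (d ^ (-θ)) * μ (tracedBall (z : Completion Ω) d) := h3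
        _ ≤ C * ENNReal.ofReal (L ^ θ * r ^ (-θ)) * μ (tracedBall (z : Completion Ω) r) := by
            gcongr
            · have : (L * d) ^ (-θ) ≤ r ^ (-θ) :=
                Real.rpow_le_rpow_of_nonpos hr hrL (by linarith)
              calc d ^ (-θ) = L ^ θ * (L * d) ^ (-θ) := by
                    rw [Real.mul_rpow hLpos.le hdpos.le, ← mul_assoc, ← Real.rpow_add hLpos]
                    simp
                _ ≤ _ := by gcongr
            · exact tracedBall_subset (by simpa using hrd.le)
        _ = C * ENNReal.ofReal (L ^ θ) * ENNReal.ofReal (r ^ (-θ)) *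
            μ (tracedBall (z : Completion Ω) r) := by
            rw [ENNReal.ofReal_mul (by positivity)]; ring
        _ ≤ _ := by
            gcongr
            exact le_add_self

lemma RegularUpTo.measure_ball_lt_top (h : RegularUpTo μ ν θ R₀) (hμ : IsDoubling μ)
    (z : Boundary Ω) {r : ℝ} (hr : 0 < r) (hR : ENNReal.ofReal r ≤ R₀) :
    ν (Metric.ball z r) < ∞ := by
  obtain ⟨C, hC, h⟩ := h
  exact (h z r hr hR).2.trans_lt (ENNReal.mul_lt_top (by finiteness)
    (hμ.measure_tracedBall_lt_top _ _))

lemma RegularUpTo.measure_ball_pos (h : RegularUpTo μ ν θ R₀) (hμ : IsDoubling μ)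
    (z : Boundary Ω) {r : ℝ} (hr : 0 < r) (hR : ENNReal.ofReal r ≤ R₀) :
    0 < ν (Metric.ball z r) := by
  obtain ⟨C, hC, h⟩ := h
  have h1 := (hμ.measure_tracedBall_pos (z : Completion Ω) hr).trans_le (h z r hr hR).1
  rw [pos_iff_ne_zero] at h1 ⊢
  exact right_ne_zero_of_mul h1

/-- Comparison of the `ν`-measures of balls of comparable sizes, close to each other. -/
lemma RegularUpTo.exists_ball_le (h : RegularUpTo μ ν θ R₀) (hμ : IsDoubling μ) (hθ : 0 < θ)
    (L : ℝ) : ∃ C : ℝ≥0∞, C ≠ ∞ ∧ ∀ (z z' : Boundary Ω) (s r : ℝ), 0 < r → r ≤ s →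
      s + dist z z' ≤ L * r → ENNReal.ofReal s ≤ R₀ →
      ν (Metric.ball z s) ≤ C * ν (Metric.ball z' r) := by
  obtain ⟨C, hC, h⟩ := h
  obtain ⟨C₁, hC₁, h₁⟩ := hμ.exists_tracedBall_le L
  refine ⟨C * C₁ * C, by finiteness, fun z z' s r hr hrs hL hs => ?_⟩
  have hrθ : 0 < r ^ θ := by positivity
  calc ν (Metric.ball z s)
      ≤ C * ENNReal.ofReal (s ^ (-θ)) * μ (tracedBall (z : Completion Ω) s) :=
        (h z s (hr.trans_le hrs) hs).2
    _ ≤ C * ENNReal.ofReal (r ^ (-θ)) * (C₁ * μ (tracedBall (z' : Completion Ω) r)) := by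
        gcongr C * ENNReal.ofReal ?_ * ?_
        · exact Real.rpow_le_rpow_of_nonpos hr hrs (by linarith)
        · exact h₁ _ _ _ _ hr hL
    _ ≤ C * ENNReal.ofReal (r ^ (-θ)) *
        (C₁ * (C * ENNReal.ofReal (r ^ θ) * ν (Metric.ball z' r))) := by
        gcongr
        exact (h z' r hr ((ENNReal.ofReal_le_ofReal hrs).trans hs)).1
    _ = C * C₁ * C * (ENNReal.ofReal (r ^ (-θ)) * ENNReal.ofReal (r ^ θ)) *
        ν (Metric.ball z' r) := by ring
    _ = _ := by
        rw [← ENNReal.ofReal_mul (by positivity), ← Real.rpow_add hr]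
        simp

end Regularity

/-! ### Jensen's inequality for mean values. -/

section Jensen

variable {X : Type*} [MeasurableSpace X] {ν : Measure X} {f : X → ℝ} {p : ℝ}

/-- For the normalised restriction of `ν` to `U`, a probability measure, the `L^1` norm of `f - c`
is at most its `L^p` norm. Multiplying through by `ν U` avoids a quotient. -/
lemma enorm_setAverage_sub_rpow_le (hp : 1 ≤ p) {U : Set X} (h0 : ν U ≠ 0) (htop : ν U ≠ ∞)
    (hf : IntegrableOn f U ν) (c : ℝ) :
    ‖(⨍ x in U, f x ∂ν) - c‖ₑ ^ p * ν U ≤ ∫⁻ x in U, ‖f x - c‖ₑ ^ p ∂ν := by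
  have hp0 : 0 < p := one_pos.trans_le hp
  have : IsFiniteMeasure (ν.restrict U) := ⟨by simpa using htop.lt_top⟩
  have : NeZero (ν.restrict U) := ⟨by simpa [Measure.restrict_eq_zero] using h0⟩
  set P := ((ν.restrict U) Set.univ)⁻¹ • ν.restrict U with hP
  have hPprob : IsProbabilityMeasure P := isProbabilityMeasureSMul
  have hfc : Integrable (fun x => f x - c) (ν.restrict U) := hf.sub (integrable_const c)
  have hPi : Integrable f P := hf.to_average
  have h1 : (⨍ x in U, f x ∂ν) - c = ∫ x, (f x - c) ∂P := by
    rw [integral_sub hPi (integrable_const c), integral_const, probReal_univ, one_smul]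
    rfl
  have h2 : ‖(⨍ x in U, f x ∂ν) - c‖ₑ ≤ eLpNorm (fun x => f x - c) (ENNReal.ofReal p) P := by
    rw [h1]
    calc ‖∫ x, (f x - c) ∂P‖ₑ ≤ ∫⁻ x, ‖f x - c‖ₑ ∂P := enorm_integral_le_lintegral_enorm _
      _ = eLpNorm (fun x => f x - c) 1 P := eLpNorm_one_eq_lintegral_enorm.symm
      _ ≤ _ := eLpNorm_le_eLpNorm_of_exponent_le (by simpa using hp)
          (hPi.sub (integrable_const c)).aestronglyMeasurable
  have h3 : ‖(⨍ x in U, f x ∂ν) - c‖ₑ ^ p ≤ ∫⁻ x, ‖f x - c‖ₑ ^ p ∂P := by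
    rw [eLpNorm_eq_lintegral_rpow_enorm_toReal (by simpa using hp0) ENNReal.ofReal_ne_top,
      ENNReal.toReal_ofReal hp0.le, one_div, ENNReal.le_rpow_inv_iff hp0] at h2
    exact h2
  calc _ ≤ (∫⁻ x, ‖f x - c‖ₑ ^ p ∂P) * ν U := by gcongr
    _ = _ := by
      rw [hP, lintegral_smul_measure, Measure.restrict_apply_univ, smul_eq_mul, mul_comm,
        ← mul_assoc, ENNReal.mul_inv_cancel h0 htop, one_mul]

/-- Jensen twice: over `U` with the mean over `V` as the constant, then over `V` with the constant
`f a`. -/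
lemma enorm_setAverage_sub_setAverage_rpow_le (hp : 1 ≤ p) {U V : Set X} (hU : ν U ≠ 0)
    (hU' : ν U ≠ ∞) (hV : ν V ≠ 0) (hV' : ν V ≠ ∞) (hfU : IntegrableOn f U ν)
    (hfV : IntegrableOn f V ν) :
    ‖(⨍ x in U, f x ∂ν) - ⨍ x in V, f x ∂ν‖ₑ ^ p * ν U * ν V ≤
      ∫⁻ a in U, ∫⁻ b in V, ‖f b - f a‖ₑ ^ p ∂ν ∂ν := by
  calc _ ≤ (∫⁻ a in U, ‖f a - ⨍ x in V, f x ∂ν‖ₑ ^ p ∂ν) * ν V := by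
        gcongr
        exact enorm_setAverage_sub_rpow_le hp hU hU' hfU _
    _ = ∫⁻ a in U, ‖f a - ⨍ x in V, f x ∂ν‖ₑ ^ p * ν V ∂ν := (lintegral_mul_const' _ _ hV').symm
    _ ≤ _ := by
        refine lintegral_mono fun a => ?_
        rw [enorm_sub_rev]
        exact enorm_setAverage_sub_rpow_le hp hV hV' hfV _

end Jensen

/-! ### Locally finite sums over the partition of unity. -/

section Synthesis

variable {Ω : Type*} [MetricSpace Ω] {ι : Type}

namespace WhitneyData

variable (W : WhitneyData Ω ι)

/-- The locally finite sum `∑_j a_j φ_j`. -/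
noncomputable def synth (a : ι → ℝ) (x : Ω) : ℝ := ∑' j, a j * W.pou j x

/-- The mean values `⨍_{U_j} f dν`. -/
noncomputable def avg (ν : Measure (Boundary Ω)) (f : Boundary Ω → ℝ) (j : ι) : ℝ :=
  ⨍ z in Metric.ball (W.closest j) (W.radius j), f z ∂ν

lemma homExt_eq_synth (ν : Measure (Boundary Ω)) (f : Boundary Ω → ℝ) :
    W.homExt ν f = W.synth (W.avg ν f) := rfl

lemma radius_pos (j : ι) : 0 < W.radius j := lt_trans (by positivity) (W.level_lt j)

lemma bdryDist_center (j : ι) : bdryDist (W.center j) = 8 * W.radius j := by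
  rw [W.radius_eq]; ring

lemma dist_center_closest (j : ι) :
    dist (W.center j : Completion Ω) (W.closest j : Completion Ω) = 8 * W.radius j := by
  rw [W.dist_closest, W.bdryDist_center]

lemma bdryDist_bounds {K : ℝ} {j : ι} {x : Ω}
    (hx : x ∈ Metric.ball (W.center j) (K * W.radius j)) :
    (8 - K) * W.radius j < bdryDist x ∧ bdryDist x < (8 + K) * W.radius j :=
  bdryDist_bounds_of_mem_ball (W.radius_eq j) hx

lemma mem_ball_of_cover (x : Ω) : ∃ j, x ∈ Metric.ball (W.center j) (2 * W.radius j) := by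
  obtain ⟨j, hj⟩ := W.cover x
  exact ⟨j, Metric.ball_subset_ball (by linarith [W.radius_pos j]) hj⟩

lemma bdryDist_pos (W : WhitneyData Ω ι) (x : Ω) : 0 < bdryDist x := by
  obtain ⟨j, hj⟩ := W.mem_ball_of_cover x
  linarith [(W.bdryDist_bounds hj).1, W.radius_pos j]

lemma exists_overlap : ∃ N : ℕ, ∀ x : Ω,
    {j | x ∈ Metric.ball (W.center j) (3 * W.radius j)}.encard ≤ N :=
  exists_overlap_three W.level_lt W.le_level W.radius_eq W.level_overlap

lemma finite_overlap (x : Ω) : {j | x ∈ Metric.ball (W.center j) (3 * W.radius j)}.Finite := by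
  obtain ⟨N, hN⟩ := W.exists_overlap
  exact finite_of_encard_le_coe (hN x)

/-- The origin of the threshold `11`: a ball active at `y` has `d(x, ∂Ω) < 10 r + t`, so `11 t ≤
d(x, ∂Ω)` forces `t < r`, and moving by less than `t` stays inside the tripled ball. -/
lemma mem_ball_three {x y : Ω} {t : ℝ} (hx : 11 * t ≤ bdryDist x) (hxy : dist x y < t) {j : ι}
    (hy : y ∈ Metric.ball (W.center j) (2 * W.radius j)) :
    x ∈ Metric.ball (W.center j) (3 * W.radius j) := by
  have h1 := (W.bdryDist_bounds hy).2
  have h2 := bdryDist_lipschitz x y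
  rw [Metric.mem_ball] at hy ⊢
  linarith [dist_triangle x y (W.center j)]

/-- The finite index set depends on `x` alone, so the same one serves for all `y` close to `x` and
the sums can be subtracted term by term. -/
lemma synth_eq_sum (a : ι → ℝ) {x y : Ω} {t : ℝ} (hx : 11 * t ≤ bdryDist x)
    (hxy : dist x y < t) :
    W.synth a y = ∑ j ∈ (W.finite_overlap x).toFinset, a j * W.pou j y := by
  refine tsum_eq_sum fun j hj => ?_
  rw [W.pou_support j y, mul_zero]
  intro hy
  exact hj (by simpa using W.mem_ball_three hx hxy hy)

lemma sum_pou_eq_one {x y : Ω} {t : ℝ} (hx : 11 * t ≤ bdryDist x)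
    (hxy : dist x y < t) : ∑ j ∈ (W.finite_overlap x).toFinset, W.pou j y = 1 := by
  rw [← (W.pou_sum y).tsum_eq]
  refine (tsum_eq_sum fun j hj => W.pou_support j y fun hy => hj ?_).symm
  simpa using W.mem_ball_three hx hxy hy

lemma hasSum_synth (a : ι → ℝ) (x : Ω) : HasSum (fun j => a j * W.pou j x) (W.synth a x) := by
  have hx := W.bdryDist_pos x
  have h : 11 * (bdryDist x / 11) ≤ bdryDist x := by linarith
  have h' : dist x x < bdryDist x / 11 := by rw [dist_self]; positivity
  rw [W.synth_eq_sum a h h']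
  refine hasSum_sum_of_ne_finset_zero fun j hj => ?_
  rw [W.pou_support j x, mul_zero]
  intro hy
  exact hj (by simpa using W.mem_ball_three h h' hy)

lemma continuous_pou (j : ι) : Continuous (W.pou j) := by
  obtain ⟨C, hC⟩ := W.pou_lipschitz
  have h0 : ∀ x y, |W.pou j x - W.pou j y| ≤ (max (C / W.radius j) 0).toNNReal * dist x y := by
    intro x y
    rw [Real.coe_toNNReal _ (le_max_right _ _)]
    refine (hC j x y).trans ?_
    gcongr
    exact le_max_left _ _
  exact (LipschitzWith.of_dist_le_mul h0).continuous

lemma continuous_synth (a : ι → ℝ) : Continuous (W.synth a) := by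
  rw [continuous_iff_continuousAt]
  intro x
  have hx := W.bdryDist_pos x
  have hev : W.synth a =ᶠ[𝓝 x]
      fun y => ∑ j ∈ (W.finite_overlap x).toFinset, a j * W.pou j y := by
    filter_upwards [Metric.ball_mem_nhds x (show 0 < bdryDist x / 11 by positivity)] with y hy
    refine W.synth_eq_sum a (t := bdryDist x / 11) (by linarith) ?_
    rwa [dist_comm]
  refine ContinuousAt.congr ?_ hev.symm
  exact (continuous_finsetSum _ fun j _ =>
    continuous_const.mul (W.continuous_pou j)).continuousAt

/-- A convex combination of numbers within `M` of `c` is within `M` of `c`; only the balls active at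
`x` carry weight. -/
lemma enorm_synth_sub_le {a : ι → ℝ} {x : Ω} {c : ℝ} {M : ℝ≥0∞}
    (h : ∀ j, x ∈ Metric.ball (W.center j) (2 * W.radius j) → ‖a j - c‖ₑ ≤ M) :
    ‖W.synth a x - c‖ₑ ≤ M := by
  induction M with
  | top => exact le_top
  | coe M =>
    have h1 : HasSum (fun j => (a j - c) * W.pou j x) (W.synth a x - c) := by
      have := (W.hasSum_synth a x).sub ((W.pou_sum x).mul_left c)
      simpa [sub_mul] using this
    have h2 : HasSum (fun j => (M : ℝ) * W.pou j x) M := by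
      simpa using (W.pou_sum x).mul_left (M : ℝ)
    have h3 : ‖W.synth a x - c‖ ≤ M := by
      refine h1.norm_le_of_bounded h2 fun j => ?_
      rw [norm_mul, Real.norm_of_nonneg (W.pou_nonneg j x)]
      by_cases hj : x ∈ Metric.ball (W.center j) (2 * W.radius j)
      · have := h j hj
        gcongr
        · exact W.pou_nonneg j x
        · exact enorm_le_coe.1 this
      · simp [W.pou_support j x hj]
    exact enorm_le_coe.2 h3

lemma enorm_synth_sub_synth_le {a : ι → ℝ} {x y : Ω} {M : ℝ≥0∞}
    (h : ∀ j k, x ∈ Metric.ball (W.center j) (2 * W.radius j) →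
      y ∈ Metric.ball (W.center k) (2 * W.radius k) → ‖a k - a j‖ₑ ≤ M) :
    ‖W.synth a y - W.synth a x‖ₑ ≤ M := by
  refine W.enorm_synth_sub_le fun k hk => ?_
  rw [enorm_sub_rev]
  refine W.enorm_synth_sub_le fun j hj => ?_
  rw [enorm_sub_rev]
  exact h j k hj hk

/-- Far from the boundary, `∑_j a_j φ_j` is Lipschitz at the scale of the distance to it. -/
lemma exists_enorm_synth_sub_synth_le_far : ∃ C : ℝ≥0∞, C ≠ ∞ ∧ ∀ (a : ι → ℝ) (x y : Ω) (t : ℝ)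
    (M : ℝ≥0∞), 11 * t ≤ bdryDist x → dist x y < t →
    (∀ j k, x ∈ Metric.ball (W.center j) (3 * W.radius j) →
      x ∈ Metric.ball (W.center k) (3 * W.radius k) →
      ENNReal.ofReal (t / W.radius j) * ‖a k - a j‖ₑ ≤ M) →
    ‖W.synth a y - W.synth a x‖ₑ ≤ C * M := by
  obtain ⟨N, hN⟩ := W.exists_overlap
  obtain ⟨C, hC⟩ := W.pou_lipschitz
  refine ⟨N * ENNReal.ofReal C, by finiteness, fun a x y t M hx hxy h => ?_⟩
  have ht : 0 < t := dist_nonneg.trans_lt hxy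
  obtain ⟨k, hk⟩ := W.mem_ball_of_cover x
  have hk3 : x ∈ Metric.ball (W.center k) (3 * W.radius k) :=
    Metric.ball_subset_ball (by linarith [W.radius_pos k]) hk
  set F := (W.finite_overlap x).toFinset
  have hcard : F.card ≤ N := by
    have := hN x
    rw [(W.finite_overlap x).encard_eq_coe_toFinset_card] at this
    exact_mod_cast this
  have hxx : dist x x < t := by rwa [dist_self]
  -- The weights sum to one at both points, so subtracting the fixed coefficient `a k` changes
  -- nothing and leaves differences of neighbouring coefficients.
  have hid : W.synth a y - W.synth a x = ∑ j ∈ F, (a j - a k) * (W.pou j y - W.pou j x) := by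
    have h1 := W.sum_pou_eq_one hx hxy
    have h2 := W.sum_pou_eq_one hx hxx
    rw [W.synth_eq_sum a hx hxy, W.synth_eq_sum a hx hxx]
    have : ∑ j ∈ F, (a j - a k) * (W.pou j y - W.pou j x) =
        (∑ j ∈ F, a j * W.pou j y - ∑ j ∈ F, a j * W.pou j x) -
        a k * (∑ j ∈ F, W.pou j y - ∑ j ∈ F, W.pou j x) := by
      rw [← Finset.sum_sub_distrib, ← Finset.sum_sub_distrib, Finset.mul_sum,
        ← Finset.sum_sub_distrib]
      exact Finset.sum_congr rfl fun j _ => by ring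
    rw [this, h1, h2]; ring
  rw [hid]
  refine (enorm_sum_le _ _).trans ?_
  have hterm : ∀ j ∈ F, ‖(a j - a k) * (W.pou j y - W.pou j x)‖ₑ ≤ ENNReal.ofReal C * M := by
    intro j hj
    have hj3 : x ∈ Metric.ball (W.center j) (3 * W.radius j) := by simpa [F] using hj
    have hrj := W.radius_pos j
    rw [enorm_mul]
    have h1 : ‖W.pou j y - W.pou j x‖ₑ ≤ ENNReal.ofReal C * ENNReal.ofReal (t / W.radius j) := by
      rw [Real.enorm_eq_ofReal_abs, ← ENNReal.ofReal_mul' (by positivity)]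
      -- The Lipschitz constant comes without a sign; if it is negative, the increment of `φ_j`
      -- vanishes.
      rcases le_or_gt 0 C with hC0 | hC0
      · refine ENNReal.ofReal_le_ofReal ((hC j y x).trans ?_)
        rw [dist_comm]
        calc C / W.radius j * dist x y ≤ C / W.radius j * t := by gcongr
          _ = _ := by ring
      · have h5 : C / W.radius j * dist y x ≤ 0 :=
          mul_nonpos_of_nonpos_of_nonneg (div_nonpos_of_nonpos_of_nonneg hC0.le hrj.le) dist_nonneg
        rw [ENNReal.ofReal_of_nonpos ((hC j y x).trans h5)]
        exact zero_le
    calc _ ≤ ‖a j - a k‖ₑ * (ENNReal.ofReal C * ENNReal.ofReal (t / W.radius j)) := by gcongr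
      _ = ENNReal.ofReal C * (ENNReal.ofReal (t / W.radius j) * ‖a k - a j‖ₑ) := by
          rw [enorm_sub_rev]; ring
      _ ≤ _ := by gcongr; exact h j k hj3 hk3
  refine (Finset.sum_le_card_nsmul _ _ _ hterm).trans ?_
  rw [nsmul_eq_mul, mul_assoc]
  gcongr

end WhitneyData

end Synthesis

/-! ### Oscillation of the extension in terms of coefficient differences. -/

section OscillationEstimates

lemma ENNReal.inv_le_mul_inv {a b C : ℝ≥0∞} (ha : a ≠ 0) (ha' : a ≠ ∞) (h : a ≤ C * b) :
    b⁻¹ ≤ C * a⁻¹ := by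
  calc b⁻¹ = a * a⁻¹ * b⁻¹ := by rw [ENNReal.mul_inv_cancel ha ha', one_mul]
    _ ≤ C * b * a⁻¹ * b⁻¹ := by gcongr
    _ = C * a⁻¹ * (b * b⁻¹) := by ring
    _ ≤ C * a⁻¹ * 1 := by gcongr; exact ENNReal.mul_inv_le_one b
    _ = _ := mul_one _

-- Maximum against sum: the `p`-th power of a maximum is at most the sum of the `p`-th powers. The
-- choice `M = S ^ p⁻¹` turns pointwise maximum bounds into sums that can be integrated term by
-- term.
open Classical in
lemma rpow_le_mul_tsum_tsum {ι κ : Type*} {P : ι → κ → Prop} {v : ι → κ → ℝ≥0∞} {X C : ℝ≥0∞}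
    {p : ℝ} (hp : 0 < p) (h : ∀ M, (∀ j k, P j k → v j k ≤ M) → X ≤ C * M) :
    X ^ p ≤ C ^ p * ∑' j, ∑' k, if P j k then v j k ^ p else 0 := by
  set S := ∑' j, ∑' k, if P j k then v j k ^ p else 0 with hS
  have h1 := h (S ^ p⁻¹) fun j k hjk => by
    rw [ENNReal.le_rpow_inv_iff hp, hS]
    refine le_trans ?_ (ENNReal.le_tsum j)
    refine le_trans ?_ (ENNReal.le_tsum k)
    rw [if_pos hjk]
  calc X ^ p ≤ (C * S ^ p⁻¹) ^ p := by gcongr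
    _ = _ := by
      rw [ENNReal.mul_rpow_of_nonneg _ _ hp.le, ← ENNReal.rpow_mul, inv_mul_cancel₀ hp.ne',
        ENNReal.rpow_one]

lemma setLAverage_const_le {X : Type*} [MeasurableSpace X] {μ : Measure X} (s : Set X) (c : ℝ≥0∞) : ⨍⁻ _ in s, c ∂μ ≤ c := by
  rw [setLAverage_eq, setLIntegral_const, div_eq_mul_inv, mul_assoc]
  calc c * (μ s * (μ s)⁻¹) ≤ c * 1 := by gcongr; exact ENNReal.mul_inv_le_one _
    _ = c := mul_one c

lemma setLAverage_mono {X : Type*} [MeasurableSpace X] {μ : Measure X} {s : Set X} (hs : MeasurableSet s) {f g : X → ℝ≥0∞}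
    (h : ∀ x ∈ s, f x ≤ g x) : ⨍⁻ x in s, f x ∂μ ≤ ⨍⁻ x in s, g x ∂μ := by
  rw [setLAverage_eq, setLAverage_eq]
  gcongr ?_ / _
  exact setLIntegral_mono' hs h

lemma isOpen_bdryDist_lt {Ω : Type*} [MetricSpace Ω] (t : ℝ) : IsOpen {x : Ω | bdryDist x < t} :=
  isOpen_lt ((Metric.continuous_infDist_pt _).comp (Completion.continuous_coe Ω))
    continuous_const

namespace WhitneyData

variable {Ω : Type*} [MetricSpace Ω] {ι : Type} (W : WhitneyData Ω ι)

/-- The pairs of Whitney balls interacting at scale `t` near the boundary. -/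
def Near (t : ℝ) (j k : ι) : Prop :=
  W.radius j ≤ 3 * t ∧ W.radius k ≤ 3 * t ∧ dist (W.closest j) (W.closest k) < 50 * t

/-- Two tripled Whitney balls meet. -/
def Touch (j k : ι) : Prop :=
  ∃ x, x ∈ Metric.ball (W.center j) (3 * W.radius j) ∧
    x ∈ Metric.ball (W.center k) (3 * W.radius k)

lemma dist_closest_le {x : Ω} {j : ι} {K : ℝ}
    (hx : x ∈ Metric.ball (W.center j) (K * W.radius j)) :
    dist (x : Completion Ω) (W.closest j) < (8 + K) * W.radius j := by
  have h1 := dist_triangle (x : Completion Ω) (W.center j) (W.closest j)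
  rw [W.dist_center_closest, Completion.dist_eq] at h1
  rw [Metric.mem_ball] at hx
  linarith

lemma dist_closest_closest_le {x y : Ω} {j k : ι} {K : ℝ}
    (hx : x ∈ Metric.ball (W.center j) (K * W.radius j))
    (hy : y ∈ Metric.ball (W.center k) (K * W.radius k)) :
    dist (W.closest j) (W.closest k) <
      (8 + K) * W.radius j + dist x y + (8 + K) * W.radius k := by
  have h1 := W.dist_closest_le hx
  have h2 := W.dist_closest_le hy
  rw [dist_comm] at h1
  rw [Subtype.dist_eq]
  have h3 := dist_triangle4 (W.closest j : Completion Ω) x y (W.closest k)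
  rw [Completion.dist_eq x y] at h3
  linarith

/-- Here `6 r_j < 11 t` and `6 r_k < 12 t`, and the closest points are less than `10 r_j + t + 10
r_k` apart. The constants `3` and `50` leave room so that touching balls satisfy the same relation
at the scale of their generation. -/
lemma near_of_mem {x y : Ω} {t : ℝ} (hx : bdryDist x < 11 * t) (hxy : dist x y < t) {j k : ι}
    (hj : x ∈ Metric.ball (W.center j) (2 * W.radius j))
    (hk : y ∈ Metric.ball (W.center k) (2 * W.radius k)) : W.Near t j k := by
  have h1 := (W.bdryDist_bounds hj).1
  have h2 := (W.bdryDist_bounds hk).1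
  have h3 := bdryDist_lipschitz y x
  have ht : 0 < t := dist_nonneg.trans_lt hxy
  rw [dist_comm y x] at h3
  refine ⟨by linarith, by linarith, ?_⟩
  linarith [W.dist_closest_closest_le hj hk]

lemma near_of_touch {j k : ι} (h : W.Touch j k) : W.Near (2 ^ W.level j) j k := by
  obtain ⟨x, hj, hk⟩ := h
  have h0 := W.le_level j
  have h1 := W.bdryDist_bounds hj
  have h2 := W.bdryDist_bounds hk
  have := W.radius_pos j
  have h4 := W.dist_closest_closest_le hj hk
  rw [dist_self] at h4
  exact ⟨by linarith, by linarith, by linarith⟩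

variable [MeasurableSpace Ω] {μ : Measure Ω}

open Classical in
/-- The energy of the differences of coefficients over the interacting pairs at scale `t`. -/
noncomputable def pairEnergy (μ : Measure Ω) (a : ι → ℝ) (p t : ℝ) : ℝ≥0∞ :=
  ∑' j, ∑' k, μ (Metric.ball (W.center j) (2 * W.radius j)) *
    (μ (Metric.ball (W.center k) (2 * W.radius k)) * (μ (Metric.ball (W.center j) t))⁻¹ *
      if W.Near t j k then ‖a k - a j‖ₑ ^ p else 0)

open Classical in
/-- The energy of the differences of neighbouring coefficients in the generation `i`. -/
noncomputable def layerEnergy (μ : Measure Ω) (a : ι → ℝ) (p : ℝ) (i : ℤ) : ℝ≥0∞ :=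
  ∑' j, ∑' k, if W.level j = i ∧ W.Touch j k then
    μ (Metric.ball (W.center j) (3 * W.radius j)) * ‖a k - a j‖ₑ ^ p else 0

/-- At scale `2^i` every touching pair with first ball in generation `i` is an interacting pair. By
doubling, the balls in its weight are comparable, so the weight is at least a constant times
`μ(3B_j)`. Hence the far part needs no separate boundary estimate. -/
lemma exists_layerEnergy_le (hμ : IsDoubling μ) (p : ℝ) : ∃ C : ℝ≥0∞, C ≠ ∞ ∧
    ∀ (a : ι → ℝ) (i : ℤ), W.layerEnergy μ a p i ≤ C * W.pairEnergy μ a p (2 ^ i) := by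
  classical
  obtain ⟨C, hC, h⟩ := hμ.exists_tracedBall_le 7
  refine ⟨C * C, by finiteness, fun a i => ?_⟩
  rw [layerEnergy, pairEnergy, ← ENNReal.tsum_mul_left]
  refine ENNReal.tsum_le_tsum fun j => ?_
  rw [← ENNReal.tsum_mul_left]
  refine ENNReal.tsum_le_tsum fun k => ?_
  split_ifs with hjk hN
  · obtain ⟨rfl, x, hj, hk⟩ := hjk
    have hrj := W.radius_pos j
    have hrk := W.radius_pos k
    have h2i : (0 : ℝ) < 2 ^ W.level j := by positivity
    have h1 : μ (Metric.ball (W.center j) (3 * W.radius j)) ≤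
        C * μ (Metric.ball (W.center j) (2 * W.radius j)) := by
      rw [← tracedBall_coe, ← tracedBall_coe]
      refine h _ _ _ _ (by positivity) ?_
      rw [dist_self]; linarith
    have h2 : (μ (Metric.ball (W.center k) (2 * W.radius k)))⁻¹ ≤
        C * (μ (Metric.ball (W.center j) (2 ^ W.level j)))⁻¹ := by
      refine ENNReal.inv_le_mul_inv (hμ.measure_ball_pos _ h2i).ne'
        (hμ.measure_ball_lt_top _ h2i).ne ?_
      rw [← tracedBall_coe, ← tracedBall_coe]
      refine h _ _ _ _ (by positivity) ?_
      rw [Completion.dist_eq]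
      have e1 := W.bdryDist_bounds hj
      have e2 := W.bdryDist_bounds hk
      have e3 := W.level_lt j
      rw [zpow_sub_one₀ two_ne_zero] at e3
      rw [Metric.mem_ball] at hj hk
      rw [dist_comm] at hj
      linarith [dist_triangle (W.center j) x (W.center k)]
    have h3 : (1 : ℝ≥0∞) ≤ C * (μ (Metric.ball (W.center k) (2 * W.radius k)) *
        (μ (Metric.ball (W.center j) (2 ^ W.level j)))⁻¹) := by
      calc (1 : ℝ≥0∞) = μ (Metric.ball (W.center k) (2 * W.radius k)) *
            (μ (Metric.ball (W.center k) (2 * W.radius k)))⁻¹ :=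
            (ENNReal.mul_inv_cancel (hμ.measure_ball_pos _ (by positivity)).ne'
              (hμ.measure_ball_lt_top _ (by positivity)).ne).symm
        _ ≤ μ (Metric.ball (W.center k) (2 * W.radius k)) *
            (C * (μ (Metric.ball (W.center j) (2 ^ W.level j)))⁻¹) := by gcongr
        _ = _ := by ring
    calc μ (Metric.ball (W.center j) (3 * W.radius j)) * ‖a k - a j‖ₑ ^ p
        ≤ C * μ (Metric.ball (W.center j) (2 * W.radius j)) * ‖a k - a j‖ₑ ^ p * 1 := by
          rw [mul_one]; gcongr
      _ ≤ C * μ (Metric.ball (W.center j) (2 * W.radius j)) * ‖a k - a j‖ₑ ^ p *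
          (C * (μ (Metric.ball (W.center k) (2 * W.radius k)) *
          (μ (Metric.ball (W.center j) (2 ^ W.level j)))⁻¹)) := by gcongr
      _ = _ := by ring
  · obtain ⟨rfl, ht⟩ := hjk
    exact absurd (W.near_of_touch ht) hN
  · exact zero_le
  · exact zero_le

variable [BorelSpace Ω] [Countable ι]

/-- The part of the oscillation coming from the points close to the boundary. -/
lemma exists_near_le (hμ : IsDoubling μ) {p : ℝ} (hp : 0 < p) : ∃ C : ℝ≥0∞, C ≠ ∞ ∧
    ∀ (a : ι → ℝ) (t : ℝ), 0 < t →
      ∫⁻ x in {x | bdryDist x < 11 * t},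
        ⨍⁻ y in Metric.ball x t, ‖W.synth a y - W.synth a x‖ₑ ^ p ∂μ ∂μ ≤
      C * W.pairEnergy μ a p t := by
  classical
  obtain ⟨C, hC, h⟩ := hμ.exists_tracedBall_le 7
  refine ⟨C, hC, fun a t ht => ?_⟩
  set B : ι → Set Ω := fun j => Metric.ball (W.center j) (2 * W.radius j) with hB
  have hBm : ∀ j, MeasurableSet (B j) := fun j => Metric.isOpen_ball.measurableSet
  set w : ι → ι → ℝ≥0∞ := fun j k => if W.Near t j k then ‖a k - a j‖ₑ ^ p else 0 with hw
  set v : ι → ι → ℝ≥0∞ := fun j k => μ (B k) * (μ (Metric.ball (W.center j) t))⁻¹ * w j k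
  have hpt : ∀ x ∈ {x : Ω | bdryDist x < 11 * t},
      ⨍⁻ y in Metric.ball x t, ‖W.synth a y - W.synth a x‖ₑ ^ p ∂μ ≤
      ∑' j, ∑' k, (B j).indicator (fun _ => C * v j k) x := by
    intro x hx
    have h1 : ∀ y ∈ Metric.ball x t, ‖W.synth a y - W.synth a x‖ₑ ^ p ≤
        ∑' j, ∑' k, (B k).indicator (fun _ => (B j).indicator (fun _ => w j k) x) y := by
      intro y hy
      have hxy : dist x y < t := by rwa [dist_comm]
      have h2 := rpow_le_mul_tsum_tsum (P := fun j k => x ∈ B j ∧ y ∈ B k)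
        (v := fun j k => ‖a k - a j‖ₑ) (X := ‖W.synth a y - W.synth a x‖ₑ) (C := 1) hp
        (fun M hM => by
          rw [one_mul]
          exact W.enorm_synth_sub_synth_le fun j k hj hk => hM j k ⟨hj, hk⟩)
      rw [ENNReal.one_rpow, one_mul] at h2
      refine h2.trans (ENNReal.tsum_le_tsum fun j => ENNReal.tsum_le_tsum fun k => ?_)
      split_ifs with hjk
      · rw [indicator_of_mem hjk.2, indicator_of_mem hjk.1, hw]
        simp only
        rw [if_pos (W.near_of_mem hx hxy hjk.1 hjk.2)]
      · exact zero_le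
    have h3 : ∫⁻ y in Metric.ball x t, ‖W.synth a y - W.synth a x‖ₑ ^ p ∂μ ≤
        ∑' j, ∑' k, (B j).indicator (fun _ => w j k) x * μ (B k) := by
      calc _ ≤ ∫⁻ y in Metric.ball x t,
            ∑' j, ∑' k, (B k).indicator (fun _ => (B j).indicator (fun _ => w j k) x) y ∂μ :=
            setLIntegral_mono' Metric.isOpen_ball.measurableSet h1
        _ ≤ ∫⁻ y, ∑' j, ∑' k, (B k).indicator (fun _ => (B j).indicator (fun _ => w j k) x) y ∂μ :=
            setLIntegral_le_lintegral _ _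
        _ = _ := by
            rw [lintegral_tsum fun j => (Measurable.tsum fun k =>
              measurable_const.indicator (hBm k)).aemeasurable]
            refine tsum_congr fun j => ?_
            rw [lintegral_tsum fun k => (measurable_const.indicator (hBm k)).aemeasurable]
            refine tsum_congr fun k => ?_
            rw [lintegral_indicator_const (hBm k)]
    rw [setLAverage_eq, div_eq_mul_inv]
    calc _ ≤ (∑' j, ∑' k, (B j).indicator (fun _ => w j k) x * μ (B k)) *
          (μ (Metric.ball x t))⁻¹ := by gcongr
      _ = ∑' j, ∑' k, (B j).indicator (fun _ => w j k) x * μ (B k) *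
          (μ (Metric.ball x t))⁻¹ := by
          rw [← ENNReal.tsum_mul_right]
          simp_rw [← ENNReal.tsum_mul_right]
      _ ≤ _ := by
          refine ENNReal.tsum_le_tsum fun j => ENNReal.tsum_le_tsum fun k => ?_
          by_cases hj : x ∈ B j
          swap
          · simp [indicator_of_notMem hj]
          rw [indicator_of_mem hj, indicator_of_mem hj]
          by_cases hN : W.Near t j k
          swap
          · simp [hw, hN]
          -- Since `x` is within `2 r_j ≤ 6 t` of `p_j`, the averaging ball may be recentred at
          -- `p_j`; `t + 6 t` explains the constant `7`.
          have h4 : (μ (Metric.ball x t))⁻¹ ≤ C * (μ (Metric.ball (W.center j) t))⁻¹ := by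
            refine ENNReal.inv_le_mul_inv (hμ.measure_ball_pos _ ht).ne'
              (hμ.measure_ball_lt_top _ ht).ne ?_
            rw [← tracedBall_coe, ← tracedBall_coe]
            refine h _ _ _ _ ht ?_
            rw [Completion.dist_eq, dist_comm]
            have := hN.1
            have : dist x (W.center j) < 2 * W.radius j := hj
            linarith
          calc w j k * μ (B k) * (μ (Metric.ball x t))⁻¹
              ≤ w j k * μ (B k) * (C * (μ (Metric.ball (W.center j) t))⁻¹) := by gcongr
            _ = C * v j k := by simp only [v]; ring
  calc _ ≤ ∫⁻ x in {x : Ω | bdryDist x < 11 * t},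
        ∑' j, ∑' k, (B j).indicator (fun _ => C * v j k) x ∂μ :=
        setLIntegral_mono' (isOpen_bdryDist_lt _).measurableSet hpt
    _ ≤ ∫⁻ x, ∑' j, ∑' k, (B j).indicator (fun _ => C * v j k) x ∂μ :=
        setLIntegral_le_lintegral _ _
    _ = ∑' j, ∑' k, C * v j k * μ (B j) := by
        rw [lintegral_tsum fun j => (Measurable.tsum fun k =>
          measurable_const.indicator (hBm j)).aemeasurable]
        refine tsum_congr fun j => ?_
        rw [lintegral_tsum fun k => (measurable_const.indicator (hBm j)).aemeasurable]
        refine tsum_congr fun k => ?_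
        rw [lintegral_indicator_const (hBm j)]
    _ = C * W.pairEnergy μ a p t := by
        rw [pairEnergy, ← ENNReal.tsum_mul_left]
        refine tsum_congr fun j => ?_
        rw [← ENNReal.tsum_mul_left]
        refine tsum_congr fun k => ?_
        simp only [v, hw]
        ring

/-- The part of the oscillation coming from the points far from the boundary. -/
lemma exists_far_le {p : ℝ} (hp : 0 < p) : ∃ C : ℝ≥0∞, C ≠ ∞ ∧
    ∀ (a : ι → ℝ) (i : ℤ) (t : ℝ), t ∈ Set.Ico ((2 : ℝ) ^ i) (2 ^ (i + 1)) →
      ∫⁻ x in {x | bdryDist x < 11 * t}ᶜ,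
        ⨍⁻ y in Metric.ball x t, ‖W.synth a y - W.synth a x‖ₑ ^ p ∂μ ∂μ ≤
      C * ∑' n : ℕ, ENNReal.ofReal (2 ^ (-p)) ^ n * W.layerEnergy μ a p (i + n) := by
  classical
  obtain ⟨C, hC, h⟩ := W.exists_enorm_synth_sub_synth_le_far
  refine ⟨C ^ p * ENNReal.ofReal (4 ^ p),
    ENNReal.mul_ne_top (ENNReal.rpow_ne_top_of_nonneg hp.le hC) ENNReal.ofReal_ne_top,
    fun a i t ht => ?_⟩
  have ht0 : 0 < t := lt_of_lt_of_le (by positivity) ht.1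
  set B : ι → Set Ω := fun j => Metric.ball (W.center j) (3 * W.radius j) with hB
  have hBm : ∀ j, MeasurableSet (B j) := fun j => Metric.isOpen_ball.measurableSet
  set κ := ENNReal.ofReal (2 ^ (-p)) with hκ
  set w : ι → ι → ℕ → ℝ≥0∞ := fun j k n =>
    if W.level j = i + n ∧ W.Touch j k then κ ^ n * ‖a k - a j‖ₑ ^ p else 0 with hw
  set D := C ^ p * ENNReal.ofReal (4 ^ p) with hD
  have hpt : ∀ x ∈ {x : Ω | bdryDist x < 11 * t}ᶜ,
      ⨍⁻ y in Metric.ball x t, ‖W.synth a y - W.synth a x‖ₑ ^ p ∂μ ≤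
      ∑' n, ∑' j, ∑' k, (B j).indicator (fun _ => D * w j k n) x := by
    intro x hx
    have hx : 11 * t ≤ bdryDist x := by simpa using hx
    -- The bound does not depend on `y`, so averaging over `y` costs nothing.
    refine (setLAverage_mono Metric.isOpen_ball.measurableSet
      (g := fun _ => ∑' n, ∑' j, ∑' k, (B j).indicator (fun _ => D * w j k n) x)
      fun y hy => ?_).trans (setLAverage_const_le _ _)
    have hxy : dist x y < t := by rwa [dist_comm]
    have h2 := rpow_le_mul_tsum_tsum (P := fun j k => x ∈ B j ∧ x ∈ B k)
      (v := fun j k => ENNReal.ofReal (t / W.radius j) * ‖a k - a j‖ₑ)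
      (X := ‖W.synth a y - W.synth a x‖ₑ) hp
      (fun M hM => h a x y t M hx hxy fun j k hj hk => hM j k ⟨hj, hk⟩)
    refine h2.trans ?_
    rw [ENNReal.tsum_comm (α := ℕ), ← ENNReal.tsum_mul_left]
    refine ENNReal.tsum_le_tsum fun j => ?_
    rw [ENNReal.tsum_comm (α := ℕ), ← ENNReal.tsum_mul_left]
    refine ENNReal.tsum_le_tsum fun k => ?_
    split_ifs with hjk
    swap
    · simp
    have hrj := W.radius_pos j
    have hb := (W.bdryDist_bounds hjk.1).2
    -- From `11 t ≤ d(x, ∂Ω) < 11 r_j` only generations at or above that of `t` are active.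
    have hlev : i ≤ W.level j := by
      have h5 : (2 : ℝ) ^ i < 2 ^ (W.level j) := by linarith [ht.1, W.le_level j]
      exact ((zpow_lt_zpow_iff_right₀ one_lt_two).1 h5).le
    obtain ⟨n, hn⟩ := Int.eq_ofNat_of_zero_le (sub_nonneg.2 hlev)
    have hn' : W.level j = i + n := by omega
    refine le_trans ?_ (ENNReal.le_tsum n)
    rw [indicator_of_mem hjk.1, hw]
    simp only
    -- Combine `t < 2^(i+1)` with `r_j > 2^(i+n-1)`. This decay in `n` is the gain from the
    -- Lipschitz bound.
    have h6 : t / W.radius j ≤ 4 * 2 ^ (-(n : ℝ)) := by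
      rw [div_le_iff₀ hrj]
      have h7 := W.level_lt j
      rw [hn', show i + (n : ℤ) - 1 = (i + 1) + n - 2 by ring, zpow_sub₀ two_ne_zero,
        zpow_add₀ two_ne_zero (i + 1), zpow_natCast] at h7
      rw [Real.rpow_neg two_pos.le, Real.rpow_natCast]
      have h8 : (0 : ℝ) < 2 ^ n := by positivity
      have h9 : (2 : ℝ) ^ (i + 1) * 2 ^ n < 4 * W.radius j := by
        rw [div_lt_iff₀ (by positivity)] at h7
        norm_num at h7 ⊢
        linarith
      calc t ≤ 2 ^ (i + 1) := ht.2.le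
        _ = 2 ^ (i + 1) * 2 ^ n * (2 ^ n)⁻¹ := by field_simp
        _ ≤ 4 * W.radius j * (2 ^ n)⁻¹ := by gcongr
        _ = _ := by ring
    have h10 : ENNReal.ofReal (t / W.radius j) ^ p ≤ ENNReal.ofReal (4 ^ p) * κ ^ n := by
      rw [hκ, ENNReal.ofReal_rpow_of_pos (by positivity), ← ENNReal.ofReal_pow (by positivity),
        ← ENNReal.ofReal_mul (by positivity)]
      refine ENNReal.ofReal_le_ofReal ?_
      calc (t / W.radius j) ^ p ≤ (4 * 2 ^ (-(n : ℝ))) ^ p := by gcongr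
        _ = 4 ^ p * (2 ^ (-p)) ^ n := by
          rw [Real.mul_rpow (by norm_num) (by positivity), ← Real.rpow_mul two_pos.le,
            ← Real.rpow_natCast, ← Real.rpow_mul two_pos.le]
          congr 2; ring
    rw [if_pos ⟨hn', x, hjk.1, hjk.2⟩, ENNReal.mul_rpow_of_nonneg _ _ hp.le, hD]
    calc _ ≤ C ^ p * (ENNReal.ofReal (4 ^ p) * κ ^ n * ‖a k - a j‖ₑ ^ p) := by gcongr
      _ = _ := by ring
  have hm1 : ∀ n, Measurable fun x => ∑' j, ∑' k, (B j).indicator (fun _ => D * w j k n) x :=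
    fun n => Measurable.tsum fun j => Measurable.tsum fun k =>
      measurable_const.indicator (hBm j)
  calc _ ≤ ∫⁻ x in {x : Ω | bdryDist x < 11 * t}ᶜ,
        ∑' n, ∑' j, ∑' k, (B j).indicator (fun _ => D * w j k n) x ∂μ :=
        setLIntegral_mono' (isOpen_bdryDist_lt _).measurableSet.compl hpt
    _ ≤ ∫⁻ x, ∑' n, ∑' j, ∑' k, (B j).indicator (fun _ => D * w j k n) x ∂μ :=
        setLIntegral_le_lintegral _ _
    _ = ∑' n, ∑' j, ∑' k, D * w j k n * μ (B j) := by
        rw [lintegral_tsum fun n => (hm1 n).aemeasurable]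
        refine tsum_congr fun n => ?_
        rw [lintegral_tsum fun j => (Measurable.tsum fun k =>
          measurable_const.indicator (hBm j)).aemeasurable]
        refine tsum_congr fun j => ?_
        rw [lintegral_tsum fun k => (measurable_const.indicator (hBm j)).aemeasurable]
        refine tsum_congr fun k => ?_
        rw [lintegral_indicator_const (hBm j)]
    _ = _ := by
        rw [← ENNReal.tsum_mul_left]
        refine tsum_congr fun n => ?_
        rw [layerEnergy, ← ENNReal.tsum_mul_left, ← ENNReal.tsum_mul_left]
        refine tsum_congr fun j => ?_
        rw [← ENNReal.tsum_mul_left, ← ENNReal.tsum_mul_left]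
        refine tsum_congr fun k => ?_
        simp only [hw]
        split_ifs
        · ring
        · simp

end WhitneyData

end OscillationEstimates

/-! ### Passing from Whitney sums to integrals over the boundary. -/

section BoundaryEstimates

/-- The lower integral is superadditive for arbitrary functions. Only this direction is needed, so
no measurability of the boundary integrands is required. -/
lemma tsum_lintegral_le {X ι : Type*} [MeasurableSpace X] {m : Measure X} (f : ι → X → ℝ≥0∞) :
    ∑' i, ∫⁻ x, f i x ∂m ≤ ∫⁻ x, ∑' i, f i x ∂m := by
  classical
  rw [ENNReal.tsum_eq_iSup_sum]
  refine iSup_le fun s => le_trans ?_ (lintegral_mono fun x => ENNReal.sum_le_tsum s)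
  induction s using Finset.induction_on with
  | empty => simp
  | insert a s ha ih =>
    simp_rw [Finset.sum_insert ha]
    exact (add_le_add le_rfl ih).trans (le_lintegral_add _ _)

namespace WhitneyData

variable {Ω : Type*} [MetricSpace Ω] {ι : Type} (W : WhitneyData Ω ι)

/-- Overlap on the boundary reduces to overlap in `Ω`: a point of `Ω` within `2^(i-1) < r_j` of `z`
is within `r_j + r_j + 8 r_j = 10 r_j` of `p_j`. -/
lemma exists_encard_boundary_le : ∃ N : ℕ, ∀ (z : Boundary Ω) (i : ℤ),
    {j | W.level j = i ∧ z ∈ Metric.ball (W.closest j) (W.radius j)}.encard ≤ N := by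
  obtain ⟨N, hN⟩ := W.level_overlap 10 (by norm_num)
  refine ⟨N, fun z i => ?_⟩
  obtain ⟨x, hx⟩ := exists_dist_coe_lt (z : Completion Ω)
    (show (0 : ℝ) < 2 ^ (i - 1) by positivity)
  refine (encard_le_encard fun j hj => ?_).trans (hN i x)
  obtain ⟨rfl, hz⟩ := hj
  refine ⟨rfl, ?_⟩
  rw [Metric.mem_ball, Subtype.dist_eq] at hz
  rw [Metric.mem_ball, ← Completion.dist_eq]
  have h1 := W.dist_center_closest j
  rw [dist_comm] at h1
  have := dist_triangle4 (x : Completion Ω) z (W.closest j) (W.center j)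
  linarith [W.level_lt j]

-- With `2^m ≤ τ < 2^(m+1)`, only generations `m + 1 - n` with `n ≥ 0` occur. Each contains
-- boundedly many terms at `z`, of size at most `2^((m+1-n)θ)`, and `θ > 0` makes the series
-- geometric.
open Classical in
lemma exists_tsum_radius_le {θ : ℝ} (hθ : 0 < θ) : ∃ C : ℝ≥0∞, C ≠ ∞ ∧
    ∀ (z : Boundary Ω) (τ : ℝ), 0 < τ →
      ∑' j, (if W.radius j ≤ τ ∧ z ∈ Metric.ball (W.closest j) (W.radius j) then
        ENNReal.ofReal (W.radius j ^ θ) else 0) ≤ C * ENNReal.ofReal (τ ^ θ) := by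
  obtain ⟨N, hN⟩ := W.exists_encard_boundary_le
  set κ := ENNReal.ofReal (2 ^ (-θ)) with hκ
  have hκ1 : κ < 1 := by
    rw [hκ, ENNReal.ofReal_lt_one]
    exact Real.rpow_lt_one_of_one_lt_of_neg one_lt_two (by linarith)
  have hG : ∑' n : ℕ, κ ^ n < ∞ := tsum_geometric_lt_top.2 hκ1
  refine ⟨N * ENNReal.ofReal (2 ^ θ) * ∑' n : ℕ, κ ^ n,
    ENNReal.mul_ne_top (by finiteness) hG.ne, fun z τ hτ => ?_⟩
  obtain ⟨m, hm⟩ := exists_mem_Ico_zpow hτ (one_lt_two (α := ℝ))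
  set V : ℕ → ℝ≥0∞ := fun n => ENNReal.ofReal (((2 : ℝ) ^ (m + 1)) ^ θ) * κ ^ n
  have h1 : ∀ j, (if W.radius j ≤ τ ∧ z ∈ Metric.ball (W.closest j) (W.radius j) then
      ENNReal.ofReal (W.radius j ^ θ) else 0) ≤
      ∑' n : ℕ, {j | W.level j = m + 1 - n ∧
        z ∈ Metric.ball (W.closest j) (W.radius j)}.indicator (fun _ => V n) j := by
    intro j
    split_ifs with hj
    swap
    · exact zero_le
    have hlev : W.level j ≤ m + 1 := by
      have : (2 : ℝ) ^ (W.level j - 1) < 2 ^ (m + 1) := (W.level_lt j).trans (hj.1.trans_lt hm.2)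
      have := (zpow_lt_zpow_iff_right₀ one_lt_two).1 this
      omega
    obtain ⟨n, hn⟩ := Int.eq_ofNat_of_zero_le (sub_nonneg.2 hlev)
    have hn' : W.level j = m + 1 - n := by omega
    refine le_trans ?_ (ENNReal.le_tsum n)
    rw [indicator_of_mem (show j ∈ {j | W.level j = m + 1 - n ∧
      z ∈ Metric.ball (W.closest j) (W.radius j)} from ⟨hn', hj.2⟩)]
    simp only [V]
    rw [hκ, ← ENNReal.ofReal_pow (by positivity), ← ENNReal.ofReal_mul (by positivity)]
    refine ENNReal.ofReal_le_ofReal ?_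
    calc W.radius j ^ θ ≤ ((2 : ℝ) ^ W.level j) ^ θ := by
          have := W.radius_pos j
          gcongr
          exact W.le_level j
      _ = _ := by
          rw [hn', zpow_sub₀ two_ne_zero, Real.div_rpow (by positivity) (by positivity),
            zpow_natCast, Real.rpow_neg two_pos.le, inv_pow, div_eq_mul_inv,
            ← Real.rpow_natCast, ← Real.rpow_natCast, ← Real.rpow_mul two_pos.le,
            ← Real.rpow_mul two_pos.le, mul_comm θ]
  calc _ ≤ ∑' j, ∑' n : ℕ, {j | W.level j = m + 1 - n ∧
        z ∈ Metric.ball (W.closest j) (W.radius j)}.indicator (fun _ => V n) j :=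
        ENNReal.tsum_le_tsum h1
    _ = ∑' n : ℕ, ∑' j, {j | W.level j = m + 1 - n ∧
        z ∈ Metric.ball (W.closest j) (W.radius j)}.indicator (fun _ => V n) j :=
        ENNReal.tsum_comm
    _ ≤ ∑' n : ℕ, N * V n := by
        refine ENNReal.tsum_le_tsum fun n => ?_
        rw [← tsum_subtype, ENNReal.tsum_set_const]
        gcongr
        have := hN z (m + 1 - n)
        exact_mod_cast (ENat.toENNReal_le.2 this)
    _ = N * ENNReal.ofReal (((2 : ℝ) ^ (m + 1)) ^ θ) * ∑' n : ℕ, κ ^ n := by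
        rw [← ENNReal.tsum_mul_left]
        exact tsum_congr fun n => by simp only [V]; ring
    _ ≤ N * (ENNReal.ofReal (2 ^ θ) * ENNReal.ofReal (τ ^ θ)) * ∑' n : ℕ, κ ^ n := by
        gcongr
        rw [← ENNReal.ofReal_mul (by positivity), ← Real.mul_rpow two_pos.le hτ.le]
        refine ENNReal.ofReal_le_ofReal ?_
        gcongr
        rw [zpow_add_one₀ two_ne_zero]
        linarith [hm.1]
    _ = _ := by ring

variable [MeasurableSpace Ω] {μ : Measure Ω} {ν : Measure (Boundary Ω)} {θ : ℝ} {R₀ : ℝ≥0∞}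

/-- The ball `2B_j` lies in the ball of radius `10 r_j` about `q_j`; doubling shrinks this to radius
`r_j`, where codimension regularity applies. -/
lemma exists_measure_ball_mul_inv_le (hμ : IsDoubling μ) (hreg : RegularUpTo μ ν θ R₀) :
    ∃ C : ℝ≥0∞, C ≠ ∞ ∧ ∀ j, ENNReal.ofReal (W.radius j) ≤ R₀ →
      μ (Metric.ball (W.center j) (2 * W.radius j)) *
        (ν (Metric.ball (W.closest j) (W.radius j)))⁻¹ ≤
      C * ENNReal.ofReal (W.radius j ^ θ) := by
  obtain ⟨C, hC, h⟩ := hreg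
  obtain ⟨C₁, hC₁, h₁⟩ := hμ.exists_tracedBall_le 10
  refine ⟨C₁ * C, by finiteness, fun j hj => ?_⟩
  have hrj := W.radius_pos j
  rw [← div_eq_mul_inv]
  refine ENNReal.div_le_of_le_mul ?_
  calc μ (Metric.ball (W.center j) (2 * W.radius j))
      ≤ C₁ * μ (tracedBall (W.closest j : Completion Ω) (W.radius j)) := by
        rw [← tracedBall_coe]
        refine h₁ _ _ _ _ hrj ?_
        rw [W.dist_center_closest]; linarith
    _ ≤ C₁ * (C * ENNReal.ofReal (W.radius j ^ θ) *
        ν (Metric.ball (W.closest j) (W.radius j))) := by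
        gcongr
        exact (h _ _ hrj hj).1
    _ = _ := by ring

open Classical in
/-- Summation over all Whitney balls of radius at most `τ`. -/
lemma exists_tsum_setLIntegral_le (hμ : IsDoubling μ) (hθ : 0 < θ)
    (hreg : RegularUpTo μ ν θ R₀) : ∃ C : ℝ≥0∞, C ≠ ∞ ∧
    ∀ (τ : ℝ), 0 < τ → ENNReal.ofReal τ ≤ R₀ → ∀ g : Boundary Ω → ℝ≥0∞,
      ∑' j, (if W.radius j ≤ τ then μ (Metric.ball (W.center j) (2 * W.radius j)) *
        (ν (Metric.ball (W.closest j) (W.radius j)))⁻¹ *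
        ∫⁻ z in Metric.ball (W.closest j) (W.radius j), g z ∂ν else 0) ≤
      C * ENNReal.ofReal (τ ^ θ) * ∫⁻ z, g z ∂ν := by
  obtain ⟨C₁, hC₁, h₁⟩ := W.exists_measure_ball_mul_inv_le hμ hreg
  obtain ⟨C₂, hC₂, h₂⟩ := W.exists_tsum_radius_le hθ
  refine ⟨C₁ * C₂, by finiteness, fun τ hτ hτR g => ?_⟩
  have hU : ∀ j, MeasurableSet (Metric.ball (W.closest j) (W.radius j)) := fun j =>
    Metric.isOpen_ball.measurableSet
  have hK : C₁ * (C₂ * ENNReal.ofReal (τ ^ θ)) ≠ ∞ := by finiteness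
  calc _ ≤ ∑' j, ∫⁻ z, C₁ * (if W.radius j ≤ τ ∧ z ∈ Metric.ball (W.closest j) (W.radius j) then
          ENNReal.ofReal (W.radius j ^ θ) else 0) * g z ∂ν := by
        refine ENNReal.tsum_le_tsum fun j => ?_
        split_ifs with hj
        swap
        · exact zero_le
        calc _ ≤ C₁ * ENNReal.ofReal (W.radius j ^ θ) *
              ∫⁻ z in Metric.ball (W.closest j) (W.radius j), g z ∂ν := by
              gcongr ?_ * _
              exact h₁ j ((ENNReal.ofReal_le_ofReal hj).trans hτR)
          _ = _ := by
              rw [← lintegral_indicator (hU j), ← lintegral_const_mul' _ _ (by finiteness)]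
              refine lintegral_congr fun z => ?_
              by_cases hz : z ∈ Metric.ball (W.closest j) (W.radius j)
              · rw [indicator_of_mem hz, if_pos ⟨hj, hz⟩]
              · rw [indicator_of_notMem hz, if_neg fun h => hz h.2]
                simp
    _ ≤ ∫⁻ z, ∑' j, C₁ * (if W.radius j ≤ τ ∧ z ∈ Metric.ball (W.closest j) (W.radius j) then
          ENNReal.ofReal (W.radius j ^ θ) else 0) * g z ∂ν := tsum_lintegral_le _
    _ ≤ ∫⁻ z, C₁ * (C₂ * ENNReal.ofReal (τ ^ θ)) * g z ∂ν := by
        refine lintegral_mono fun z => ?_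
        rw [ENNReal.tsum_mul_right, ENNReal.tsum_mul_left]
        gcongr
        exact h₂ z τ hτ
    _ = _ := by
        rw [lintegral_const_mul' _ _ hK]
        ring

/-- The energy of the pairs interacting at scale `t` is controlled by the oscillation of the
boundary function at a comparable scale. -/
lemma exists_pairEnergy_le (hμ : IsDoubling μ) (hθ : 0 < θ)
    (hreg : RegularUpTo μ ν θ R₀) {p : ℝ} (hp : 1 ≤ p) : ∃ C : ℝ≥0∞, C ≠ ∞ ∧
    ∀ (f : Boundary Ω → ℝ) (t : ℝ),
      (∀ j, IntegrableOn f (Metric.ball (W.closest j) (W.radius j)) ν) → 0 < t →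
      ENNReal.ofReal (60 * t) ≤ R₀ →
      W.pairEnergy μ (W.avg ν f) p t ≤
        C * ENNReal.ofReal (t ^ θ) * besovOsc ν p f (60 * t) := by
  classical
  obtain ⟨C₁, hC₁, h₁⟩ := W.exists_tsum_setLIntegral_le hμ hθ hreg
  -- A point `a` of `U_j` is within `9 r_j ≤ 27 t` of `p_j`, and `60 + 27 = 87`.
  obtain ⟨C₂, hC₂, h₂⟩ := hμ.exists_tracedBall_le 87
  obtain ⟨C₃, hC₃, h₃⟩ := id hreg
  set K := C₃ * C₂ * (C₁ * ENNReal.ofReal (3 ^ θ)) * (C₁ * ENNReal.ofReal (3 ^ θ)) with hK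
  refine ⟨K, by finiteness, fun f t hf ht htR => ?_⟩
  set U : ι → Set (Boundary Ω) := fun j => Metric.ball (W.closest j) (W.radius j) with hUdef
  have hUm : ∀ j, MeasurableSet (U j) := fun j => Metric.isOpen_ball.measurableSet
  have hscale : ∀ r, r ≤ 3 * t → ENNReal.ofReal r ≤ R₀ := fun r hr =>
    (ENNReal.ofReal_le_ofReal (by linarith)).trans htR
  set w : ι → ℝ≥0∞ := fun j => if W.radius j ≤ 3 * t then
    μ (Metric.ball (W.center j) (2 * W.radius j)) * (ν (U j))⁻¹ else 0 with hw
  set g : Boundary Ω → Boundary Ω → ℝ≥0∞ := fun a =>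
    (Metric.ball a (60 * t)).indicator fun b => ‖f b - f a‖ₑ ^ p with hg
  set T := C₃ * C₂ * ENNReal.ofReal (t ^ (-θ)) with hT
  have hTtop : T ≠ ∞ := by finiteness
  set h : ι → Boundary Ω → ℝ≥0∞ := fun k a =>
    (ν (Metric.ball a (60 * t)))⁻¹ * (w k * ∫⁻ b in U k, g a b ∂ν) with hh
  have hνball : ∀ j, ∀ a ∈ U j, W.radius j ≤ 3 * t →
      (μ (Metric.ball (W.center j) t))⁻¹ ≤ T * (ν (Metric.ball a (60 * t)))⁻¹ := by
    intro j a ha hj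
    refine ENNReal.inv_le_mul_inv (hreg.measure_ball_pos hμ a (by positivity) htR).ne'
      (hreg.measure_ball_lt_top hμ a (by positivity) htR).ne ?_
    calc ν (Metric.ball a (60 * t))
        ≤ C₃ * ENNReal.ofReal ((60 * t) ^ (-θ)) * μ (tracedBall (a : Completion Ω) (60 * t)) :=
          (h₃ a _ (by positivity) htR).2
      _ ≤ C₃ * ENNReal.ofReal (t ^ (-θ)) * (C₂ * μ (Metric.ball (W.center j) t)) := by
          gcongr C₃ * ENNReal.ofReal ?_ * ?_
          · exact Real.rpow_le_rpow_of_nonpos ht (by linarith) (by linarith)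
          · rw [← tracedBall_coe]
            refine h₂ _ _ _ _ ht ?_
            have e1 := W.dist_center_closest j
            rw [dist_comm] at e1
            rw [hUdef, Metric.mem_ball, Subtype.dist_eq] at ha
            have := dist_triangle (a : Completion Ω) (W.closest j) (W.center j)
            linarith
      _ = _ := by rw [hT]; ring
  have hterm : ∀ j k, μ (Metric.ball (W.center j) (2 * W.radius j)) *
      (μ (Metric.ball (W.center k) (2 * W.radius k)) * (μ (Metric.ball (W.center j) t))⁻¹ *
      if W.Near t j k then ‖W.avg ν f k - W.avg ν f j‖ₑ ^ p else 0) ≤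
      T * (w j * ∫⁻ a in U j, h k a ∂ν) := by
    intro j k
    split_ifs with hN
    swap
    · simp
    have hj0 := (hreg.measure_ball_pos hμ (W.closest j) (W.radius_pos j) (hscale _ hN.1)).ne'
    have hj1 := (hreg.measure_ball_lt_top hμ (W.closest j) (W.radius_pos j) (hscale _ hN.1)).ne
    have hk0 := (hreg.measure_ball_pos hμ (W.closest k) (W.radius_pos k) (hscale _ hN.2.1)).ne'
    have hk1 := (hreg.measure_ball_lt_top hμ (W.closest k) (W.radius_pos k) (hscale _ hN.2.1)).ne
    have hJ := enorm_setAverage_sub_setAverage_rpow_le hp hj0 hj1 hk0 hk1 (hf j) (hf k)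
    have hJ' : ‖W.avg ν f k - W.avg ν f j‖ₑ ^ p ≤
        (ν (U j))⁻¹ * (ν (U k))⁻¹ * ∫⁻ a in U j, ∫⁻ b in U k, ‖f b - f a‖ₑ ^ p ∂ν ∂ν := by
      rw [enorm_sub_rev]
      calc ‖W.avg ν f j - W.avg ν f k‖ₑ ^ p
          = ‖W.avg ν f j - W.avg ν f k‖ₑ ^ p * (ν (U j) * (ν (U j))⁻¹) *
            (ν (U k) * (ν (U k))⁻¹) := by
            rw [ENNReal.mul_inv_cancel hj0 hj1, ENNReal.mul_inv_cancel hk0 hk1, mul_one, mul_one]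
        _ = (ν (U j))⁻¹ * (ν (U k))⁻¹ *
            (‖W.avg ν f j - W.avg ν f k‖ₑ ^ p * ν (U j) * ν (U k)) := by ring
        _ ≤ _ := by gcongr; exact hJ
    have hin : (μ (Metric.ball (W.center j) t))⁻¹ *
        ∫⁻ a in U j, ∫⁻ b in U k, ‖f b - f a‖ₑ ^ p ∂ν ∂ν ≤
        T * ∫⁻ a in U j, (ν (Metric.ball a (60 * t)))⁻¹ * ∫⁻ b in U k, g a b ∂ν ∂ν := by
      have : (μ (Metric.ball (W.center j) t))⁻¹ ≠ ∞ :=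
        ENNReal.inv_ne_top.2 (hμ.measure_ball_pos _ ht).ne'
      rw [← lintegral_const_mul' _ _ this, ← lintegral_const_mul' _ _ hTtop]
      refine setLIntegral_mono' (hUm j) fun a ha => ?_
      rw [← mul_assoc]
      gcongr ?_ * ?_
      · exact hνball j a ha hN.1
      -- The points `a` and `b` are less than `r_j + 50 t + r_k ≤ 56 t` apart, so restricting to
      -- `B(a, 60 t)` loses nothing.
      · refine setLIntegral_mono' (hUm k) fun b hb => ?_
        rw [hg]
        simp only
        rw [indicator_of_mem]
        rw [Metric.mem_ball]
        have e1 : dist a (W.closest j) < W.radius j := ha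
        have e2 : dist b (W.closest k) < W.radius k := hb
        have e3 := hN.2.2
        have e4 := dist_triangle4 b (W.closest k) (W.closest j) a
        rw [dist_comm (W.closest j) a, dist_comm (W.closest k)] at e4
        linarith [hN.1, hN.2.1]
    have hwk : w k ≠ ∞ := by
      rw [hw]; simp only
      rw [if_pos hN.2.1]
      exact ENNReal.mul_ne_top (hμ.measure_ball_lt_top _ (by linarith [W.radius_pos k])).ne
        (ENNReal.inv_ne_top.2 hk0)
    calc _ ≤ μ (Metric.ball (W.center j) (2 * W.radius j)) *
          (μ (Metric.ball (W.center k) (2 * W.radius k)) * (μ (Metric.ball (W.center j) t))⁻¹ *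
          ((ν (U j))⁻¹ * (ν (U k))⁻¹ *
            ∫⁻ a in U j, ∫⁻ b in U k, ‖f b - f a‖ₑ ^ p ∂ν ∂ν)) := by gcongr
      _ = w j * w k * ((μ (Metric.ball (W.center j) t))⁻¹ *
            ∫⁻ a in U j, ∫⁻ b in U k, ‖f b - f a‖ₑ ^ p ∂ν ∂ν) := by
          rw [hw]; simp only
          rw [if_pos hN.1, if_pos hN.2.1]; ring
      _ ≤ w j * w k * (T * ∫⁻ a in U j,
            (ν (Metric.ball a (60 * t)))⁻¹ * ∫⁻ b in U k, g a b ∂ν ∂ν) := by gcongr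
      _ = T * (w j * (w k * ∫⁻ a in U j,
            (ν (Metric.ball a (60 * t)))⁻¹ * ∫⁻ b in U k, g a b ∂ν ∂ν)) := by ring
      _ = _ := by
          rw [← lintegral_const_mul' _ _ hwk]
          congr 2
          refine lintegral_congr fun a => ?_
          simp only [hh]; ring
  have h3t : 0 < 3 * t := by positivity
  -- Used twice, for the sum over `k` with `a` fixed and then for the sum over `j`. The two factors
  -- `t^θ` and the `t^(-θ)` inside `T` combine to a single `t^θ`.
  have hsum : ∀ G : Boundary Ω → ℝ≥0∞, ∑' j, w j * ∫⁻ a in U j, G a ∂ν ≤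
      C₁ * ENNReal.ofReal ((3 * t) ^ θ) * ∫⁻ a, G a ∂ν := by
    intro G
    refine le_trans (ENNReal.tsum_le_tsum fun j => ?_) (h₁ (3 * t) h3t (hscale _ le_rfl) G)
    rw [hw]; simp only
    split_ifs
    · exact le_rfl
    · simp
  set L := C₁ * ENNReal.ofReal ((3 * t) ^ θ) with hL
  have hLtop : L ≠ ∞ := by finiteness
  have hLt : L = C₁ * ENNReal.ofReal (3 ^ θ) * ENNReal.ofReal (t ^ θ) := by
    rw [hL, Real.mul_rpow (by norm_num) ht.le, ENNReal.ofReal_mul (by positivity), mul_assoc]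
  calc W.pairEnergy μ (W.avg ν f) p t
      ≤ ∑' j, ∑' k, T * (w j * ∫⁻ a in U j, h k a ∂ν) :=
        ENNReal.tsum_le_tsum fun j => ENNReal.tsum_le_tsum fun k => hterm j k
    _ = T * ∑' j, w j * ∑' k, ∫⁻ a in U j, h k a ∂ν := by
        simp_rw [ENNReal.tsum_mul_left]
    _ ≤ T * ∑' j, w j * ∫⁻ a in U j, ∑' k, h k a ∂ν := by
        gcongr with j
        exact tsum_lintegral_le _
    _ ≤ T * (L * ∫⁻ a, ∑' k, h k a ∂ν) := by
        gcongr
        exact hsum _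
    _ ≤ T * (L * ∫⁻ a, L * ⨍⁻ b in Metric.ball a (60 * t), ‖f b - f a‖ₑ ^ p ∂ν ∂ν) := by
        gcongr with a
        simp only [hh]
        rw [ENNReal.tsum_mul_left, setLAverage_eq, div_eq_mul_inv, mul_comm]
        rw [← mul_assoc]
        gcongr
        refine (hsum (g a)).trans_eq ?_
        rw [hg]
        simp only
        rw [lintegral_indicator Metric.isOpen_ball.measurableSet]
    _ = T * L * L * besovOsc ν p f (60 * t) := by
        rw [lintegral_const_mul' _ _ hLtop, besovOsc]; ring
    _ = K * ENNReal.ofReal (t ^ θ) * besovOsc ν p f (60 * t) := by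
        have e1 : ENNReal.ofReal (t ^ (-θ)) * ENNReal.ofReal (t ^ θ) = 1 := by
          rw [← ENNReal.ofReal_mul (by positivity), ← Real.rpow_add ht]
          simp
        rw [hK, hT, hLt]
        calc _ = C₃ * C₂ * (C₁ * ENNReal.ofReal (3 ^ θ)) * (C₁ * ENNReal.ofReal (3 ^ θ)) *
              (ENNReal.ofReal (t ^ (-θ)) * ENNReal.ofReal (t ^ θ)) * ENNReal.ofReal (t ^ θ) *
              besovOsc ν p f (60 * t) := by ring
          _ = _ := by rw [e1, mul_one]

/-- Integrals of `|Ẽf - c|^p` are controlled by integrals of `|f - c|^p` on the boundary. -/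
lemma exists_lintegral_homExt_sub_le [BorelSpace Ω] [Countable ι] (hμ : IsDoubling μ)
    (hθ : 0 < θ) (hreg : RegularUpTo μ ν θ R₀) {p : ℝ} (hp : 1 ≤ p) : ∃ C : ℝ≥0∞, C ≠ ∞ ∧
    ∀ (f : Boundary Ω → ℝ) (c τ : ℝ) (E : Set Ω) (D : Set (Boundary Ω)),
      (∀ j, IntegrableOn f (Metric.ball (W.closest j) (W.radius j)) ν) →
      MeasurableSet E → MeasurableSet D → 0 < τ → ENNReal.ofReal τ ≤ R₀ →
      (∀ j, ∀ x ∈ E, x ∈ Metric.ball (W.center j) (2 * W.radius j) → W.avg ν f j = c ∨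
        (W.radius j ≤ τ ∧ Metric.ball (W.closest j) (W.radius j) ⊆ D)) →
      ∫⁻ x in E, ‖W.homExt ν f x - c‖ₑ ^ p ∂μ ≤
        C * ENNReal.ofReal (τ ^ θ) * ∫⁻ z in D, ‖f z - c‖ₑ ^ p ∂ν := by
  classical
  have hp0 : 0 < p := one_pos.trans_le hp
  obtain ⟨C₁, hC₁, h₁⟩ := W.exists_tsum_setLIntegral_le hμ hθ hreg
  refine ⟨C₁, hC₁, fun f c τ E D hf hE hD hτ hτR h => ?_⟩
  set U : ι → Set (Boundary Ω) := fun j => Metric.ball (W.closest j) (W.radius j) with hUdef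
  set B : ι → Set Ω := fun j => Metric.ball (W.center j) (2 * W.radius j) with hB
  have hBm : ∀ j, MeasurableSet (B j) := fun j => Metric.isOpen_ball.measurableSet
  set v : ι → ℝ≥0∞ := fun j =>
    if W.radius j ≤ τ ∧ U j ⊆ D then ‖W.avg ν f j - c‖ₑ ^ p else 0 with hv
  have hpt : ∀ x ∈ E, ‖W.homExt ν f x - c‖ₑ ^ p ≤ ∑' j, (B j).indicator (fun _ => v j) x := by
    intro x hx
    -- A trivial second index makes the two-index estimate serve for a single sum.
    have h2 := rpow_le_mul_tsum_tsum (P := fun j (_ : Unit) => x ∈ B j)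
      (v := fun j _ => ‖W.avg ν f j - c‖ₑ) (X := ‖W.homExt ν f x - c‖ₑ) (C := 1) hp0
      (fun M hM => by
        rw [one_mul]
        exact W.enorm_synth_sub_le fun j hj => hM j () hj)
    rw [ENNReal.one_rpow, one_mul] at h2
    refine h2.trans (ENNReal.tsum_le_tsum fun j => ?_)
    rw [tsum_fintype, Finset.univ_unique, Finset.sum_singleton]
    split_ifs with hj
    · rw [indicator_of_mem hj, hv]
      simp only
      rcases h j x hx hj with h3 | h3
      · rw [h3, sub_self, enorm_zero, ENNReal.zero_rpow_of_pos hp0]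
        exact zero_le
      · rw [if_pos h3]
    · exact zero_le
  calc _ ≤ ∫⁻ x in E, ∑' j, (B j).indicator (fun _ => v j) x ∂μ := setLIntegral_mono' hE hpt
    _ ≤ ∫⁻ x, ∑' j, (B j).indicator (fun _ => v j) x ∂μ := setLIntegral_le_lintegral _ _
    _ = ∑' j, v j * μ (B j) := by
        rw [lintegral_tsum fun j => (measurable_const.indicator (hBm j)).aemeasurable]
        exact tsum_congr fun j => lintegral_indicator_const (hBm j) _
    _ ≤ ∑' j, (if W.radius j ≤ τ then μ (B j) * (ν (U j))⁻¹ *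
        ∫⁻ z in U j, D.indicator (fun z => ‖f z - c‖ₑ ^ p) z ∂ν else 0) := by
        refine ENNReal.tsum_le_tsum fun j => ?_
        rw [hv]; simp only
        split_ifs with h4 h5 h6
        · have hR : ENNReal.ofReal (W.radius j) ≤ R₀ := (ENNReal.ofReal_le_ofReal h5).trans hτR
          have hj0 := (hreg.measure_ball_pos hμ (W.closest j) (W.radius_pos j) hR).ne'
          have hj1 := (hreg.measure_ball_lt_top hμ (W.closest j) (W.radius_pos j) hR).ne
          have hJ := enorm_setAverage_sub_rpow_le hp hj0 hj1 (hf j) c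
          have e1 : ∫⁻ z in U j, D.indicator (fun z => ‖f z - c‖ₑ ^ p) z ∂ν =
              ∫⁻ z in U j, ‖f z - c‖ₑ ^ p ∂ν :=
            setLIntegral_congr_fun Metric.isOpen_ball.measurableSet fun z hz =>
              indicator_of_mem (h4.2 hz) _
          rw [e1]
          calc ‖W.avg ν f j - c‖ₑ ^ p * μ (B j)
              = ‖W.avg ν f j - c‖ₑ ^ p * (ν (U j) * (ν (U j))⁻¹) * μ (B j) := by
                rw [ENNReal.mul_inv_cancel hj0 hj1, mul_one]
            _ = μ (B j) * (ν (U j))⁻¹ * (‖W.avg ν f j - c‖ₑ ^ p * ν (U j)) := by ring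
            _ ≤ _ := by gcongr; exact hJ
        · exact absurd h4.1 h5
        · simp
        · simp
    _ ≤ C₁ * ENNReal.ofReal (τ ^ θ) * ∫⁻ z, D.indicator (fun z => ‖f z - c‖ₑ ^ p) z ∂ν :=
        h₁ τ hτ hτR _
    _ = _ := by rw [lintegral_indicator hD]

end WhitneyData

end BoundaryEstimates

/-! ### Oscillation of the extension against dyadic oscillations on the boundary. -/

section EnergyOfExtension

variable {Ω : Type*} [MetricSpace Ω] [MeasurableSpace Ω] {μ : Measure Ω}

lemma measurable_measure_ball {X : Type*} [MetricSpace X] [MeasurableSpace X] [BorelSpace X]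
    [SecondCountableTopology X] (m : Measure X) [SFinite m] (t : ℝ) :
    Measurable fun x => m (Metric.ball x t) := by
  have : MeasurableSet {q : X × X | dist q.2 q.1 < t} :=
    (isOpen_lt (continuous_snd.dist continuous_fst) continuous_const).measurableSet
  exact measurable_measure_prodMk_left this

/-- The oscillation at any scale is controlled by the distance to constants in `L^p`. -/
lemma IsDoubling.exists_besovOsc_le_lintegral [BorelSpace Ω] (hμ : IsDoubling μ) {p : ℝ}
    (hp : 1 ≤ p) : ∃ C : ℝ≥0∞, C ≠ ∞ ∧ ∀ (u : Ω → ℝ) (c t : ℝ), Measurable u → 0 < t →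
      besovOsc μ p u t ≤ C * ∫⁻ x, ‖u x - c‖ₑ ^ p ∂μ := by
  have hp0 : 0 < p := one_pos.trans_le hp
  have := hμ.secondCountableTopology
  have := hμ.isLocallyFiniteMeasure
  obtain ⟨C, hC, h⟩ := hμ.exists_tracedBall_le 2
  have h2p : (2 : ℝ≥0∞) ^ p ≠ ∞ := ENNReal.rpow_ne_top_of_nonneg hp0.le ENNReal.ofNat_ne_top
  refine ⟨2 ^ p * (C + 1), by finiteness, fun u c t hu ht => ?_⟩
  set g : Ω → ℝ≥0∞ := fun x => ‖u x - c‖ₑ ^ p with hg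
  have hgm : Measurable g := by fun_prop
  have hm := measurable_measure_ball μ t
  -- The averaging weight at `x` is traded for the one at `y`, so that after exchanging the
  -- integrals the integration in `x` cancels it.
  have hinv : ∀ x y, dist y x < t → (μ (Metric.ball x t))⁻¹ ≤ C * (μ (Metric.ball y t))⁻¹ := by
    intro x y hxy
    refine ENNReal.inv_le_mul_inv (hμ.measure_ball_pos _ ht).ne'
      (hμ.measure_ball_lt_top _ ht).ne ?_
    rw [← tracedBall_coe, ← tracedBall_coe]
    refine h _ _ _ _ ht ?_
    rw [Completion.dist_eq]
    linarith
  have hpt : ∀ x, ⨍⁻ y in Metric.ball x t, ‖u y - u x‖ₑ ^ p ∂μ ≤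
      2 ^ p * ((∫⁻ y in Metric.ball x t, C * (μ (Metric.ball y t))⁻¹ * g y ∂μ) + g x) := by
    intro x
    have h0 := (hμ.measure_ball_pos x ht).ne'
    have h1 := (hμ.measure_ball_lt_top x ht).ne
    rw [setLAverage_eq, div_eq_mul_inv]
    calc _ ≤ (∫⁻ y in Metric.ball x t, 2 ^ p * (g y + g x) ∂μ) * (μ (Metric.ball x t))⁻¹ := by
          gcongr with y
          have e1 : ‖u y - u x‖ₑ ≤ ‖u y - c‖ₑ + ‖u x - c‖ₑ := by
            rw [show u y - u x = (u y - c) - (u x - c) by ring]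
            exact enorm_sub_le
          calc ‖u y - u x‖ₑ ^ p ≤ (‖u y - c‖ₑ + ‖u x - c‖ₑ) ^ p := by gcongr
            _ ≤ _ := ENNReal.add_rpow_le_two_rpow hp0.le _ _
      _ = 2 ^ p * ((∫⁻ y in Metric.ball x t, (μ (Metric.ball x t))⁻¹ * g y ∂μ) +
            g x * (μ (Metric.ball x t) * (μ (Metric.ball x t))⁻¹)) := by
          rw [lintegral_const_mul' _ _ h2p, lintegral_add_right _ measurable_const,
            setLIntegral_const, lintegral_const_mul' _ _ (ENNReal.inv_ne_top.2 h0)]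
          ring
      _ ≤ _ := by
          rw [ENNReal.mul_inv_cancel h0 h1, mul_one]
          gcongr _ * (?_ + _)
          refine setLIntegral_mono' Metric.isOpen_ball.measurableSet fun y hy => ?_
          gcongr
          exact hinv x y hy
  have hswap : ∫⁻ x, ∫⁻ y in Metric.ball x t, C * (μ (Metric.ball y t))⁻¹ * g y ∂μ ∂μ =
      C * ∫⁻ y, g y ∂μ := by
    have hset : MeasurableSet {q : Ω × Ω | dist q.2 q.1 < t} :=
      (isOpen_lt (continuous_snd.dist continuous_fst) continuous_const).measurableSet
    have hF : Measurable fun q : Ω × Ω => {q : Ω × Ω | dist q.2 q.1 < t}.indicator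
        (fun q => C * (μ (Metric.ball q.2 t))⁻¹ * g q.2) q :=
      Measurable.indicator (((hm.comp measurable_snd).inv.const_mul C).mul
        (hgm.comp measurable_snd)) hset
    calc _ = ∫⁻ x, ∫⁻ y, {q : Ω × Ω | dist q.2 q.1 < t}.indicator
          (fun q => C * (μ (Metric.ball q.2 t))⁻¹ * g q.2) (x, y) ∂μ ∂μ := by
          refine lintegral_congr fun x => ?_
          rw [← lintegral_indicator Metric.isOpen_ball.measurableSet]
          rfl
      _ = ∫⁻ y, ∫⁻ x, {q : Ω × Ω | dist q.2 q.1 < t}.indicator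
          (fun q => C * (μ (Metric.ball q.2 t))⁻¹ * g q.2) (x, y) ∂μ ∂μ :=
          lintegral_lintegral_swap hF.aemeasurable
      _ = ∫⁻ y, C * g y ∂μ := by
          refine lintegral_congr fun y => ?_
          have e1 : ∀ x, {q : Ω × Ω | dist q.2 q.1 < t}.indicator
              (fun q => C * (μ (Metric.ball q.2 t))⁻¹ * g q.2) (x, y) =
              (Metric.ball y t).indicator (fun _ => C * (μ (Metric.ball y t))⁻¹ * g y) x := by
            intro x
            simp only [indicator, mem_ofPred_eq, Metric.mem_ball, dist_comm x y]
          simp_rw [e1]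
          rw [lintegral_indicator_const Metric.isOpen_ball.measurableSet]
          calc _ = C * g y * (μ (Metric.ball y t) * (μ (Metric.ball y t))⁻¹) := by ring
            _ = _ := by
              rw [ENNReal.mul_inv_cancel (hμ.measure_ball_pos y ht).ne'
                (hμ.measure_ball_lt_top y ht).ne, mul_one]
      _ = _ := lintegral_const_mul' _ _ hC
  calc besovOsc μ p u t ≤ ∫⁻ x, 2 ^ p *
        ((∫⁻ y in Metric.ball x t, C * (μ (Metric.ball y t))⁻¹ * g y ∂μ) + g x) ∂μ :=
        lintegral_mono hpt
    _ = 2 ^ p * (C * ∫⁻ y, g y ∂μ + ∫⁻ y, g y ∂μ) := by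
        rw [lintegral_const_mul' _ _ h2p, lintegral_add_right _ hgm, hswap]
    _ = _ := by ring

variable {ν : Measure (Boundary Ω)} {θ : ℝ} {R₀ : ℝ≥0∞}

/-- The oscillation is almost increasing in the scale. -/
lemma RegularUpTo.exists_besovOsc_le (h : RegularUpTo μ ν θ R₀) (hμ : IsDoubling μ)
    (hθ : 0 < θ) (p : ℝ) : ∃ C : ℝ≥0∞, C ≠ ∞ ∧ ∀ (f : Boundary Ω → ℝ) (t t' : ℝ), 0 < t →
      t ≤ t' → t' ≤ 2 * t → ENNReal.ofReal t' ≤ R₀ →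
      besovOsc ν p f t ≤ C * besovOsc ν p f t' := by
  obtain ⟨C, hC, hb⟩ := h.exists_ball_le hμ hθ 2
  refine ⟨C, hC, fun f t t' ht htt' ht' hR => ?_⟩
  rw [besovOsc, besovOsc, ← lintegral_const_mul' _ _ hC]
  refine lintegral_mono fun z => ?_
  rw [setLAverage_eq, setLAverage_eq, div_eq_mul_inv, div_eq_mul_inv]
  have h1 : (ν (Metric.ball z t))⁻¹ ≤ C * (ν (Metric.ball z t'))⁻¹ :=
    ENNReal.inv_le_mul_inv (h.measure_ball_pos hμ z (ht.trans_le htt') hR).ne'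
      (h.measure_ball_lt_top hμ z (ht.trans_le htt') hR).ne
      (hb z z t' t ht htt' (by rw [dist_self]; linarith) hR)
  calc _ ≤ (∫⁻ y in Metric.ball z t', ‖f y - f z‖ₑ ^ p ∂ν) * (C * (ν (Metric.ball z t'))⁻¹) := by
        gcongr
    _ = _ := by ring

open Classical in
/-- The dyadic oscillations of a boundary function, weighted by the smoothness. -/
noncomputable def oscSeq (ν : Measure (Boundary Ω)) (α p : ℝ) (R₀ : ℝ≥0∞)
    (f : Boundary Ω → ℝ) (i : ℤ) : ℝ≥0∞ :=
  if ENNReal.ofReal (60 * 2 ^ (i + 1)) ≤ R₀ then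
    besovOsc ν p f (60 * 2 ^ i) * ENNReal.ofReal (((2 : ℝ) ^ i) ^ (-(α * p))) else 0

/-- Almost monotonicity compares the oscillation at `60 * 2^i` with that at every scale of the
dyadic interval starting there. The truncation at exponent `i + 1` keeps the whole interval within
the range of regularity. -/
lemma seqFin_oscSeq (h : RegularUpTo μ ν θ R₀) (hμ : IsDoubling μ) (hθ : 0 < θ) {α p : ℝ}
    {q : ℝ≥0∞} (hα : 0 < α) (hp : 1 ≤ p) (hq : 1 ≤ q) {f : Boundary Ω → ℝ}
    (hf : besovEnergy ν α p q f < ∞) : SeqFin p q (oscSeq ν α p R₀ f) := by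
  obtain ⟨C, hC, hb⟩ := h.exists_besovOsc_le hμ hθ p
  rw [besovEnergy_eq_energyOf] at hf
  refine seqFin_of_energyOf_lt_top hα hp hq hf (c := 60) (by norm_num) hC fun i t ht => ?_
  rw [oscSeq]
  split_ifs with hR
  swap
  · exact zero_le
  gcongr
  have h2 := ht.2.le
  rw [zpow_add_one₀ two_ne_zero] at h2
  exact hb f _ _ (by positivity) ht.1 (by linarith)
    ((ENNReal.ofReal_le_ofReal ht.2.le).trans hR)

lemma besovOsc_eq_oscSeq {Ω : Type*} [MetricSpace Ω] {ν : Measure (Boundary Ω)} {R₀ : ℝ≥0∞}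
    {α p : ℝ} {f : Boundary Ω → ℝ} {i : ℤ}
    (hR : ENNReal.ofReal (60 * 2 ^ (i + 1)) ≤ R₀) :
    besovOsc ν p f (60 * 2 ^ i) =
      ENNReal.ofReal (((2 : ℝ) ^ i) ^ (α * p)) * oscSeq ν α p R₀ f i := by
  have h2i : (0 : ℝ) < 2 ^ i := by positivity
  rw [oscSeq, if_pos hR, mul_left_comm, ← ENNReal.ofReal_mul (by positivity),
    ← Real.rpow_add h2i]
  simp

namespace WhitneyData

variable {ι : Type} [Countable ι] [BorelSpace Ω] (W : WhitneyData Ω ι)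

/-- The oscillation of the extension in terms of the dyadic oscillations of the boundary
function. -/
lemma exists_besovOsc_homExt_le (hμ : IsDoubling μ) (hθ : 0 < θ) (hreg : RegularUpTo μ ν θ R₀)
    {α p : ℝ} (hp : 1 ≤ p) : ∃ C : ℝ≥0∞, C ≠ ∞ ∧
    ∀ f : Boundary Ω → ℝ,
      (∀ j, IntegrableOn f (Metric.ball (W.closest j) (W.radius j)) ν) →
      (∀ i : ℤ, ¬ ENNReal.ofReal (60 * 2 ^ (i + 1)) ≤ R₀ →
        W.layerEnergy μ (W.avg ν f) p i = 0) →
      ∀ i : ℤ, ENNReal.ofReal (60 * 2 ^ (i + 2)) ≤ R₀ →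
      ∀ t ∈ Set.Ico ((2 : ℝ) ^ i) (2 ^ (i + 1)), besovOsc μ p (W.homExt ν f) t ≤
        ENNReal.ofReal (((2 : ℝ) ^ i) ^ ((α + θ / p) * p)) *
          (C * ∑' n : ℕ, ENNReal.ofReal (2 ^ (-(p - (α + θ / p) * p))) ^ n *
            oscSeq ν α p R₀ f (i + n)) := by
  have hp0 : 0 < p := one_pos.trans_le hp
  obtain ⟨C₁, hC₁, hnear⟩ := W.exists_near_le hμ hp0
  obtain ⟨C₂, hC₂, hfar⟩ := W.exists_far_le (μ := μ) hp0
  obtain ⟨C₃, hC₃, hlay⟩ := W.exists_layerEnergy_le hμ p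
  obtain ⟨C₄, hC₄, hpair⟩ := W.exists_pairEnergy_le hμ hθ hreg hp
  obtain ⟨C₅, hC₅, hmono⟩ := hreg.exists_besovOsc_le hμ hθ p
  refine ⟨C₁ * C₄ * C₅ * ENNReal.ofReal (2 ^ p) + C₂ * C₃ * C₄, by finiteness,
    fun f hf hlayer i hi t ht => ?_⟩
  set s := α + θ / p with hs
  have hsp : s * p = α * p + θ := by rw [hs]; field_simp
  set κ := ENNReal.ofReal (2 ^ (-(p - s * p))) with hκ
  set a := oscSeq ν α p R₀ f with ha
  set S := ∑' n : ℕ, κ ^ n * a (i + n) with hS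
  have h2i : (0 : ℝ) < 2 ^ i := by positivity
  have ht0 : 0 < t := h2i.trans_le ht.1
  have hdyad : ∀ k : ℤ, ENNReal.ofReal (60 * 2 ^ (k + 1)) ≤ R₀ →
      ENNReal.ofReal (((2 : ℝ) ^ k) ^ θ) * besovOsc ν p f (60 * 2 ^ k) =
        ENNReal.ofReal (((2 : ℝ) ^ k) ^ (s * p)) * a k := by
    intro k hk
    have h2k : (0 : ℝ) < 2 ^ k := by positivity
    rw [besovOsc_eq_oscSeq (α := α) hk, ← mul_assoc, ← ENNReal.ofReal_mul (by positivity),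
      ← Real.rpow_add h2k, hsp, add_comm θ]
  -- The scale `60 t` is rounded up to `60 * 2^(i+1)`, so the near part is dominated by the term `n
  -- = 1` of the series. This is why the range condition involves `i + 2`.
  have hN : C₁ * W.pairEnergy μ (W.avg ν f) p t ≤ ENNReal.ofReal (((2 : ℝ) ^ i) ^ (s * p)) *
      (C₁ * C₄ * C₅ * ENNReal.ofReal (2 ^ p) * S) := by
    have e0 : (2 : ℝ) ^ (i + 1) = 2 * 2 ^ i := by rw [zpow_add_one₀ two_ne_zero]; ring
    have e1 : ENNReal.ofReal (60 * 2 ^ (i + 1)) ≤ R₀ := by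
      refine (ENNReal.ofReal_le_ofReal ?_).trans hi
      gcongr
      · exact one_le_two
      · norm_num
    have e2 : 60 * t ≤ 60 * 2 ^ (i + 1) := by gcongr; exact ht.2.le
    calc C₁ * W.pairEnergy μ (W.avg ν f) p t
        ≤ C₁ * (C₄ * ENNReal.ofReal (t ^ θ) * besovOsc ν p f (60 * t)) := by
          gcongr
          exact hpair f t hf ht0 ((ENNReal.ofReal_le_ofReal e2).trans e1)
      _ ≤ C₁ * (C₄ * ENNReal.ofReal (((2 : ℝ) ^ (i + 1)) ^ θ) *
          (C₅ * besovOsc ν p f (60 * 2 ^ (i + 1)))) := by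
          gcongr C₁ * (C₄ * ENNReal.ofReal (?_ ^ θ) * ?_)
          · exact ht.2.le
          · refine hmono f _ _ (by positivity) e2 ?_ e1
            rw [e0]; linarith [ht.1]
      _ = C₁ * C₄ * C₅ * (ENNReal.ofReal (((2 : ℝ) ^ (i + 1)) ^ θ) *
          besovOsc ν p f (60 * 2 ^ (i + 1))) := by ring
      _ = C₁ * C₄ * C₅ * (ENNReal.ofReal (((2 : ℝ) ^ (i + 1)) ^ (s * p)) * a (i + 1)) := by
          rw [hdyad _ (by rwa [add_assoc])]
      _ = ENNReal.ofReal (((2 : ℝ) ^ i) ^ (s * p)) *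
          (C₁ * C₄ * C₅ * ENNReal.ofReal (2 ^ p) * (κ ^ 1 * a (i + (1 : ℕ)))) := by
          have e3 : ENNReal.ofReal (((2 : ℝ) ^ (i + 1)) ^ (s * p)) =
              ENNReal.ofReal (((2 : ℝ) ^ i) ^ (s * p)) * (ENNReal.ofReal (2 ^ p) * κ) := by
            rw [hκ, ← ENNReal.ofReal_mul (by positivity), ← ENNReal.ofReal_mul (by positivity),
              ← Real.rpow_add two_pos, e0, Real.mul_rpow two_pos.le h2i.le]
            congr 1
            rw [mul_comm]
            congr 2
            ring
          rw [e3, pow_one, Nat.cast_one]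
          ring
      _ ≤ _ := by
          gcongr
          exact ENNReal.le_tsum (f := fun n : ℕ => κ ^ n * a (i + n)) 1
  have hF : C₂ * ∑' n : ℕ, ENNReal.ofReal (2 ^ (-p)) ^ n *
      W.layerEnergy μ (W.avg ν f) p (i + n) ≤
      ENNReal.ofReal (((2 : ℝ) ^ i) ^ (s * p)) * (C₂ * C₃ * C₄ * S) := by
    have e1 : ∀ k : ℤ, W.layerEnergy μ (W.avg ν f) p k ≤
        C₃ * C₄ * (ENNReal.ofReal (((2 : ℝ) ^ k) ^ (s * p)) * a k) := by
      intro k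
      by_cases hk : ENNReal.ofReal (60 * 2 ^ (k + 1)) ≤ R₀
      swap
      · rw [hlayer k hk]; exact zero_le
      refine (hlay _ k).trans ?_
      calc C₃ * W.pairEnergy μ (W.avg ν f) p (2 ^ k)
          ≤ C₃ * (C₄ * ENNReal.ofReal (((2 : ℝ) ^ k) ^ θ) * besovOsc ν p f (60 * 2 ^ k)) := by
            gcongr
            refine hpair f _ hf (by positivity) ((ENNReal.ofReal_le_ofReal ?_).trans hk)
            gcongr
            · exact one_le_two
            · omega
        _ = C₃ * C₄ * (ENNReal.ofReal (((2 : ℝ) ^ k) ^ θ) * besovOsc ν p f (60 * 2 ^ k)) := by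
            ring
        _ = _ := by rw [hdyad k hk]
    -- The Lipschitz gain `2^(-np)` competes with the growth `2^(nsp)` of the weight; their product
    -- is `κ ^ n`.
    have e2 : ∀ n : ℕ, ENNReal.ofReal (2 ^ (-p)) ^ n *
        ENNReal.ofReal (((2 : ℝ) ^ (i + n)) ^ (s * p)) =
        ENNReal.ofReal (((2 : ℝ) ^ i) ^ (s * p)) * κ ^ n := by
      intro n
      rw [hκ, ← ENNReal.ofReal_pow (by positivity), ← ENNReal.ofReal_pow (by positivity),
        ← ENNReal.ofReal_mul (by positivity), ← ENNReal.ofReal_mul (by positivity),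
        zpow_add₀ two_ne_zero, Real.mul_rpow h2i.le (by positivity), zpow_natCast, mul_left_comm]
      congr 2
      rw [← Real.rpow_natCast, ← Real.rpow_natCast, ← Real.rpow_natCast, ← Real.rpow_mul two_pos.le,
        ← Real.rpow_mul two_pos.le, ← Real.rpow_mul two_pos.le, ← Real.rpow_add two_pos]
      congr 1
      ring
    calc _ ≤ C₂ * ∑' n : ℕ, ENNReal.ofReal (2 ^ (-p)) ^ n *
          (C₃ * C₄ * (ENNReal.ofReal (((2 : ℝ) ^ (i + n)) ^ (s * p)) * a (i + n))) := by
          gcongr with n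
          exact e1 _
      _ = C₂ * ∑' n : ℕ, C₃ * C₄ * ENNReal.ofReal (((2 : ℝ) ^ i) ^ (s * p)) *
          (κ ^ n * a (i + n)) := by
          congr 1
          refine tsum_congr fun n => ?_
          calc _ = C₃ * C₄ * (ENNReal.ofReal (2 ^ (-p)) ^ n *
                ENNReal.ofReal (((2 : ℝ) ^ (i + n)) ^ (s * p))) * a (i + n) := by ring
            _ = _ := by rw [e2]; ring
      _ = _ := by rw [ENNReal.tsum_mul_left]; ring
  rw [besovOsc, ← lintegral_add_compl _ (isOpen_bdryDist_lt (11 * t)).measurableSet]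
  calc _ ≤ ENNReal.ofReal (((2 : ℝ) ^ i) ^ (s * p)) *
        (C₁ * C₄ * C₅ * ENNReal.ofReal (2 ^ p) * S) +
        ENNReal.ofReal (((2 : ℝ) ^ i) ^ (s * p)) * (C₂ * C₃ * C₄ * S) :=
        add_le_add ((hnear _ t ht0).trans hN) ((hfar _ i t ht).trans hF)
    _ = _ := by ring

end WhitneyData

end EnergyOfExtension

/-! ### Energy, trace and local integrability of the homogeneous extension. -/

section HomogeneousExtension

lemma ofReal_two_rpow_neg_lt_one {x : ℝ} (hx : 0 < x) : ENNReal.ofReal (2 ^ (-x)) < 1 := by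
  rw [ENNReal.ofReal_lt_one]
  exact Real.rpow_lt_one_of_one_lt_of_neg one_lt_two (by linarith)

lemma ofReal_zpow_rpow_mul_pow_natAbs {x : ℝ} {k : ℤ} (hk : 0 ≤ k) :
    ENNReal.ofReal (((2 : ℝ) ^ k) ^ x) * ENNReal.ofReal (2 ^ (-x)) ^ k.natAbs = 1 := by
  obtain ⟨n, rfl⟩ := Int.eq_ofNat_of_zero_le hk
  rw [← ENNReal.ofReal_pow (by positivity), ← ENNReal.ofReal_mul (by positivity), zpow_natCast,
    Int.natAbs_natCast, ← Real.rpow_natCast, ← Real.rpow_natCast, ← Real.rpow_mul two_pos.le,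
    ← Real.rpow_mul two_pos.le, ← Real.rpow_add two_pos]
  rw [show (n : ℝ) * x + -x * n = 0 by ring]
  simp

variable {Ω : Type*} [MetricSpace Ω] [MeasurableSpace Ω] [BorelSpace Ω] {μ : Measure Ω}
  {ν : Measure (Boundary Ω)} {θ α p : ℝ} {q : ℝ≥0∞}

lemma IsDoubling.integrableOn_ball [LocallyCompactSpace Ω] (hμ : IsDoubling μ)
    {f : Boundary Ω → ℝ} (hf : LocallyIntegrable f ν) (z : Boundary Ω) (r : ℝ) :
    IntegrableOn f (Metric.ball z r) ν := by
  have := hμ.properSpace_boundary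
  exact (hf.integrableOn_isCompact (isCompact_closedBall z r)).mono_set
    Metric.ball_subset_closedBall

namespace WhitneyData

variable {ι : Type} [Countable ι] (W : WhitneyData Ω ι)

/-- Regularity holds at all radii, so the dyadic estimate is valid at every scale and the Hardy
inequality suffices; `α + θ/p < 1` makes its ratio less than one. -/
lemma energy_homExt_lt_top_of_unbounded (hμ : IsDoubling μ) (hθ : 0 < θ)
    (hreg : RegularUpTo μ ν θ ∞) (hα : 0 < α) (hp : 1 ≤ p) (hq : 1 ≤ q)
    (hs : α + θ / p < 1) {f : Boundary Ω → ℝ}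
    (hint : ∀ j, IntegrableOn f (Metric.ball (W.closest j) (W.radius j)) ν)
    (hf : besovEnergy ν α p q f < ∞) : besovEnergy μ (α + θ / p) p q (W.homExt ν f) < ∞ := by
  have hp0 : 0 < p := one_pos.trans_le hp
  obtain ⟨C, hC, h⟩ := W.exists_besovOsc_homExt_le hμ hθ hreg (α := α) hp
  have hκ := ofReal_two_rpow_neg_lt_one (x := p - (α + θ / p) * p) (by nlinarith)
  rw [besovEnergy_eq_energyOf]
  refine energyOf_lt_top_of_seqFin hp hq (by positivity)
    (((seqFin_oscSeq hreg hμ hθ hα hp hq hf).hardy hp hq hκ).of_le_mul hp hC fun _ => le_rfl)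
    (h f hint (fun i hi => absurd le_top hi) · le_top)

/-- Scales `2^k` with `k < 0` follow from the dyadic estimate. At the others the oscillation is at
most a constant, the `L^p` distance from the extension to the mean `c`, and the positive smoothness
makes the weighted sequence geometric. -/
lemma energy_homExt_lt_top_of_bounded (hμ : IsDoubling μ) (hθ : 0 < θ)
    (hreg : ∀ R : ℝ, RegularUpTo μ ν θ (ENNReal.ofReal R))
    (hbdd : Metric.ediam (Set.univ : Set (Boundary Ω)) ≠ ∞) (hne : Nonempty (Boundary Ω))
    (hα : 0 < α) (hp : 1 ≤ p) (hq : 1 ≤ q) (hs : α + θ / p < 1) {f : Boundary Ω → ℝ}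
    (hint : ∀ z r, IntegrableOn f (Metric.ball z r) ν)
    (hf : besovEnergy ν α p q f < ∞) : besovEnergy μ (α + θ / p) p q (W.homExt ν f) < ∞ := by
  have hp0 : 0 < p := one_pos.trans_le hp
  set D := (Metric.ediam (Set.univ : Set (Boundary Ω))).toReal with hD
  have hD0 : 0 ≤ D := ENNReal.toReal_nonneg
  have hball : ∀ (z : Boundary Ω) (r : ℝ), D < r → Metric.ball z r = Set.univ := by
    intro z r hr
    refine eq_univ_of_forall fun w => lt_of_le_of_lt ?_ hr
    rw [dist_edist]
    exact ENNReal.toReal_mono hbdd (Metric.edist_le_ediam_of_mem (mem_univ _) (mem_univ _))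
  -- Large enough that the dyadic estimate covers all `k < 0`, and that a touching pair from a
  -- generation beyond the range has both radii above `D`, hence equal coefficients.
  set R := 1056 * D + 240 with hR
  have hregR := hreg R
  obtain ⟨z₀⟩ := hne
  have huniv : Metric.ball z₀ (D + 1) = Set.univ := hball z₀ _ (by linarith)
  have hu0 : ν Set.univ ≠ 0 := by
    rw [← huniv]; exact ((hreg (D + 1)).measure_ball_pos hμ z₀ (by positivity) le_rfl).ne'
  have hu1 : ν Set.univ ≠ ∞ := by
    rw [← huniv]; exact ((hreg (D + 1)).measure_ball_lt_top hμ z₀ (by positivity) le_rfl).ne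
  have hintu : IntegrableOn f Set.univ ν := by rw [← huniv]; exact hint z₀ _
  set c := ⨍ z in Set.univ, f z ∂ν with hc
  have havg : ∀ j, D < W.radius j → W.avg ν f j = c := by
    intro j hj
    rw [avg, hball _ _ hj]
  obtain ⟨C, hC, h⟩ := W.exists_besovOsc_homExt_le hμ hθ hregR (α := α) hp
  have hseq := seqFin_oscSeq hregR hμ hθ hα hp hq hf
  have hosc : ∃ t, D < t ∧ besovOsc ν p f t < ∞ := by
    obtain ⟨B, hB, hle⟩ := hseq.exists_le hp hq
    obtain ⟨i, hi⟩ := exists_mem_Ico_zpow (show 0 < D + 1 by positivity) (one_lt_two (α := ℝ))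
    have hi' := hi.2
    rw [zpow_add_one₀ two_ne_zero] at hi'
    refine ⟨60 * 2 ^ i, by linarith, ?_⟩
    rw [besovOsc_eq_oscSeq (α := α) (R₀ := ENNReal.ofReal R) (by
      refine ENNReal.ofReal_le_ofReal ?_
      rw [zpow_add_one₀ two_ne_zero]
      linarith [hi.1])]
    exact ENNReal.mul_lt_top ENNReal.ofReal_lt_top ((hle i).trans_lt hB.lt_top)
  -- At a scale above the diameter the inner mean runs over all of `∂Ω`, and by Jensen it dominates
  -- `|f(z) - c|^p`. So finite energy alone gives this, without `f` in `L^p`.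
  have hfc : ∫⁻ z, ‖f z - c‖ₑ ^ p ∂ν < ∞ := by
    obtain ⟨t, ht, hosct⟩ := hosc
    refine lt_of_le_of_lt (lintegral_mono fun z => ?_) hosct
    rw [hball z t ht, setLAverage_eq, ENNReal.le_div_iff_mul_le (Or.inl hu0) (Or.inl hu1),
      enorm_sub_rev]
    exact enorm_setAverage_sub_rpow_le hp hu0 hu1 hintu (f z)
  have huc : ∫⁻ x, ‖W.homExt ν f x - c‖ₑ ^ p ∂μ < ∞ := by
    obtain ⟨C', hC', h'⟩ := W.exists_lintegral_homExt_sub_le hμ hθ (hreg (D + 1)) hp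
    have := h' f c (D + 1) Set.univ Set.univ (fun j => hint _ _) MeasurableSet.univ
      MeasurableSet.univ (by positivity) le_rfl fun j x _ _ => by
        rcases lt_or_ge D (W.radius j) with hj | hj
        · exact Or.inl (havg j hj)
        · exact Or.inr ⟨by linarith, subset_univ _⟩
    rw [Measure.restrict_univ, Measure.restrict_univ] at this
    exact this.trans_lt (ENNReal.mul_lt_top (by finiteness) hfc)
  have hlayer : ∀ i : ℤ, ¬ ENNReal.ofReal (60 * 2 ^ (i + 1)) ≤ ENNReal.ofReal R →
      W.layerEnergy μ (W.avg ν f) p i = 0 := by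
    intro i hi
    rw [ENNReal.ofReal_le_ofReal_iff (by positivity), not_le, zpow_add_one₀ two_ne_zero] at hi
    classical
    rw [layerEnergy, ENNReal.tsum_eq_zero]
    intro j
    rw [ENNReal.tsum_eq_zero]
    intro k
    split_ifs with hjk
    swap
    · rfl
    obtain ⟨rfl, x, hj, hk⟩ := hjk
    have h1 := W.level_lt j
    rw [zpow_sub_one₀ two_ne_zero] at h1
    have h2 := W.bdryDist_bounds hj
    have h3 := W.bdryDist_bounds hk
    rw [havg j (by linarith), havg k (by linarith), sub_self, enorm_zero,
      ENNReal.zero_rpow_of_pos hp0, mul_zero]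
  obtain ⟨C'', hC'', hLp⟩ := hμ.exists_besovOsc_le_lintegral hp
  set L := C'' * ∫⁻ x, ‖W.homExt ν f x - c‖ₑ ^ p ∂μ with hL
  have hLtop : L ≠ ∞ := ENNReal.mul_ne_top hC'' huc.ne
  have hs0 : 0 < α + θ / p := by positivity
  have hκ := ofReal_two_rpow_neg_lt_one (x := p - (α + θ / p) * p) (by nlinarith)
  have hκ' := ofReal_two_rpow_neg_lt_one (x := (α + θ / p) * p) (by positivity)
  have hmeas : Measurable (W.homExt ν f) := (W.continuous_synth _).measurable
  rw [besovEnergy_eq_energyOf]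
  refine energyOf_lt_top_of_seqFin hp hq (by positivity)
    (((hseq.hardy hp hq hκ).of_le_mul hp hC fun _ => le_rfl).add hp
      ((SeqFin.geometric hp hq hκ').of_le_mul hp hLtop fun _ => le_rfl)) fun k t ht => ?_
  have ht0 : 0 < t := lt_of_lt_of_le (by positivity) ht.1
  rcases lt_or_ge k 0 with hk | hk
  · refine (h f (fun j => hint _ _) hlayer k (ENNReal.ofReal_le_ofReal ?_) t ht).trans ?_
    · have : (2 : ℝ) ^ (k + 2) ≤ 2 ^ (1 : ℤ) := zpow_le_zpow_right₀ one_le_two (by omega)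
      norm_num at this
      linarith
    · gcongr
      exact le_self_add
  · calc besovOsc μ p (W.homExt ν f) t ≤ L := hLp _ c t hmeas ht0
      _ = ENNReal.ofReal (((2 : ℝ) ^ k) ^ ((α + θ / p) * p)) *
          (L * ENNReal.ofReal (2 ^ (-((α + θ / p) * p))) ^ k.natAbs) := by
          rw [mul_left_comm, ofReal_zpow_rpow_mul_pow_natAbs hk, mul_one]
      _ ≤ _ := by
          gcongr
          exact le_add_self

/-- Almost every boundary point is a Lebesgue point of order `p` along dyadic balls. -/
lemma ae_tendsto_setLAverage_of_energy (hμ : IsDoubling μ) (hθ : 0 < θ)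
    (hreg : ∀ R : ℝ, RegularUpTo μ ν θ (ENNReal.ofReal R)) (hα : 0 < α) (hp : 1 ≤ p)
    (hq : 1 ≤ q) {f : Boundary Ω → ℝ} (hfm : LocallyIntegrable f ν)
    (hf : besovEnergy ν α p q f < ∞) :
    ∀ᵐ z ∂ν, Tendsto (fun n : ℕ => ⨍⁻ y in Metric.ball z (60 * (1 / 2) ^ n),
      ‖f y - f z‖ₑ ^ p ∂ν) atTop (𝓝 0) := by
  have hp0 : 0 < p := one_pos.trans_le hp
  have := hμ.properSpace_completion
  have hlf : IsLocallyFiniteMeasure ν := ⟨fun z => ⟨_, Metric.ball_mem_nhds z one_pos,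
    (hreg 1).measure_ball_lt_top hμ z one_pos le_rfl⟩⟩
  have hfa : AEStronglyMeasurable f ν := hfm.aestronglyMeasurable
  have hm : ∀ t : ℝ, AEMeasurable (fun z => ⨍⁻ y in Metric.ball z t, ‖f y - f z‖ₑ ^ p ∂ν) ν := by
    intro t
    have hset : MeasurableSet {w : Boundary Ω × Boundary Ω | dist w.2 w.1 < t} :=
      (isOpen_lt (continuous_snd.dist continuous_fst) continuous_const).measurableSet
    have h1 : AEMeasurable (fun w : Boundary Ω × Boundary Ω => ‖f w.2 - f w.1‖ₑ ^ p)
        (ν.prod ν) :=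
      ((hfa.comp_snd (μ := ν)).sub (hfa.comp_fst (ν := ν))).enorm.pow_const p
    have h2 := (h1.indicator hset).lintegral_prod_right'
    simp_rw [setLAverage_eq]
    refine AEMeasurable.div (h2.congr (ae_of_all _ fun z => ?_))
      (measurable_measure_ball ν t).aemeasurable
    simp only
    rw [← lintegral_indicator Metric.isOpen_ball.measurableSet]
    rfl
  obtain ⟨B, hB, hle⟩ := (seqFin_oscSeq (hreg 120) hμ hθ hα hp hq hf).exists_le hp hq
  have hosc : ∀ n : ℕ, besovOsc ν p f (60 * (1 / 2) ^ n) ≤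
      ENNReal.ofReal (2 ^ (-(α * p))) ^ n * B := by
    intro n
    have e1 : (1 / 2 : ℝ) ^ n = 2 ^ (-(n : ℤ)) := by simp
    have e2 : (2 : ℝ) ^ (-(n : ℤ) + 1) ≤ 2 ^ (1 : ℤ) := zpow_le_zpow_right₀ one_le_two (by omega)
    rw [zpow_one] at e2
    rw [e1, besovOsc_eq_oscSeq (α := α) (R₀ := ENNReal.ofReal 120)
      (ENNReal.ofReal_le_ofReal (by linarith)), ← ENNReal.ofReal_pow (by positivity)]
    have e3 : ((2 : ℝ) ^ (-(n : ℤ))) ^ (α * p) = (2 ^ (-(α * p))) ^ n := by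
      rw [← Real.rpow_intCast, ← Real.rpow_natCast, ← Real.rpow_mul two_pos.le,
        ← Real.rpow_mul two_pos.le]
      congr 1
      push_cast
      ring
    rw [e3]
    gcongr
    exact hle _
  -- The integrals of the dyadic means decay like `2^(-αpn)`, so the series of means is finite
  -- almost everywhere and its terms tend to zero; no differentiation theorem is involved.
  have hsum : ∫⁻ z, ∑' n : ℕ, ⨍⁻ y in Metric.ball z (60 * (1 / 2) ^ n),
      ‖f y - f z‖ₑ ^ p ∂ν ∂ν ≠ ∞ := by
    rw [lintegral_tsum fun n => hm _]
    refine ((ENNReal.tsum_le_tsum hosc).trans_lt ?_).ne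
    rw [ENNReal.tsum_mul_right]
    exact ENNReal.mul_lt_top (tsum_geometric_lt_top.2
      (ofReal_two_rpow_neg_lt_one (by positivity))) hB.lt_top
  filter_upwards [ae_lt_top' (AEMeasurable.tsum fun n => hm _) hsum] with z hz
  exact ENNReal.tendsto_atTop_zero_of_tsum_ne_top hz.ne

/-- The homogeneous extension has the original function as a trace. -/
lemma hasTrace_homExt (hμ : IsDoubling μ) (hθ : 0 < θ)
    (hreg : ∀ R : ℝ, RegularUpTo μ ν θ (ENNReal.ofReal R)) (hα : 0 < α) (hp : 1 ≤ p)
    (hq : 1 ≤ q) {f : Boundary Ω → ℝ} (hfm : LocallyIntegrable f ν)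
    (hint : ∀ j, IntegrableOn f (Metric.ball (W.closest j) (W.radius j)) ν)
    (hf : besovEnergy ν α p q f < ∞) : HasTrace μ ν p (W.homExt ν f) f := by
  have hreg60 := hreg 60
  obtain ⟨C₁, hC₁, h₁⟩ := W.exists_lintegral_homExt_sub_le hμ hθ hreg60 hp
  obtain ⟨C₂, hC₂, h₂⟩ := hreg60.exists_ball_le hμ hθ 120
  obtain ⟨C₃, hC₃, h₃⟩ := id hreg60
  set K := C₁ * C₃ * C₂ with hK
  have hKtop : K ≠ ∞ := by finiteness
  filter_upwards [ae_tendsto_setLAverage_of_energy hμ hθ hreg hα hp hq hfm hf] with z hz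
  -- A ball active at a point of `B(z, r)` has `6 r_j < r`, so its `U_j` lies in `B(z, 3r)`. The
  -- powers `r^θ` from the integral and `r^(-θ)` from the normalisation cancel.
  have hbound : ∀ (n : ℕ) (r : ℝ), (1 / 2 : ℝ) ^ (n + 1) < r → r ≤ (1 / 2) ^ n →
      ⨍⁻ x in trBall z r, ‖W.homExt ν f x - f z‖ₑ ^ p ∂μ ≤
      K * ⨍⁻ y in Metric.ball z (60 * (1 / 2) ^ n), ‖f y - f z‖ₑ ^ p ∂ν := by
    intro n r hr hr'
    have hr0 : 0 < r := lt_trans (by positivity) hr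
    have hn1 : (1 / 2 : ℝ) ^ n ≤ 1 := pow_le_one₀ (by norm_num) (by norm_num)
    set ρ : ℝ := 60 * (1 / 2) ^ n with hρ
    have hrρ : 3 * r ≤ ρ := by linarith
    have hρr : ρ ≤ 120 * r := by rw [pow_succ] at hr; linarith
    have hρR : ENNReal.ofReal ρ ≤ ENNReal.ofReal 60 := ENNReal.ofReal_le_ofReal (by linarith)
    have hrR : ENNReal.ofReal r ≤ ENNReal.ofReal 60 := ENNReal.ofReal_le_ofReal (by linarith)
    have e1 := h₁ f (f z) r (tracedBall (z : Completion Ω) r) (Metric.ball z (3 * r)) hint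
      (isOpen_tracedBall _ _).measurableSet Metric.isOpen_ball.measurableSet hr0 hrR
      fun j x hx hxj => by
        have hb := (W.bdryDist_bounds hxj).1
        have hd := bdryDist_le_dist x z
        have hx' : dist (x : Completion Ω) z < r := hx
        refine Or.inr ⟨by linarith [W.radius_pos j], fun a ha => ?_⟩
        have h5 := W.dist_closest_le hxj
        rw [Metric.mem_ball, Subtype.dist_eq] at ha ⊢
        rw [dist_comm] at h5
        have := dist_triangle4 (a : Completion Ω) (W.closest j) x z
        linarith
    have e2 : (μ (tracedBall (z : Completion Ω) r))⁻¹ ≤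
        C₃ * ENNReal.ofReal (r ^ (-θ)) * (ν (Metric.ball z r))⁻¹ :=
      ENNReal.inv_le_mul_inv (hreg60.measure_ball_pos hμ z hr0 hrR).ne'
        (hreg60.measure_ball_lt_top hμ z hr0 hrR).ne (h₃ z r hr0 hrR).2
    have e3 : (ν (Metric.ball z r))⁻¹ ≤ C₂ * (ν (Metric.ball z ρ))⁻¹ :=
      ENNReal.inv_le_mul_inv (hreg60.measure_ball_pos hμ z (by linarith) hρR).ne'
        (hreg60.measure_ball_lt_top hμ z (by linarith) hρR).ne
        (h₂ z z ρ r hr0 (by linarith) (by rw [dist_self]; linarith) hρR)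
    have e4 : ENNReal.ofReal (r ^ θ) * ENNReal.ofReal (r ^ (-θ)) = 1 := by
      rw [← ENNReal.ofReal_mul (by positivity), ← Real.rpow_add hr0]
      simp
    rw [trBall_eq_tracedBall, setLAverage_eq, setLAverage_eq, div_eq_mul_inv, div_eq_mul_inv]
    calc _ ≤ (C₁ * ENNReal.ofReal (r ^ θ) * ∫⁻ y in Metric.ball z ρ, ‖f y - f z‖ₑ ^ p ∂ν) *
          (C₃ * ENNReal.ofReal (r ^ (-θ)) * (C₂ * (ν (Metric.ball z ρ))⁻¹)) := by
          gcongr ?_ * ?_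
          · refine e1.trans ?_
            gcongr
          · refine e2.trans ?_
            gcongr
      _ = K * (ENNReal.ofReal (r ^ θ) * ENNReal.ofReal (r ^ (-θ))) *
          ((∫⁻ y in Metric.ball z ρ, ‖f y - f z‖ₑ ^ p ∂ν) * (ν (Metric.ball z ρ))⁻¹) := by
          rw [hK]; ring
      _ = _ := by rw [e4, mul_one]
  have hz' : Tendsto (fun n : ℕ => K * ⨍⁻ y in Metric.ball z (60 * (1 / 2) ^ n),
      ‖f y - f z‖ₑ ^ p ∂ν) atTop (𝓝 0) := by
    simpa using ENNReal.Tendsto.const_mul hz (Or.inr hKtop)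
  rw [ENNReal.tendsto_nhds_zero] at hz' ⊢
  intro ε hε
  obtain ⟨N, hN⟩ := eventually_atTop.1 (hz' ε hε)
  filter_upwards [Ioo_mem_nhdsGT (show (0 : ℝ) < (1 / 2) ^ N by positivity)] with r hr
  have hr1 : r ≤ 1 := hr.2.le.trans (pow_le_one₀ (by norm_num) (by norm_num))
  obtain ⟨n, hn1, hn2⟩ := exists_nat_pow_near_of_lt_one hr.1 hr1
    (show (0 : ℝ) < 1 / 2 by norm_num) (by norm_num)
  refine (hbound n r hn1 hn2).trans (hN n ?_)
  by_contra! hlt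
  have : (1 / 2 : ℝ) ^ N ≤ (1 / 2) ^ (n + 1) :=
    pow_le_pow_of_le_one (by norm_num) (by norm_num) hlt
  linarith [hr.2]

/-- The homogeneous extension of an `L^p` function is `p`-integrable near the boundary. -/
lemma lintegral_homExt_lt_top (hμ : IsDoubling μ) (hθ : 0 < θ)
    (hreg : ∀ R : ℝ, RegularUpTo μ ν θ (ENNReal.ofReal R)) (hp : 1 ≤ p) {f : Boundary Ω → ℝ}
    (hint : ∀ j, IntegrableOn f (Metric.ball (W.closest j) (W.radius j)) ν)
    (hf : MemLp f (ENNReal.ofReal p) ν) :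
    ∫⁻ x in {x | bdryDist x < 4}, ‖W.homExt ν f x‖ₑ ^ p ∂μ < ∞ := by
  have hp0 : 0 < p := one_pos.trans_le hp
  obtain ⟨C, hC, h⟩ := W.exists_lintegral_homExt_sub_le hμ hθ (hreg 1) hp
  -- On the strip of width `4` active balls have `6 r_j < 4`, so `τ = 1` is admissible.
  have h1 := h f 0 1 {x | bdryDist x < 4} Set.univ hint (isOpen_bdryDist_lt 4).measurableSet
    MeasurableSet.univ one_pos le_rfl fun j x hx hxj => by
      have h2 := (W.bdryDist_bounds hxj).1
      have hx : bdryDist x < 4 := hx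
      exact Or.inr ⟨by linarith, subset_univ _⟩
  simp only [sub_zero, Measure.restrict_univ] at h1
  refine h1.trans_lt (ENNReal.mul_lt_top (by finiteness) ?_)
  have h3 := lintegral_rpow_enorm_lt_top_of_eLpNorm_lt_top (by simpa using hp0)
    ENNReal.ofReal_ne_top hf.2
  rwa [ENNReal.toReal_ofReal hp0.le] at h3

end WhitneyData

end HomogeneousExtension

/-! ### Traces as limits of mean values, and their uniqueness. -/

section Traces

variable {Ω : Type*} [MetricSpace Ω] [MeasurableSpace Ω] [BorelSpace Ω] {μ : Measure Ω}
  {ν : Measure (Boundary Ω)} {p : ℝ}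

lemma IsDoubling.integrableOn_trBall (hμ : IsDoubling μ) (hp : 1 ≤ p) {u : Ω → ℝ}
    (hu : Continuous u) {z : Boundary Ω} {c r : ℝ} (hr : 0 < r)
    (h : ⨍⁻ x in trBall z r, ‖u x - c‖ₑ ^ p ∂μ < ∞) : IntegrableOn u (trBall z r) μ := by
  have hp0 : 0 < p := one_pos.trans_le hp
  have := hμ.secondCountableTopology
  have h0 := (hμ.measure_tracedBall_pos (z : Completion Ω) hr).ne'
  have h1 := hμ.measure_tracedBall_lt_top (z : Completion Ω) r
  rw [← trBall_eq_tracedBall] at h0 h1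
  have : IsFiniteMeasure (μ.restrict (trBall z r)) := ⟨by simpa using h1⟩
  rw [setLAverage_eq] at h
  have h2 : ∫⁻ x in trBall z r, ‖u x - c‖ₑ ^ p ∂μ < ∞ := by
    by_contra hcon
    rw [not_lt, top_le_iff] at hcon
    rw [hcon, ENNReal.top_div_of_ne_top h1.ne] at h
    exact lt_irrefl _ h
  have h3 : MemLp (fun x => u x - c) (ENNReal.ofReal p) (μ.restrict (trBall z r)) := by
    refine ⟨(hu.sub continuous_const).aestronglyMeasurable, ?_⟩
    rw [eLpNorm_lt_top_iff_lintegral_rpow_enorm_lt_top (by simpa using hp0)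
      ENNReal.ofReal_ne_top, ENNReal.toReal_ofReal hp0.le]
    exact h2
  have h4 := (h3.integrable (by simpa using hp)).add (integrable_const c)
  exact h4.congr (ae_of_all _ fun x => by simp)

/-- Traces are limits of mean values. -/
lemma IsDoubling.tendsto_setAverage_of_tendsto (hμ : IsDoubling μ) (hp : 1 ≤ p) {u : Ω → ℝ}
    (hu : Continuous u) {z : Boundary Ω} {c : ℝ}
    (h : Tendsto (fun r : ℝ => ⨍⁻ x in trBall z r, ‖u x - c‖ₑ ^ p ∂μ) (𝓝[>] 0) (𝓝 0)) :
    Tendsto (fun r : ℝ => ⨍ x in trBall z r, u x ∂μ) (𝓝[>] 0) (𝓝 c) := by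
  have hp0 : 0 < p := one_pos.trans_le hp
  rw [tendsto_iff_edist_tendsto_0]
  have h1 : Tendsto (fun r : ℝ => (⨍⁻ x in trBall z r, ‖u x - c‖ₑ ^ p ∂μ) ^ p⁻¹)
      (𝓝[>] 0) (𝓝 0) := by
    have := (ENNReal.continuous_rpow_const (y := p⁻¹)).continuousAt.tendsto.comp h
    rwa [ENNReal.zero_rpow_of_pos (by positivity)] at this
  refine tendsto_of_tendsto_of_tendsto_of_le_of_le' tendsto_const_nhds h1
    (Eventually.of_forall fun _ => zero_le) ?_
  -- Finiteness of the mean makes `u` integrable on the ball for small `r`, so that the Bochner mean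
  -- is a genuine one and Jensen applies.
  filter_upwards [self_mem_nhdsWithin, h.eventually_lt_const ENNReal.zero_lt_top] with r hr hlt
  have h0 := (hμ.measure_tracedBall_pos (z : Completion Ω) hr).ne'
  have h1 := (hμ.measure_tracedBall_lt_top (z : Completion Ω) r).ne
  rw [← trBall_eq_tracedBall] at h0 h1
  rw [edist_eq_enorm_sub, ENNReal.le_rpow_inv_iff hp0, setLAverage_eq,
    ENNReal.le_div_iff_mul_le (Or.inl h0) (Or.inl h1)]
  exact enorm_setAverage_sub_rpow_le hp h0 h1 (hμ.integrableOn_trBall hp hu hr hlt) c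

lemma HasTrace.traceOp_ae_eq (hμ : IsDoubling μ) (hp : 1 ≤ p) {u : Ω → ℝ} (hu : Continuous u)
    {f : Boundary Ω → ℝ} (h : HasTrace μ ν p u f) : traceOp μ u =ᵐ[ν] f := by
  filter_upwards [h] with z hz
  exact (hμ.tendsto_setAverage_of_tendsto hp hu hz).limUnder_eq

lemma HasTrace.ae_eq (hμ : IsDoubling μ) (hp : 1 ≤ p) {u : Ω → ℝ} (hu : Continuous u)
    {f g : Boundary Ω → ℝ} (hf : HasTrace μ ν p u f) (hg : HasTrace μ ν p u g) : g =ᵐ[ν] f :=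
  (hg.traceOp_ae_eq hμ hp hu).symm.trans (hf.traceOp_ae_eq hμ hp hu)

end Traces

/-! ### The cutoff extension and the one-point boundary. -/

section

variable {Ω : Type*} [MetricSpace Ω] {ν : Measure (Boundary Ω)}

lemma HasTrace.congr_ae [MeasurableSpace Ω] {μ : Measure Ω} {p : ℝ} {u : Ω → ℝ}
    {f g : Boundary Ω → ℝ} (h : HasTrace μ ν p u f)
    (hfg : g =ᵐ[ν] f) : HasTrace μ ν p u g := by
  filter_upwards [h, hfg] with z hz hz'
  rwa [hz']

namespace WhitneyData

variable {ι : Type} (W : WhitneyData Ω ι)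

lemma continuous_homExt (f : Boundary Ω → ℝ) : Continuous (W.homExt ν f) :=
  W.continuous_synth _

lemma continuous_ext (f : Boundary Ω → ℝ) : Continuous (W.ext ν f) :=
  W.cutoff_lipschitz.continuous.mul (W.continuous_homExt f)

lemma ext_eq_zero {f : Boundary Ω → ℝ} {x : Ω} (hx : 2 < bdryDist x) : W.ext ν f x = 0 := by
  rw [ext, W.cutoff_eq_zero x hx, zero_mul]

lemma enorm_cutoff_le_one (x : Ω) : ‖W.cutoff x‖ₑ ≤ 1 := by
  rw [Real.enorm_of_nonneg (W.cutoff_nonneg x), ENNReal.ofReal_le_one]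
  exact W.cutoff_le_one x

/-- Product rule with the `1`-Lipschitz cutoff. If `d(x, ∂Ω) ≥ 4`, points within distance one have
`d > 2` as well, so both values vanish; hence the strip of width `4`. -/
lemma enorm_ext_sub_ext_le {f : Boundary Ω → ℝ} {x y : Ω} {t : ℝ} (ht : t < 1)
    (hxy : dist x y < t) : ‖W.ext ν f y - W.ext ν f x‖ₑ ≤ ‖W.homExt ν f y - W.homExt ν f x‖ₑ +
      {x | bdryDist x < 4}.indicator (fun x => ENNReal.ofReal t * ‖W.homExt ν f x‖ₑ) x := by
  by_cases hx : bdryDist x < 4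
  · rw [indicator_of_mem (show x ∈ {x : Ω | bdryDist x < 4} from hx)]
    have e1 : W.ext ν f y - W.ext ν f x = W.cutoff y * (W.homExt ν f y - W.homExt ν f x) +
        (W.cutoff y - W.cutoff x) * W.homExt ν f x := by
      simp only [ext]; ring
    rw [e1]
    refine (enorm_add_le _ _).trans (add_le_add ?_ ?_)
    · rw [enorm_mul]
      exact mul_le_of_le_one_left' (W.enorm_cutoff_le_one y)
    · rw [enorm_mul]
      gcongr
      have h1 := W.cutoff_lipschitz.dist_le_mul y x
      rw [NNReal.coe_one, one_mul, Real.dist_eq, dist_comm] at h1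
      rw [Real.enorm_eq_ofReal_abs]
      exact ENNReal.ofReal_le_ofReal (h1.trans hxy.le)
  · have h1 := bdryDist_lipschitz x y
    rw [W.ext_eq_zero (by linarith), W.ext_eq_zero (by linarith), sub_self, enorm_zero]
    exact zero_le

/-- When the boundary is a single point, the homogeneous extension is constant. -/
lemma exists_homExt_eq_const (hne : Nonempty (Boundary Ω)) [Subsingleton (Boundary Ω)]
    {f : Boundary Ω → ℝ} (hf : LocallyIntegrable f ν) :
    ∃ c : ℝ, (∀ x, W.homExt ν f x = c) ∧ f =ᵐ[ν] fun _ => c := by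
  obtain ⟨z₀⟩ := hne
  have hball : ∀ j, Metric.ball (W.closest j) (W.radius j) = Set.univ := fun j =>
    eq_univ_of_forall fun w => by
      rw [Subsingleton.elim w (W.closest j)]
      exact Metric.mem_ball_self (W.radius_pos j)
  refine ⟨⨍ z in Set.univ, f z ∂ν, fun x => ?_, ?_⟩
  · have : W.avg ν f = fun _ => ⨍ z in Set.univ, f z ∂ν := funext fun j => by rw [avg, hball]
    rw [homExt_eq_synth, this, synth, tsum_mul_left, (W.pou_sum x).tsum_eq, mul_one]
  obtain ⟨c, rfl⟩ : ∃ c, f = fun _ => c :=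
    ⟨f z₀, funext fun z => by rw [Subsingleton.elim z z₀]⟩
  by_cases h0 : ν Set.univ = 0
  · rw [Measure.measure_univ_eq_zero.1 h0, Filter.EventuallyEq, ae_zero]
    exact Filter.eventually_bot
  -- Regularity says nothing about a one-point boundary, so its mass may be infinite. Local
  -- integrability then forces the value `c = 0`, which is also the mean in that case.
  by_cases h1 : ν Set.univ = ∞
  · obtain ⟨s, hs, hint⟩ := hf z₀
    have hs' : s = Set.univ := eq_univ_of_forall fun w => by
      rw [Subsingleton.elim w z₀]; exact mem_of_mem_nhds hs
    rw [hs', integrableOn_const_iff] at hint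
    obtain rfl : c = 0 := by
      rcases hint with h | h
      · simpa using h
      · exact absurd h (by simp [h1])
    simp
  · rw [setAverage_const h0 h1]

end WhitneyData

end

/-! ### Energy and integrability after multiplication by the cutoff. -/

section InhomogeneousExtension

variable {Ω : Type*} [MetricSpace Ω] [MeasurableSpace Ω] [BorelSpace Ω] {μ : Measure Ω}
  {ν : Measure (Boundary Ω)} {θ α p s : ℝ} {q : ℝ≥0∞}

/-- `t ↦ min(t, 1)^p` has finite Besov energy. -/
lemma energyOf_truncated_rpow_lt_top (hs0 : 0 < s) (hs1 : s < 1) (hp : 1 ≤ p) (hq : 1 ≤ q)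
    {L : ℝ≥0∞} (hL : L ≠ ∞) :
    energyOf s p q (fun t => if t < 1 then ENNReal.ofReal (t ^ p) * L else L) < ∞ := by
  have hp0 : 0 < p := one_pos.trans_le hp
  have hκ := ofReal_two_rpow_neg_lt_one (x := p - s * p) (by nlinarith)
  have hκ' := ofReal_two_rpow_neg_lt_one (x := s * p) (by positivity)
  have h2p : (1 : ℝ≥0∞) ≤ ENNReal.ofReal (2 ^ p) := by
    rw [ENNReal.one_le_ofReal]
    exact Real.one_le_rpow one_le_two hp0.le
  -- The two geometric sequences handle the two ends: `s < 1` gives decay as `k → -∞`, where the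
  -- function is `t^p L`, and `s > 0` gives decay as `k → ∞`, where it is constant.
  refine energyOf_lt_top_of_seqFin hp hq hs0
    (((SeqFin.geometric hp hq hκ).of_le_mul (C := ENNReal.ofReal (2 ^ p) * L) hp
      (by finiteness) fun _ => le_rfl).add hp
      ((SeqFin.geometric hp hq hκ').of_le_mul (C := L) hp hL fun _ => le_rfl)) fun k t ht => ?_
  have h2k : (0 : ℝ) < 2 ^ k := by positivity
  have ht0 : 0 < t := h2k.trans_le ht.1
  rcases lt_or_ge k 0 with hk | hk
  · have ht1 : t < 1 := by
      refine ht.2.trans_le ?_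
      have : (2 : ℝ) ^ (k + 1) ≤ 2 ^ (0 : ℤ) := zpow_le_zpow_right₀ one_le_two (by omega)
      simpa using this
    rw [if_pos ht1]
    calc ENNReal.ofReal (t ^ p) * L ≤ ENNReal.ofReal ((2 * 2 ^ k) ^ p) * L := by
          gcongr
          have := ht.2.le
          rw [zpow_add_one₀ two_ne_zero] at this
          linarith
      _ = ENNReal.ofReal (((2 : ℝ) ^ k) ^ (s * p)) *
          (ENNReal.ofReal (2 ^ p) * L * ENNReal.ofReal (2 ^ (-(p - s * p))) ^ k.natAbs) := by
          obtain ⟨n, hn⟩ := Int.eq_ofNat_of_zero_le (neg_nonneg.2 hk.le)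
          have hk' : k = -(n : ℤ) := by omega
          have e1 : ((2 : ℝ) ^ k) ^ (p - s * p) = (2 ^ (-(p - s * p))) ^ n := by
            rw [hk', ← Real.rpow_intCast, ← Real.rpow_natCast, ← Real.rpow_mul two_pos.le,
              ← Real.rpow_mul two_pos.le]
            congr 1
            push_cast
            ring
          have e2 : k.natAbs = n := by omega
          have e3 : (2 * (2 : ℝ) ^ k) ^ p =
              ((2 : ℝ) ^ k) ^ (s * p) * (2 ^ p * (2 ^ (-(p - s * p))) ^ n) := by
            rw [← e1, Real.mul_rpow two_pos.le h2k.le, mul_left_comm, ← Real.rpow_add h2k]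
            congr 2
            ring
          rw [e3, e2, ENNReal.ofReal_mul (by positivity), ENNReal.ofReal_mul (by positivity),
            ENNReal.ofReal_pow (by positivity)]
          ring
      _ ≤ _ := by
          gcongr
          exact le_self_add
  · have ht1 : ¬ t < 1 := by
      rw [not_lt]
      refine le_trans ?_ ht.1
      have : (2 : ℝ) ^ (0 : ℤ) ≤ 2 ^ k := zpow_le_zpow_right₀ one_le_two hk
      simpa using this
    rw [if_neg ht1]
    calc L = ENNReal.ofReal (((2 : ℝ) ^ k) ^ (s * p)) *
          (L * ENNReal.ofReal (2 ^ (-(s * p))) ^ k.natAbs) := by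
          rw [mul_left_comm, ofReal_zpow_rpow_mul_pow_natAbs hk, mul_one]
      _ ≤ _ := by
          gcongr
          exact le_add_self

namespace WhitneyData

variable {ι : Type} (W : WhitneyData Ω ι)

/-- For `r < 1` the cutoff equals one on `B(z, r) ∩ Ω`, so the means coincide for small `r`. -/
lemma hasTrace_ext {f : Boundary Ω → ℝ} (h : HasTrace μ ν p (W.homExt ν f) f) :
    HasTrace μ ν p (W.ext ν f) f := by
  filter_upwards [h] with z hz
  refine hz.congr' ?_
  filter_upwards [Ioo_mem_nhdsGT one_pos] with r hr
  rw [setLAverage_eq, setLAverage_eq]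
  congr 1
  refine setLIntegral_congr_fun (isOpen_tracedBall (z : Completion Ω) r).measurableSet
    fun x hx => ?_
  have hx' : dist (x : Completion Ω) z < r := hx
  simp only [ext]
  rw [W.cutoff_eq_one x (by linarith [bdryDist_le_dist x z, hr.2]), one_mul]

lemma lintegral_ext_le (hp : 1 ≤ p) (f : Boundary Ω → ℝ) :
    ∫⁻ x, ‖W.ext ν f x‖ₑ ^ p ∂μ ≤
      ∫⁻ x in {x | bdryDist x < 4}, ‖W.homExt ν f x‖ₑ ^ p ∂μ := by
  have hp0 : 0 < p := one_pos.trans_le hp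
  rw [← lintegral_indicator (isOpen_bdryDist_lt 4).measurableSet]
  refine lintegral_mono fun x => ?_
  by_cases hx : bdryDist x < 4
  · rw [indicator_of_mem (show x ∈ {x : Ω | bdryDist x < 4} from hx), ext, enorm_mul]
    gcongr
    exact mul_le_of_le_one_left' (W.enorm_cutoff_le_one x)
  · rw [W.ext_eq_zero (by linarith), enorm_zero, ENNReal.zero_rpow_of_pos hp0]
    exact zero_le

lemma memLp_ext (hμ : IsDoubling μ) (hp : 1 ≤ p) {f : Boundary Ω → ℝ}
    (hL : ∫⁻ x in {x | bdryDist x < 4}, ‖W.homExt ν f x‖ₑ ^ p ∂μ < ∞) :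
    MemLp (W.ext ν f) (ENNReal.ofReal p) μ := by
  have hp0 : 0 < p := one_pos.trans_le hp
  have := hμ.secondCountableTopology
  refine ⟨(W.continuous_ext f).aestronglyMeasurable, ?_⟩
  rw [eLpNorm_lt_top_iff_lintegral_rpow_enorm_lt_top (by simpa using hp0)
    ENNReal.ofReal_ne_top, ENNReal.toReal_ofReal hp0.le]
  exact (W.lintegral_ext_le hp f).trans_lt hL

lemma besovOsc_ext_le (hμ : IsDoubling μ) (hp : 1 ≤ p) (f : Boundary Ω → ℝ) {t : ℝ}
    (ht0 : 0 < t) (ht : t < 1) : besovOsc μ p (W.ext ν f) t ≤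
      2 ^ p * (besovOsc μ p (W.homExt ν f) t + ENNReal.ofReal (t ^ p) *
        ∫⁻ x in {x | bdryDist x < 4}, ‖W.homExt ν f x‖ₑ ^ p ∂μ) := by
  have hp0 : 0 < p := one_pos.trans_le hp
  have h2p : (2 : ℝ≥0∞) ^ p ≠ ∞ := ENNReal.rpow_ne_top_of_nonneg hp0.le ENNReal.ofNat_ne_top
  have hu := (W.continuous_homExt (ν := ν) f).measurable
  have hEm := (isOpen_bdryDist_lt (Ω := Ω) 4).measurableSet
  set v : Ω → ℝ≥0∞ := {x | bdryDist x < 4}.indicator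
    (fun x => ENNReal.ofReal (t ^ p) * ‖W.homExt ν f x‖ₑ ^ p) with hv
  have hvm : Measurable v := by
    refine Measurable.indicator ?_ hEm
    fun_prop
  have hpt : ∀ x, ⨍⁻ y in Metric.ball x t, ‖W.ext ν f y - W.ext ν f x‖ₑ ^ p ∂μ ≤
      2 ^ p * (⨍⁻ y in Metric.ball x t, ‖W.homExt ν f y - W.homExt ν f x‖ₑ ^ p ∂μ + v x) := by
    intro x
    have h0 := (hμ.measure_ball_pos x ht0).ne'
    have h1 := (hμ.measure_ball_lt_top x ht0).ne
    rw [setLAverage_eq, setLAverage_eq, div_eq_mul_inv, div_eq_mul_inv]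
    calc _ ≤ (∫⁻ y in Metric.ball x t,
          2 ^ p * (‖W.homExt ν f y - W.homExt ν f x‖ₑ ^ p + v x) ∂μ) *
          (μ (Metric.ball x t))⁻¹ := by
          gcongr ?_ * _
          refine setLIntegral_mono' Metric.isOpen_ball.measurableSet fun y hy => ?_
          have hxy : dist x y < t := by rwa [dist_comm]
          have e1 : ({x | bdryDist x < 4}.indicator
              (fun x => ENNReal.ofReal t * ‖W.homExt ν f x‖ₑ) x) ^ p = v x := by
            by_cases hx : x ∈ {x : Ω | bdryDist x < 4}
            · rw [hv, indicator_of_mem hx, indicator_of_mem hx,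
                ENNReal.mul_rpow_of_nonneg _ _ hp0.le, ENNReal.ofReal_rpow_of_pos ht0]
            · rw [hv, indicator_of_notMem hx, indicator_of_notMem hx,
                ENNReal.zero_rpow_of_pos hp0]
          rw [← e1]
          refine le_trans ?_ (ENNReal.add_rpow_le_two_rpow hp0.le _ _)
          gcongr
          exact W.enorm_ext_sub_ext_le ht hxy
      _ = 2 ^ p * ((∫⁻ y in Metric.ball x t, ‖W.homExt ν f y - W.homExt ν f x‖ₑ ^ p ∂μ) *
          (μ (Metric.ball x t))⁻¹ + v x * (μ (Metric.ball x t) * (μ (Metric.ball x t))⁻¹)) := by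
          rw [lintegral_const_mul' _ _ h2p, lintegral_add_right _ measurable_const,
            setLIntegral_const]
          ring
      _ = _ := by rw [ENNReal.mul_inv_cancel h0 h1, mul_one]
  calc _ ≤ ∫⁻ x, 2 ^ p * (⨍⁻ y in Metric.ball x t,
        ‖W.homExt ν f y - W.homExt ν f x‖ₑ ^ p ∂μ + v x) ∂μ := lintegral_mono hpt
    _ = _ := by
      rw [lintegral_const_mul' _ _ h2p, lintegral_add_right _ hvm, hv, lintegral_indicator hEm,
        lintegral_const_mul' _ _ ENNReal.ofReal_ne_top]
      rfl

/-- For `t < 1` the product rule adds `t^p L` to the oscillation of `Ẽf`; for `t ≥ 1` the `L^p` norm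
of the extension bounds the oscillation. Both extra terms form the truncated power. -/
lemma energy_ext_lt_top (hμ : IsDoubling μ) (hs0 : 0 < s) (hs1 : s < 1) (hp : 1 ≤ p)
    (hq : 1 ≤ q) {f : Boundary Ω → ℝ} (hu : besovEnergy μ s p q (W.homExt ν f) < ∞)
    (hL : ∫⁻ x in {x | bdryDist x < 4}, ‖W.homExt ν f x‖ₑ ^ p ∂μ < ∞) :
    besovEnergy μ s p q (W.ext ν f) < ∞ := by
  have hp0 : 0 < p := one_pos.trans_le hp
  have h2p : (2 : ℝ≥0∞) ^ p ≠ ∞ := ENNReal.rpow_ne_top_of_nonneg hp0.le ENNReal.ofNat_ne_top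
  obtain ⟨C, hC, h⟩ := hμ.exists_besovOsc_le_lintegral hp
  set L := ∫⁻ x in {x | bdryDist x < 4}, ‖W.homExt ν f x‖ₑ ^ p ∂μ
  rw [besovEnergy_eq_energyOf] at hu ⊢
  refine energyOf_lt_top_of_le_add hp hq (C := 2 ^ p + C) (by finiteness) (fun t ht0 => ?_) ?_ hu
    (energyOf_truncated_rpow_lt_top hs0 hs1 hp hq hL.ne)
  · split_ifs with ht
    · refine (W.besovOsc_ext_le hμ hp f ht0 ht).trans ?_
      gcongr
      exact le_self_add
    · have h1 := h (W.ext ν f) 0 t (W.continuous_ext f).measurable ht0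
      simp only [sub_zero] at h1
      calc _ ≤ C * L := h1.trans (by gcongr; exact W.lintegral_ext_le hp f)
        _ ≤ _ := by
          gcongr
          · exact le_add_self
          · exact le_add_self
  · exact Measurable.ite measurableSet_Iio (by fun_prop) measurable_const

end WhitneyData

end InhomogeneousExtension

/-! ### Assembling the cases by the diameter of the boundary. -/

section Main

variable {Ω : Type*} [MetricSpace Ω] [MeasurableSpace Ω]
  {μ : Measure Ω} {ν : Measure (Boundary Ω)} {θ α p : ℝ} {q : ℝ≥0∞} {ι : Type}

namespace WhitneyData

variable (W : WhitneyData Ω ι)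

/-- A constant has zero oscillation. The strip is contained in the trace on `Ω` of a ball about the
unique boundary point, so it has finite measure and the constant is `p`-integrable there. -/
theorem homExt_spec_of_subsingleton (hΩ : ¬ CompleteSpace Ω) (hμ : IsDoubling μ)
    [Subsingleton (Boundary Ω)] (hp : 1 ≤ p) (hq : 1 ≤ q) (s : ℝ) {f : Boundary Ω → ℝ}
    (hf : LocallyIntegrable f ν) :
    besovEnergy μ s p q (W.homExt ν f) < ∞ ∧ HasTrace μ ν p (W.homExt ν f) f ∧
      ∫⁻ x in {x | bdryDist x < 4}, ‖W.homExt ν f x‖ₑ ^ p ∂μ < ∞ := by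
  have hp0 : 0 < p := one_pos.trans_le hp
  have hne : Nonempty (Boundary Ω) := (nonempty_boundarySet hΩ).to_subtype
  obtain ⟨c, hc, hfc⟩ := W.exists_homExt_eq_const hne hf
  obtain ⟨z₀⟩ := hne
  have hosc : besovOsc μ p (W.homExt ν f) = fun _ => 0 := by
    funext t
    simp [besovOsc, hc, ENNReal.zero_rpow_of_pos hp0]
  refine ⟨?_, ?_, ?_⟩
  · rw [besovEnergy_eq_energyOf, hosc]
    rcases eq_or_ne q ∞ with rfl | hq'
    · rw [energyOf_top]
      simp [ENNReal.zero_rpow_of_pos (inv_pos.2 hp0)]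
    · rw [energyOf_lt_top_iff hq hq']
      simp [ENNReal.zero_rpow_of_pos (div_pos (toReal_pos_of_one_le hq hq') hp0)]
  · filter_upwards [hfc] with z hz
    simp [hc, hz, ENNReal.zero_rpow_of_pos hp0]
  · simp only [hc]
    rw [setLIntegral_const]
    refine ENNReal.mul_lt_top (ENNReal.rpow_lt_top_of_nonneg hp0.le enorm_ne_top) ?_
    refine (measure_mono fun x hx => ?_).trans_lt
      (hμ.measure_tracedBall_lt_top (z₀ : Completion Ω) 4)
    have hx : Metric.infDist (x : Completion Ω) (boundarySet Ω) < 4 := hx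
    obtain ⟨w, hw, hxw⟩ := (Metric.infDist_lt_iff (nonempty_boundarySet hΩ)).1 hx
    have : w = z₀ := congrArg Subtype.val (Subsingleton.elim (⟨w, hw⟩ : Boundary Ω) z₀)
    rwa [this] at hxw

/-- Three cases: diameter zero, where the regularity condition is vacuous; infinite diameter, where
it holds at all radii; and finite positive diameter, where it extends to any bounded range of radii
with a constant depending on the range. -/
theorem homExt_spec [BorelSpace Ω] [LocallyCompactSpace Ω] [Countable ι] (hΩ : ¬ CompleteSpace Ω) (hμ : IsDoubling μ) (hθ : 0 < θ)
    (hν : IsCodimRegular μ ν θ) (hp : 1 ≤ p) (hq : 1 ≤ q) (hα : 0 < α) (hαθ : α + θ / p < 1)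
    {f : Boundary Ω → ℝ} (hf : MemHB ν α p q f) :
    besovEnergy μ (α + θ / p) p q (W.homExt ν f) < ∞ ∧ HasTrace μ ν p (W.homExt ν f) f ∧
      (MemLp f (ENNReal.ofReal p) ν →
        ∫⁻ x in {x | bdryDist x < 4}, ‖W.homExt ν f x‖ₑ ^ p ∂μ < ∞) := by
  obtain ⟨hfl, hfe⟩ := hf
  by_cases h0 : Metric.ediam (Set.univ : Set (Boundary Ω)) = 0
  · have : Subsingleton (Boundary Ω) := by
      rw [Metric.ediam_eq_zero_iff] at h0
      exact Set.subsingleton_univ_iff.1 h0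
    obtain ⟨h1, h2, h3⟩ := W.homExt_spec_of_subsingleton hΩ hμ hp hq (α + θ / p) hfl
    exact ⟨h1, h2, fun _ => h3⟩
  have hreg : ∀ R : ℝ, RegularUpTo μ ν θ (ENNReal.ofReal R) := fun R =>
    hν.regularUpTo hμ hθ h0 (Or.inl ENNReal.ofReal_ne_top)
  have hint := fun z r => hμ.integrableOn_ball hfl z r
  refine ⟨?_, W.hasTrace_homExt hμ hθ hreg hα hp hq hfl (fun j => hint _ _) hfe,
    W.lintegral_homExt_lt_top hμ hθ hreg hp fun j => hint _ _⟩
  by_cases htop : Metric.ediam (Set.univ : Set (Boundary Ω)) = ∞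
  · exact W.energy_homExt_lt_top_of_unbounded hμ hθ (hν.regularUpTo hμ hθ h0 (Or.inr htop))
      hα hp hq hαθ (fun j => hint _ _) hfe
  · exact W.energy_homExt_lt_top_of_bounded hμ hθ hreg htop
      (nonempty_boundarySet hΩ).to_subtype hα hp hq hαθ hint hfe

end WhitneyData

end Main

theorem mainTheorem7 {Ω : Type*} [MetricSpace Ω] [LocallyCompactSpace Ω]
    [MeasurableSpace Ω] [BorelSpace Ω] (hΩ : ¬ CompleteSpace Ω)
    (μ : Measure Ω) (hμ : IsDoubling μ) (hU : IsUniformDomain Ω)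
    (ν : Measure (Boundary Ω)) (θ : ℝ) (hθ : 0 < θ) (hν : IsCodimRegular μ ν θ)
    (α p : ℝ) (q : ℝ≥0∞) (hp : 1 ≤ p) (hq : 1 ≤ q) (hα : 0 < α) (hαθ : α + θ / p < 1) :
    (∃ (ι : Type) (_ : Countable ι), Nonempty (WhitneyData Ω ι)) ∧
    ∀ (ι : Type) [Countable ι] (W : WhitneyData Ω ι),
      (∀ f : Boundary Ω → ℝ, MemBesov ν α p q f →
        MemBesov μ (α + θ / p) p q (W.ext ν f) ∧
        HasTrace μ ν p (W.ext ν f) (traceOp μ (W.ext ν f)) ∧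
        traceOp μ (W.ext ν f) =ᵐ[ν] f ∧
        ∀ g : Boundary Ω → ℝ, HasTrace μ ν p (W.ext ν f) g → g =ᵐ[ν] f) ∧
      (∀ f : Boundary Ω → ℝ, MemHB ν α p q f →
        MemHB μ (α + θ / p) p q (W.homExt ν f) ∧
        HasTrace μ ν p (W.homExt ν f) (traceOp μ (W.homExt ν f)) ∧
        traceOp μ (W.homExt ν f) =ᵐ[ν] f ∧
        ∀ g : Boundary Ω → ℝ, HasTrace μ ν p (W.homExt ν f) g → g =ᵐ[ν] f) := by
  refine ⟨exists_whitneyData hΩ hμ, fun ι _ W => ⟨fun f hf => ?_, fun f hf => ?_⟩⟩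
  all_goals
    have hs0 : 0 < α + θ / p := by
      have := one_pos.trans_le hp
      positivity
    have := hμ.secondCountableTopology
    have := hμ.isLocallyFiniteMeasure
  · obtain ⟨hE, hT, hL⟩ := W.homExt_spec hΩ hμ hθ hν hp hq hα hαθ hf.1
    have hc : Continuous (W.ext ν f) := W.continuous_ext f
    have hT' := W.hasTrace_ext hT
    have hTf := hT'.traceOp_ae_eq hμ hp hc
    exact ⟨⟨⟨hc.locallyIntegrable, W.energy_ext_lt_top hμ hs0 hαθ hp hq hE (hL hf.2)⟩,
      W.memLp_ext hμ hp (hL hf.2)⟩, hT'.congr_ae hTf, hTf, fun g hg => hT'.ae_eq hμ hp hc hg⟩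
  · obtain ⟨hE, hT, -⟩ := W.homExt_spec hΩ hμ hθ hν hp hq hα hαθ hf
    have hc : Continuous (W.homExt ν f) := W.continuous_homExt f
    have hTf := hT.traceOp_ae_eq hμ hp hc
    exact ⟨⟨hc.locallyIntegrable, hE⟩, hT.congr_ae hTf, hTf, fun g hg => hT.ae_eq hμ hp hc hg⟩
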